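/- Let $g\ge 2$ and let $\Gamma\subset \mathrm{PSL}(2,\mathbb R)$ be a marked, purely hyperbolic Fuchsian group of genus $g$: a discrete subgroup whose nontrivial elements are all hyperbolic, with generators $\alpha_1,\dots,\alpha_g,\beta_1,\dots,\beta_g$ subject to the single relation $\gamma_1\cdots\gamma_g=1$, where $\gamma_k=\alpha_k\beta_k\alpha_k^{-1}\beta_k^{-1}$. Let $X=\Gamma\backslash\mathbb U$, where $\mathbb U$ is the upper half-plane and $z=x+iy$. Let $F\subset\mathbb U$ be a standard fundamental domain: a closed hyperbolic polygon whose $\Gamma$-translates cover $\mathbb U$ and have disjoint interiors, with $4g$ geodesic sides $a_k,\ b_k'=\beta_k^{-1}b_k,\ a_k'=\alpha_k^{-1}a_k,\ b_k$ and positively oriented boundary, a simple closed curve, $\partial F=\sum_{k=1}^g(a_k+b_k'-a_k'-b_k)$, the sides being traversed in this cyclic order. Write $c(0)$ for the initial point of a side $c$. Identify conformal metrics $e^{\phi}|dz|^2$ on $X$ with $$\mathcal{CM}(X)=\{\phi\in C^\infty(\mathbb U,\mathbb R):\ \phi\circ\gamma+\log|\gamma'|^2=\phi\ \text{ for all }\gamma\in\Gamma\},$$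 identify $C^\infty(X,\mathbb R)$ with the smooth $\Gamma$-invariant real functions on $\mathbb U$, and let $\phi_{hyp}=-2\log y$ be the hyperbolic metric. For $\phi\in\mathcal{CM}(X)$ and $\gamma\in\Gamma$ put $$\omega[\phi]=(|\phi_z|^2+e^\phi)\,dz\wedge d\bar z,\qquad \theta_{\gamma^{-1}}[\phi]=\Big(\phi-\tfrac12\log|\gamma'|^2\Big)\Big(\frac{\gamma''}{\gamma'}dz-\frac{\overline{\gamma''}}{\overline{\gamma'}}d\bar z\Big).$$ There are functions $l_\gamma:\mathbb U\to\mathbb C$ $(\gamma\in\Gamma)$ with $l_1=0$ and $dl_\gamma=\theta_\gamma[\phi_{hyp}]$. Fix any such choice and put $\Theta_{\gamma_1,\gamma_2}=l_{\gamma_2}\circ\gamma_1^{-1}-l_{\gamma_1\gamma_2}+l_{\gamma_1}$. The Liouville action functional is $$S[\phi]=S[\phi;X]=\frac i2\Big(\int_F\omega[\phi]-\sum_{k=1}^g\Big(\int_{b_k}\theta_{\beta_k}[\phi]-\int_{a_k}\theta_{\alpha_k}[\phi]\Big)+\langle\Theta,V\rangle\Big),$$ where $$\langle\Theta,V\rangle=\sum_{k=1}^g\Big(\Theta_{\alpha_k,\beta_k}(a_k(0))-\Theta_{\beta_k,\alpha_k}(b_k(0))+\Theta_{\gamma_k^{-1},\alpha_k\beta_k}(b_k(0))\Big)-\sum_{k=1}^{g-1}\Theta_{\gamma_g^{-1}\cdots\gamma_{k+1}^{-1},\,\gamma_k^{-1}}(b_g(0)).$$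 Let $K_\phi=-2e^{-\phi}\phi_{z\bar z}$ be the Gaussian curvature of $e^\phi|dz|^2$. Call $\phi\in\mathcal{CM}(X)$ a critical point of $S$ if $\frac{d}{dt}S[\phi+t\sigma]\big|_{t=0}$ exists and equals $0$ for all $\sigma\in C^\infty(X,\mathbb R)$. Then: 1. $S$ is real-valued on $\mathcal{CM}(X)$, and for all $\phi\in\mathcal{CM}(X)$ and $\sigma\in C^\infty(X,\mathbb R)$ $$\frac{d}{dt}S[\phi+t\sigma]\Big|_{t=0}=\iint_F(K_\phi+1)\,\sigma\,e^\phi\,dx\,dy .$$ 2. The Euler–Lagrange equation of $S$ is the Liouville equation: $\phi\in\mathcal{CM}(X)$ is a critical point of $S$ if and only if $K_\phi=-1$ on $\mathbb U$. 3. $\phi_{hyp}\in\mathcal{CM}(X)$, and $\phi_{hyp}$ is the only critical point of $S$ in $\mathcal{CM}(X)$. 4. This critical point is non-degenerate: the second variation $B(\sigma,\tau)=\frac{\partial^2}{\partial s\,\partial t}S[\phi_{hyp}+s\sigma+t\tau]\big|_{s=t=0}$ exists and is a symmetric, non-degenerate bilinear form on $C^\infty(X,\mathbb R)$, with $B(\sigma,\sigma)>0$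 for $\sigma\neq0$. 5. The critical value is twice the hyperbolic area of $X$: $S[\phi_{hyp}]=2\iint_F\frac{dx\,dy}{y^2}=4\pi(2g-2)$. -/

import Mathlib

open MeasureTheory
open scoped MatrixGroups ContDiff UpperHalfPlane

noncomputable section

namespace FuchsianLiouville

/-! ### The group `PSL(2, ℝ)` acting on the upper half-plane -/

lemma center_le_ker :
    Subgroup.center SL(2, ℝ) ≤ (MulAction.toPermHom SL(2, ℝ) ℍ).ker := by
  intro A hA
  obtain ⟨r, hr, hA⟩ := Matrix.SpecialLinearGroup.mem_center_iff.mp hA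
  have hr' : r = 1 ∨ r = -1 := by
    have : r ^ 2 = 1 := by simpa using hr
    simpa using this
  rw [MonoidHom.mem_ker]
  ext z : 1
  rcases hr' with rfl | rfl
  · have : A = 1 := Subtype.ext (by rw [← hA]; simp)
    simp [this]
  · have : A = -1 := Subtype.ext (by
      rw [← hA, Matrix.SpecialLinearGroup.coe_neg, Matrix.SpecialLinearGroup.coe_one, map_neg,
        map_one])
    rw [this]
    have h : ((-1 : SL(2, ℝ)) : GL (Fin 2) ℝ) = -1 := by ext i j; simp
    show ((-1 : SL(2, ℝ)) : GL (Fin 2) ℝ) • z = z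
    rw [h, UpperHalfPlane.neg_smul, one_smul]

/-- The action of `PSL(2, ℝ)` on `ℍ` by Möbius transformations, induced by that of `SL(2, ℝ)`. -/
instance : MulAction PSL(2, ℝ) ℍ :=
  MulAction.compHom ℍ
    (QuotientGroup.lift _ (MulAction.toPermHom SL(2, ℝ) ℍ) center_le_ker :
      PSL(2, ℝ) →* Equiv.Perm ℍ)

lemma mk_smul (A : SL(2, ℝ)) (z : ℍ) : (QuotientGroup.mk A : PSL(2, ℝ)) • z = A • z := rfl

instance : ContinuousConstSMul PSL(2, ℝ) ℍ where
  continuous_const_smul γ := by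
    induction γ using QuotientGroup.induction_on with
    | H A => exact continuous_const_smul A

/-- Hyperbolicity of an element of `PSL(2, ℝ)` (it does not depend on the sign of the matrix). -/
def IsHyperbolic (γ : PSL(2, ℝ)) : Prop :=
  ∃ A : SL(2, ℝ), (QuotientGroup.mk A : PSL(2, ℝ)) = γ ∧ (A : Matrix (Fin 2) (Fin 2) ℝ).IsHyperbolic

/-- The word `[α₁, β₁] ⋯ [α_g, β_g]` in the free group on `α₁, …, α_g, β₁, …, β_g`. -/
def surfaceRelator (g : ℕ) : FreeGroup (Fin g ⊕ Fin g) :=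
  (List.ofFn fun k : Fin g =>
    FreeGroup.of (Sum.inl k) * FreeGroup.of (Sum.inr k) *
      (FreeGroup.of (Sum.inl k))⁻¹ * (FreeGroup.of (Sum.inr k))⁻¹).prod

/-- A marked purely hyperbolic Fuchsian group of genus `g`: a discrete subgroup of `PSL(2, ℝ)`
all of whose nontrivial elements are hyperbolic, with standard generators `α k, β k` which
satisfy the single relation `[α₁, β₁] ⋯ [α_g, β_g] = 1`. -/
structure MarkedFuchsianGroup (g : ℕ) where
  /-- the group -/
  Γ : Subgroup PSL(2, ℝ)
  discrete : DiscreteTopology Γ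
  hyperbolic : ∀ γ ∈ Γ, γ ≠ 1 → IsHyperbolic γ
  /-- the generators `α_k` -/
  α : Fin g → Γ
  /-- the generators `β_k` -/
  β : Fin g → Γ
  generates : Function.Surjective (FreeGroup.lift (Sum.elim α β))
  single_relation :
    (FreeGroup.lift (Sum.elim α β)).ker = Subgroup.normalClosure {surfaceRelator g}

/-- `γ_k = [α_k, β_k]`. -/
def MarkedFuchsianGroup.comm {g : ℕ} (M : MarkedFuchsianGroup g) (k : Fin g) : M.Γ :=
  M.α k * M.β k * (M.α k)⁻¹ * (M.β k)⁻¹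

/-! ### Calculus on the upper half-plane -/

/-- A function on `ℍ` written in the coordinate `z` (the values off the open upper half-plane
are irrelevant). -/
def coord {E : Type*} (f : ℍ → E) : ℂ → E := fun z => f (UpperHalfPlane.ofComplex z)

/-- `∂f/∂z`. -/
def dz (f : ℂ → ℂ) (z : ℂ) : ℂ := (fderiv ℝ f z 1 - Complex.I * fderiv ℝ f z Complex.I) / 2

/-- `∂f/∂z̄`. -/
def dzbar (f : ℂ → ℂ) (z : ℂ) : ℂ := (fderiv ℝ f z 1 + Complex.I * fderiv ℝ f z Complex.I) / 2

/-- `f ∈ C^∞(ℍ, ℝ)`. -/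
def IsSmooth (f : ℍ → ℝ) : Prop := ContDiffOn ℝ ∞ (coord f) {z : ℂ | 0 < z.im}

/-- The complex coordinate expression of a real function on `ℍ`. -/
def coordC (f : ℍ → ℝ) : ℂ → ℂ := fun z => ((coord f z : ℝ) : ℂ)

/-- The Möbius transformation `γ` as a function of the coordinate `z`. -/
def mob (γ : PSL(2, ℝ)) : ℂ → ℂ := coord fun z => ((γ • z : ℍ) : ℂ)

/-- The differential form `p dz + q dz̄` at a point. -/
def oneForm (p q : ℂ) : ℂ →L[ℝ] ℂ :=
  p • ContinuousLinearMap.id ℝ ℂ + q • (Complex.conjCLE : ℂ →L[ℝ] ℂ)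

/-- The space `CM(X)` of conformal metrics `e^φ |dz|²` on `X = Γ \ ℍ`. -/
def conformalMetrics (Γ : Subgroup PSL(2, ℝ)) : Set (ℍ → ℝ) :=
  {φ | IsSmooth φ ∧
    ∀ γ ∈ Γ, ∀ z : ℍ, φ (γ • z) + Real.log (‖deriv (mob γ) z‖ ^ 2) = φ z}

/-- The space `C^∞(X, ℝ)` of smooth functions on `X = Γ \ ℍ`, as `Γ`-invariant smooth
functions on `ℍ`. -/
def smoothFunctions (Γ : Subgroup PSL(2, ℝ)) : Submodule ℝ (ℍ → ℝ) where
  carrier := {σ | IsSmooth σ ∧ ∀ γ ∈ Γ, ∀ z : ℍ, σ (γ • z) = σ z}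
  zero_mem' := ⟨contDiffOn_const, fun _ _ _ => rfl⟩
  add_mem' := fun {σ τ} hσ hτ =>
    ⟨hσ.1.add hτ.1, fun γ h z => by simp [hσ.2 γ h z, hτ.2 γ h z]⟩
  smul_mem' := fun c {σ} hσ =>
    ⟨contDiffOn_const.smul hσ.1, fun γ h z => by simp [hσ.2 γ h z]⟩

/-- The hyperbolic metric `e^φ |dz|² = |dz|² / y²`. -/
def phiHyp : ℍ → ℝ := fun z => -2 * Real.log z.im

/-- The Gaussian curvature `K = -2 e^{-φ} φ_{z z̄}` of `e^φ |dz|²`; the Liouville equation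
is `K = -1`, that is, `φ_{z z̄} = e^φ / 2`. -/
def curvature (φ : ℍ → ℝ) (z : ℍ) : ℝ :=
  -2 * Real.exp (-φ z) * (dz (dzbar (coordC φ)) z).re

/-! ### The cocycle `Ψ[φ] = ω[φ] - θ[φ] - Θ` -/

/-- The coefficient of `dz ∧ dz̄` in `ω[φ] = (|φ_z|² + e^φ) dz ∧ dz̄`. -/
def omega (φ : ℍ → ℝ) (z : ℂ) : ℂ :=
  ((‖dz (coordC φ) z‖ ^ 2 + Real.exp (coord φ z) : ℝ) : ℂ)

/-- The `1`-form `θ_γ[φ]`; with `h = γ⁻¹` it is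
`(φ - ½ log |h'|²) (h''/h' dz - conj (h''/h') dz̄)`. -/
def theta (φ : ℍ → ℝ) (γ : PSL(2, ℝ)) (z : ℂ) : ℂ →L[ℝ] ℂ :=
  ((coord φ z - 1 / 2 * Real.log (‖deriv (mob γ⁻¹) z‖ ^ 2) : ℝ) : ℂ) •
    oneForm (deriv (deriv (mob γ⁻¹)) z / deriv (mob γ⁻¹) z)
      (-(starRingEnd ℂ) (deriv (deriv (mob γ⁻¹)) z / deriv (mob γ⁻¹) z))

/-- `l` is a `0`-form valued group `1`-cochain with `dl = θ[φ_hyp]`. As the bar symbol `[1]` is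
zero, a cochain vanishes at the identity of `Γ`. -/
structure IsPrimitive (Γ : Subgroup PSL(2, ℝ)) (l : Γ → ℍ → ℂ) : Prop where
  normalized : l 1 = 0
  hasFDerivAt : ∀ (γ : Γ) (z : ℍ), HasFDerivAt (coord (l γ)) (theta phiHyp γ z) (z : ℂ)

/-- `Θ = δl`: the group coboundary, with `γ · f = f ∘ γ⁻¹`. -/
def Theta {Γ : Subgroup PSL(2, ℝ)} (l : Γ → ℍ → ℂ) (γ₁ γ₂ : Γ) (z : ℍ) : ℂ :=
  l γ₂ (γ₁⁻¹ • z) - l (γ₁ * γ₂) z + l γ₁ z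

/-! ### Chains and the evaluation pairing -/

/-- Paths in `ℍ` (singular `1`-simplices) with arbitrary endpoints. -/
abbrev Arc : Type := Σ p : ℍ × ℍ, Path p.1 p.2

/-- A path in `ℍ` as a path in `ℂ`. -/
def Arc.toComplex (c : Arc) : Path (c.1.1 : ℂ) (c.1.2 : ℂ) :=
  c.2.map UpperHalfPlane.continuous_coe

/-- The image of a path under `γ`. -/
def Arc.translate (γ : PSL(2, ℝ)) (c : Arc) : Arc :=
  ⟨(γ • c.1.1, γ • c.1.2), c.2.map (continuous_const_smul γ)⟩

/-- The same path with the opposite orientation. -/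
def Arc.reverse (c : Arc) : Arc := ⟨(c.1.2, c.1.1), c.2.symm⟩

/-- Integer combinations of `c ⊗ [γ]`, `c` a path. -/
abbrev Chain11 (Γ : Subgroup PSL(2, ℝ)) : Type := (Arc × Γ) →₀ ℤ

/-- Integer combinations of `z ⊗ [γ₁|γ₂]`, `z` a point. -/
abbrev Chain02 (Γ : Subgroup PSL(2, ℝ)) : Type := (ℍ × Γ × Γ) →₀ ℤ

/-- `∫_F f dz ∧ dz̄`, where `dz ∧ dz̄ = -2i dx ∧ dy`. -/
def pair20 (f : ℂ → ℂ) (F : Set ℍ) : ℂ :=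
  ∫ z in (UpperHalfPlane.coe '' F), f z * (-2 * Complex.I)

/-- The pairing with `c ⊗ [γ]` is `∫_c ϖ_γ`. -/
def pair11 {Γ : Subgroup PSL(2, ℝ)} (ϖ : Γ → ℂ → ℂ →L[ℝ] ℂ) (c : Chain11 Γ) : ℂ :=
  c.sum fun x n => (n : ℂ) * curveIntegral (ϖ x.2) x.1.toComplex

/-- The pairing with `z ⊗ [γ₁|γ₂]` is `ϖ_{γ₁,γ₂}(z)`. -/
def pair02 {Γ : Subgroup PSL(2, ℝ)} (ϖ : Γ → Γ → ℍ → ℂ) (c : Chain02 Γ) : ℂ :=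
  c.sum fun x n => (n : ℂ) * ϖ x.2.1 x.2.2 x.1

/-! ### Fundamental polygons -/

/-- A geodesic segment of the hyperbolic plane, parametrized on `[0, 1]` proportionally to
arc length. -/
structure IsGeodesicSegment (c : Arc) : Prop where
  dist_eq : ∀ s t : unitInterval, dist (c.2 s) (c.2 t) = |(s : ℝ) - t| * dist c.1.1 c.1.2
  smooth : ContDiffOn ℝ ∞ c.toComplex.extend (Set.Icc 0 1)

/-- The oriented sides `a_k, b_k', -a_k', -b_k` (in this order), where `a_k' = α_k⁻¹ a_k` and
`b_k' = β_k⁻¹ b_k`. -/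
def boundarySide {g : ℕ} (M : MarkedFuchsianGroup g) (a b : Fin g → Arc) (k : Fin g) :
    Fin 4 → Arc :=
  ![a k, (b k).translate (M.β k)⁻¹, ((a k).translate (M.α k)⁻¹).reverse, (b k).reverse]

/-- The winding number about `z` of the `1`-cycle formed by a finite family of arcs. -/
def windingNumber {ι : Type*} [Fintype ι] (c : ι → Arc) (z : ℂ) : ℂ :=
  (2 * Real.pi * Complex.I)⁻¹ *
    ∑ i, curveIntegral (fun ζ => oneForm (ζ - z)⁻¹ 0) (c i).toComplex

/-- A standard fundamental domain of a marked Fuchsian group: a closed non-Euclidean polygon `F`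
with `4g` sides `a_k, a_k', b_k', b_k`, where `α_k a_k' = a_k` and `β_k b_k' = b_k`, and with
positively oriented boundary `∂F = ∑ (a_k + b_k' - a_k' - b_k)`. -/
structure FundamentalPolygon {g : ℕ} (M : MarkedFuchsianGroup g) where
  /-- the closed polygon -/
  F : Set ℍ
  /-- the sides `a_k` -/
  a : Fin g → Arc
  /-- the sides `b_k` -/
  b : Fin g → Arc
  a_geodesic : ∀ k, IsGeodesicSegment (a k)
  b_geodesic : ∀ k, IsGeodesicSegment (b k)
  /- consecutive sides share a vertex -/
  vertex₁ : ∀ k, (a k).1.2 = (M.β k)⁻¹ • (b k).1.1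
  vertex₂ : ∀ k, (M.β k)⁻¹ • (b k).1.2 = (M.α k)⁻¹ • (a k).1.2
  vertex₃ : ∀ k, (M.α k)⁻¹ • (a k).1.1 = (b k).1.2
  vertex₄ : ∀ k, (b k).1.1 = (a (finRotate g k)).1.1
  /- the boundary is a simple closed curve -/
  simple : Set.InjOn
    (fun x : (Fin g × Fin 4) × unitInterval => (boundarySide M a b x.1.1 x.1.2).2 x.2)
    {x | x.2 ≠ 1}
  compact : IsCompact F
  frontier_eq : frontier F =
    ⋃ i : Fin g × Fin 4, Set.range (boundarySide M a b i.1 i.2).2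
  /- the boundary is positively oriented: it winds once around the points inside -/
  winding_inside : ∀ z ∈ interior F,
    windingNumber (fun i : Fin g × Fin 4 => boundarySide M a b i.1 i.2) z = 1
  winding_outside : ∀ z ∉ F,
    windingNumber (fun i : Fin g × Fin 4 => boundarySide M a b i.1 i.2) z = 0
  /- the translates of `F` cover `ℍ` and have disjoint interiors -/
  covers : ∀ z : ℍ, ∃ γ : M.Γ, γ • z ∈ F
  disjoint : ∀ γ : M.Γ, γ ≠ 1 → ∀ z ∈ interior F, γ • z ∉ interior F

namespace FundamentalPolygon

variable {g : ℕ} {M : MarkedFuchsianGroup g} (P : FundamentalPolygon M)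

/-- `L = ∑ (b_k ⊗ [β_k] - a_k ⊗ [α_k])`. -/
def L : Chain11 M.Γ :=
  ∑ k, (Finsupp.single (P.b k, M.β k) 1 - Finsupp.single (P.a k, M.α k) 1)

/-- `V = ∑_k (a_k(0) ⊗ [α_k|β_k] - b_k(0) ⊗ [β_k|α_k] + b_k(0) ⊗ [γ_k⁻¹|α_k β_k])
- ∑_{k<g} b_g(0) ⊗ [γ_g⁻¹ ⋯ γ_{k+1}⁻¹|γ_k⁻¹]`.
(For `k j : Fin g`, the vertex `b_g(0)` is `b j` with `j + 1 = g`, and `List.drop (k + 1)`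
leaves the commutators after the `k`-th.) -/
def V : Chain02 M.Γ :=
  ∑ k, (Finsupp.single ((P.a k).1.1, M.α k, M.β k) 1
      - Finsupp.single ((P.b k).1.1, M.β k, M.α k) 1
      + Finsupp.single ((P.b k).1.1, (M.comm k)⁻¹, M.α k * M.β k) 1)
  - ∑ k : Fin g, ∑ j : Fin g, if (k : ℕ) + 1 < g ∧ (j : ℕ) + 1 = g then
      Finsupp.single ((P.b j).1.1,
        (((List.ofFn M.comm).drop (k + 1)).map (·⁻¹)).reverse.prod, (M.comm k)⁻¹) 1
    else 0

/-- `(i/2) ⟨Ψ[φ], Σ⟩`, where `Ψ[φ] = ω[φ] - θ[φ] - Θ`, `Θ = δl`, and `Σ = F + L - V`. -/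
def evaluation (l : M.Γ → ℍ → ℂ) (φ : ℍ → ℝ) : ℂ :=
  Complex.I / 2 *
    (pair20 (omega φ) P.F
      + pair11 (fun γ z => -theta φ (γ : PSL(2, ℝ)) z) P.L
      + pair02 (fun γ₁ γ₂ z => -Theta l γ₁ γ₂ z) (-P.V))

/-- The Liouville action functional `S[φ; X]`. -/
def liouvilleAction (l : M.Γ → ℍ → ℂ) (φ : ℍ → ℝ) : ℝ := (P.evaluation l φ).re

end FundamentalPolygon

/-! ### Critical points -/

/-- `φ` is a critical point of `S`: all first variations along `C^∞(X, ℝ)` exist and vanish. -/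
def IsCriticalPoint (Γ : Subgroup PSL(2, ℝ)) (S : (ℍ → ℝ) → ℝ) (φ : ℍ → ℝ) : Prop :=
  ∀ σ ∈ smoothFunctions Γ, HasDerivAt (fun t : ℝ => S (φ + t • σ)) 0 0

/-- `B` is the second variation of `S` at `φ`: the bilinear form
`B(σ, τ) = ∂²/∂s∂t S[φ + sσ + tτ]` at `s = t = 0`. -/
def IsSecondVariation (Γ : Subgroup PSL(2, ℝ)) (S : (ℍ → ℝ) → ℝ) (φ : ℍ → ℝ)
    (B : LinearMap.BilinForm ℝ (smoothFunctions Γ)) : Prop :=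
  ∀ σ τ : smoothFunctions Γ,
    (∀ s : ℝ, DifferentiableAt ℝ
      (fun t : ℝ => S (φ + s • (σ : ℍ → ℝ) + t • (τ : ℍ → ℝ))) 0) ∧
    HasDerivAt
      (fun s : ℝ => deriv (fun t : ℝ => S (φ + s • (σ : ℍ → ℝ) + t • (τ : ℍ → ℝ))) 0)
      (B σ τ) 0

end FuchsianLiouville

end

open FuchsianLiouville

noncomputable section

namespace FuchsianLiouville

/-! ### The Cauchy–Pompeiu formula -/

/-! Since `Θ = δl`, evaluating `Θ` on `V` telescopes: the vertex relations of the polygon and the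
surface relation cancel everything except the increments of `l` along the sides `a_k`, `b_k`, and
these are integrals of `θ[φ_hyp]` (`sum_coboundary`). As `θ[φ]` is affine in `φ`, the action becomes
`∬_F (|φ_z|² + e^φ) dx dy` plus a real linear functional of `φ - φ_hyp`, namely half the imaginary
part of `kappaPairing` (`evaluation_eq`). Reality, independence of `l` and the critical value can be
read off this formula; for `φ_hyp` the boundary term is zero and each summand of the integrand is
`1/y²`.

The first variation is a gradient integral plus the same linear functional at `σ`. Apply Stokes to
`σ φ_z dz`. Under the side pairings `φ_z dz` fails to be invariant exactly by `γ''/γ' dz`, so the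
boundary integral reproduces that functional and `∬ (K + 1) σ e^φ` remains (`im_kappaPairing`,
`firstVariation_eq`). Testing with `σ = K + 1` gives the Liouville equation. Uniqueness and
positivity of the second variation are convexity: the Dirichlet part is a nonnegative quadratic form
and the exponential is strictly increasing.

The polygon is known only through its frontier and the winding numbers of its boundary, so Stokes is
derived from the Cauchy–Pompeiu formula. Integrating the Cauchy kernel along the boundary cycle
turns it into the winding number, which is the indicator of `F` off a null set.

The area `A = 2π(2g - 2)` is Gauss–Bonnet for the polygon. Let `I` be its angle sum. A continuous
logarithm of the directions of chords of the boundary gives `A + I = (4g - 2)(2m + 1)π` for some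
integer `m` (`exists_sum_vertexAngle`, `volume_real_eq_sum_sideArg`). The `4g` vertices lie in one
orbit and translates of `F` overlap in null sets, so `I ≤ 2π` (`sum_vertexAngle_le`); two sides
meeting at angle zero would overlap, so `I > 0` (`vertexAngle_pos`). The derivatives `γ'` form a
multiplicative cocycle, and the telescoping identity in `ℂˣ` shows that `A` is a multiple of `2π`
(`exists_volume_real_eq`). Size estimates force `m = 0`; then `I` is a multiple of `2π` in `(0,
2π]`, hence `I = 2π`. -/

lemma continuous_polar_fderiv {u : ℂ → ℂ} (hu : ContDiff ℝ 1 u) (a : ℂ) :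
    Continuous fun p : ℝ × ℝ =>
      fderiv ℝ u (p.1 * Complex.exp (p.2 * Complex.I)) (a * Complex.exp (p.2 * Complex.I)) := by
  have h := hu.continuous_fderiv one_ne_zero
  exact (h.comp (by fun_prop)).clm_apply (by fun_prop)

lemma integrableOn_polar_fderiv {u : ℂ → ℂ} (hu : ContDiff ℝ 1 u) (hc : HasCompactSupport u)
    (a : ℂ) :
    IntegrableOn (fun p : ℝ × ℝ =>
      fderiv ℝ u (p.1 * Complex.exp (p.2 * Complex.I)) (a * Complex.exp (p.2 * Complex.I)))
      (Set.Ioi 0 ×ˢ Set.Ioo (-Real.pi) Real.pi) := by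
  obtain ⟨R, hR⟩ := (hc.fderiv ℝ).isCompact.isBounded.subset_closedBall 0
  have h1 : IntegrableOn (fun p : ℝ × ℝ =>
      fderiv ℝ u (p.1 * Complex.exp (p.2 * Complex.I)) (a * Complex.exp (p.2 * Complex.I)))
      (Set.Icc 0 R ×ˢ Set.Icc (-Real.pi) Real.pi) :=
    (continuous_polar_fderiv hu a).continuousOn.integrableOn_compact
      (isCompact_Icc.prod isCompact_Icc)
  refine h1.of_forall_sdiff_eq_zero (measurableSet_Ioi.prod measurableSet_Ioo) ?_
  rintro ⟨r, θ⟩ ⟨⟨hr, hθ⟩, hn⟩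
  have hr' : R < r := by
    by_contra! h
    exact hn ⟨⟨le_of_lt hr, h⟩, Set.Ioo_subset_Icc_self hθ⟩
  have h0 : fderiv ℝ u (r * Complex.exp (θ * Complex.I)) = 0 := by
    by_contra h
    have := hR (subset_tsupport _ h)
    rw [mem_closedBall_zero_iff, norm_mul, Complex.norm_exp_ofReal_mul_I, mul_one,
      Complex.norm_real, Real.norm_of_nonneg (le_of_lt hr)] at this
    linarith
  simp [h0]

lemma hasDerivAt_polar_radius {u : ℂ → ℂ} (hu : ContDiff ℝ 1 u) (r θ : ℝ) :
    HasDerivAt (fun r : ℝ => u (r * Complex.exp (θ * Complex.I)))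
      (fderiv ℝ u (r * Complex.exp (θ * Complex.I)) (1 * Complex.exp (θ * Complex.I))) r :=
  ((hu.differentiable one_ne_zero).differentiableAt.hasFDerivAt).comp_hasDerivAt r
    (((hasDerivAt_id r).ofReal_comp).mul_const _)

lemma hasDerivAt_polar_angle {u : ℂ → ℂ} (hu : ContDiff ℝ 1 u) (r θ : ℝ) :
    HasDerivAt (fun θ : ℝ => u (r * Complex.exp (θ * Complex.I)))
      (r * fderiv ℝ u (r * Complex.exp (θ * Complex.I))
        (Complex.I * Complex.exp (θ * Complex.I))) θ := by
  have h1 : HasDerivAt (fun θ : ℝ => (r : ℂ) * Complex.exp (θ * Complex.I))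
      (r • (Complex.I * Complex.exp (θ * Complex.I))) θ := by
    have := ((((hasDerivAt_id θ).ofReal_comp).mul_const Complex.I).cexp).const_mul (r : ℂ)
    simpa [mul_comm] using this
  have := ((hu.differentiable one_ne_zero).differentiableAt.hasFDerivAt).comp_hasDerivAt θ h1
  rwa [map_smul, Complex.real_smul] at this

lemma exists_forall_lt_eq_zero {u : ℂ → ℂ} (hc : HasCompactSupport u) :
    ∃ R : ℝ, 0 ≤ R ∧ ∀ z : ℂ, R < ‖z‖ → u z = 0 := by
  obtain ⟨R, hR⟩ := hc.isCompact.isBounded.subset_closedBall 0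
  refine ⟨max R 0, le_max_right _ _, fun z hz => ?_⟩
  by_contra h
  have := hR (subset_tsupport _ h)
  rw [mem_closedBall_zero_iff] at this
  exact absurd (lt_of_le_of_lt (le_max_left R 0) hz) (not_lt.mpr this)

lemma integral_polar_radius {u : ℂ → ℂ} (hu : ContDiff ℝ 1 u) (hc : HasCompactSupport u)
    (θ : ℝ) :
    ∫ r in Set.Ioi (0 : ℝ), fderiv ℝ u (r * Complex.exp (θ * Complex.I))
      (1 * Complex.exp (θ * Complex.I)) = -u 0 := by
  obtain ⟨R, hR0, hR⟩ := exists_forall_lt_eq_zero hc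
  obtain ⟨R', hR0', hR'⟩ := exists_forall_lt_eq_zero (u := fun z => fderiv ℝ u z
    (1 * Complex.exp (θ * Complex.I))) ((hc.fderiv ℝ).comp_left
      (g := fun L : ℂ →L[ℝ] ℂ => L (1 * Complex.exp (θ * Complex.I))) (by simp))
  have hcont : Continuous fun r : ℝ => fderiv ℝ u (r * Complex.exp (θ * Complex.I))
      (1 * Complex.exp (θ * Complex.I)) :=
    ((hu.continuous_fderiv one_ne_zero).comp (by fun_prop)).clm_apply (by fun_prop)
  have hnorm : ∀ r : ℝ, 0 ≤ r → ‖(r : ℂ) * Complex.exp (θ * Complex.I)‖ = r := fun r hr => by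
    rw [norm_mul, Complex.norm_exp_ofReal_mul_I, mul_one, Complex.norm_real,
      Real.norm_of_nonneg hr]
  have hint : IntegrableOn (fun r : ℝ => fderiv ℝ u (r * Complex.exp (θ * Complex.I))
      (1 * Complex.exp (θ * Complex.I))) (Set.Ioi 0) := by
    refine (hcont.continuousOn.integrableOn_compact (isCompact_Icc (a := 0) (b := R')))
      |>.of_forall_sdiff_eq_zero measurableSet_Ioi ?_
    rintro r ⟨hr, hn⟩
    apply hR'
    rw [hnorm r (le_of_lt hr)]
    by_contra! h
    exact hn ⟨le_of_lt hr, h⟩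
  have hlim : Filter.Tendsto (fun r : ℝ => u (r * Complex.exp (θ * Complex.I))) Filter.atTop
      (nhds 0) := by
    refine tendsto_const_nhds.congr' ?_
    filter_upwards [Filter.eventually_gt_atTop R] with r hr
    rw [hR _ (by rw [hnorm r (hR0.trans hr.le)]; exact hr)]
  have := integral_Ioi_of_hasDerivAt_of_tendsto' (a := 0)
    (fun r _ => hasDerivAt_polar_radius hu r θ) hint hlim
  simpa using this

/-- Up to the factor `r`, the integrand is the angular derivative of `u` on the circle of radius
`r`, and `u` is `2π`-periodic in the angle. -/
lemma integral_polar_angle {u : ℂ → ℂ} (hu : ContDiff ℝ 1 u) {r : ℝ} (hr : 0 < r) :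
    ∫ θ in Set.Ioo (-Real.pi) Real.pi, fderiv ℝ u (r * Complex.exp (θ * Complex.I))
      (Complex.I * Complex.exp (θ * Complex.I)) = 0 := by
  have hcont : Continuous fun θ : ℝ => fderiv ℝ u (r * Complex.exp (θ * Complex.I))
      (Complex.I * Complex.exp (θ * Complex.I)) :=
    ((hu.continuous_fderiv one_ne_zero).comp (by fun_prop)).clm_apply (by fun_prop)
  rw [← integral_Ioc_eq_integral_Ioo,
    ← intervalIntegral.integral_of_le (by linarith [Real.pi_pos])]
  have h := intervalIntegral.integral_eq_sub_of_hasDerivAt (a := -Real.pi) (b := Real.pi)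
    (fun θ _ => hasDerivAt_polar_angle hu r θ)
    ((continuous_const.mul hcont).intervalIntegrable _ _)
  rw [intervalIntegral.integral_const_mul] at h
  have h0 : (r : ℂ) ≠ 0 := by exact_mod_cast hr.ne'
  have h1 : Complex.exp ((-Real.pi : ℝ) * Complex.I) = Complex.exp (Real.pi * Complex.I) := by
    rw [Complex.exp_pi_mul_I, Complex.ofReal_neg, neg_mul, Complex.exp_neg,
      Complex.exp_pi_mul_I]
    norm_num
  rw [h1, sub_self] at h
  exact (mul_eq_zero.mp h).resolve_left h0

/-- In polar coordinates the Jacobian `r` cancels the pole: `r u_{z̄} / z = ½ (u_r + (i/r) u_θ)`. On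
each ray the radial part integrates to `-u(0)`, and the angular part integrates to zero by
periodicity. -/
lemma integral_dzbar_div {u : ℂ → ℂ} (hu : ContDiff ℝ 1 u) (hc : HasCompactSupport u) :
    ∫ z, dzbar u z / z = -Real.pi * u 0 := by
  rw [← Complex.integral_comp_polarCoord_symm]
  have h1 : Set.EqOn (fun p : ℝ × ℝ => p.1 • (dzbar u (Complex.polarCoord.symm p) /
      Complex.polarCoord.symm p))
      (fun p => (1 / 2 : ℂ) * (fderiv ℝ u (p.1 * Complex.exp (p.2 * Complex.I))
        (1 * Complex.exp (p.2 * Complex.I))) + (Complex.I / 2) *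
        (fderiv ℝ u (p.1 * Complex.exp (p.2 * Complex.I))
        (Complex.I * Complex.exp (p.2 * Complex.I)))) (polarCoord.target) := by
    rintro ⟨r, θ⟩ ⟨hr, hθ⟩
    have hr0 : (r : ℂ) ≠ 0 := by exact_mod_cast (ne_of_gt hr)
    have he : Complex.polarCoord.symm (r, θ) = r * Complex.exp (θ * Complex.I) := by
      rw [Complex.polarCoord_symm_apply, Complex.exp_mul_I]
      simp
    simp only [he, dzbar]
    have hdec : ∀ (L : ℂ →L[ℝ] ℂ) (z : ℂ), L z = z.re * L 1 + z.im * L Complex.I := by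
      intro L z
      conv_lhs => rw [← Complex.re_add_im z]
      have h1 : (z.re : ℂ) + z.im * Complex.I = z.re • (1 : ℂ) + z.im • Complex.I := by simp
      rw [h1, map_add, map_smul, map_smul]
      simp
    set L := fderiv ℝ u (r * Complex.exp (θ * Complex.I))
    rw [hdec L (1 * _), hdec L (Complex.I * _)]
    have e1 : (Complex.exp (θ * Complex.I)).re = Real.cos θ := Complex.exp_ofReal_mul_I_re θ
    have e2 : (Complex.exp (θ * Complex.I)).im = Real.sin θ := Complex.exp_ofReal_mul_I_im θ
    simp only [one_mul, Complex.mul_re, Complex.mul_im, Complex.I_re, Complex.I_im, e1, e2]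
    have hexp : Complex.exp (θ * Complex.I) * ((Real.cos θ : ℂ) - Real.sin θ * Complex.I) = 1 := by
      have : (Real.cos θ : ℂ) ^ 2 + (Real.sin θ : ℂ) ^ 2 = 1 := by
        exact_mod_cast Real.cos_sq_add_sin_sq θ
      rw [Complex.exp_mul_I, ← Complex.ofReal_cos, ← Complex.ofReal_sin]
      linear_combination this - (Real.sin θ : ℂ) ^ 2 * Complex.I_sq
    have hne := Complex.exp_ne_zero (θ * Complex.I)
    rw [Complex.real_smul, ← mul_div_assoc, div_eq_iff (mul_ne_zero hr0 hne)]
    simp only [Complex.ofReal_sub, Complex.ofReal_add, Complex.ofReal_mul, Complex.ofReal_zero]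
    linear_combination (-(r : ℂ) / 2 * (L 1 + Complex.I * L Complex.I)) * hexp
      - (r / 2 * Complex.exp (θ * Complex.I) * Real.sin θ * L Complex.I) * Complex.I_sq
  rw [setIntegral_congr_fun polarCoord.open_target.measurableSet h1]
  have ht : polarCoord.target = Set.Ioi (0 : ℝ) ×ˢ Set.Ioo (-Real.pi) Real.pi := rfl
  have i1 := integrableOn_polar_fderiv hu hc 1
  have i2 := integrableOn_polar_fderiv hu hc Complex.I
  rw [ht, integral_add (i1.const_mul _) (i2.const_mul _), integral_const_mul,
    integral_const_mul]
  have j1 : ∫ p in Set.Ioi (0 : ℝ) ×ˢ Set.Ioo (-Real.pi) Real.pi,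
      fderiv ℝ u (p.1 * Complex.exp (p.2 * Complex.I)) (1 * Complex.exp (p.2 * Complex.I))
      = -(2 * Real.pi) * u 0 := by
    rw [Measure.volume_eq_prod, ← Measure.prod_restrict, integral_prod_symm]
    · rw [setIntegral_congr_fun measurableSet_Ioo
        (fun θ _ => integral_polar_radius hu hc θ)]
      rw [setIntegral_const, Real.volume_real_Ioo_of_le (by linarith [Real.pi_pos])]
      rw [Complex.real_smul]
      push_cast
      ring
    · rwa [IntegrableOn, Measure.volume_eq_prod, ← Measure.prod_restrict] at i1
  have j2 : ∫ p in Set.Ioi (0 : ℝ) ×ˢ Set.Ioo (-Real.pi) Real.pi,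
      fderiv ℝ u (p.1 * Complex.exp (p.2 * Complex.I))
        (Complex.I * Complex.exp (p.2 * Complex.I)) = 0 := by
    rw [Measure.volume_eq_prod, ← Measure.prod_restrict, integral_prod]
    · rw [setIntegral_congr_fun measurableSet_Ioi (fun r hr => integral_polar_angle hu hr)]
      simp
    · rwa [IntegrableOn, Measure.volume_eq_prod, ← Measure.prod_restrict] at i2
  rw [j1, j2]
  ring

lemma dzbar_comp_add (u : ℂ → ℂ) (w z : ℂ) : dzbar (fun z => u (z + w)) z = dzbar u (z + w) := by
  simp only [dzbar, fderiv_comp_add_right]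

/-- The Cauchy–Pompeiu formula for compactly supported functions. -/
lemma integral_dzbar_div_sub {u : ℂ → ℂ} (hu : ContDiff ℝ 1 u) (hc : HasCompactSupport u)
    (w : ℂ) : ∫ z, dzbar u z / (z - w) = -Real.pi * u w := by
  have h := integral_dzbar_div (u := fun z => u (z + w)) (hu.comp (contDiff_id.add contDiff_const))
    (hc.comp_homeomorph (Homeomorph.addRight w))
  rw [zero_add] at h
  rw [← h, ← integral_add_right_eq_self (fun z => dzbar u z / (z - w)) w]
  simp only [dzbar_comp_add, add_sub_cancel_right]

/-! ### Stokes' theorem for a cycle with prescribed winding numbers -/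

/-- The Jacobian `r` of polar coordinates cancels `1/|z|`. This function dominates the Cauchy kernel
near its pole. -/
lemma integrable_indicator_ball_inv_norm :
    Integrable fun z : ℂ => (Set.Iio (1 : ℝ)).indicator (fun r => r⁻¹) ‖z‖ := by
  rw [integrable_fun_norm_addHaar (μ := volume)
    (f := (Set.Iio (1 : ℝ)).indicator (fun r => r⁻¹))]
  have h : IntegrableOn (fun _ : ℝ => (1 : ℝ)) (Set.Ioo 0 1) := by simp
  refine (h.integrable_indicator measurableSet_Ioo).integrableOn.congr_fun (fun r hr => ?_)
    measurableSet_Ioi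
  have hr0 : r ≠ 0 := ne_of_gt hr
  by_cases h1 : r < 1
  · simp [Set.indicator, h1, Complex.finrank_real_complex, hr0, Set.mem_Ioi.mp hr]
  · simp [Set.indicator, h1]

/-- Near the pole the kernel is compared with a translate of `1/|z|` on the unit disc, and elsewhere
it is at most `1`. Translation invariance makes the bound uniform in `w`, which Fubini along a curve
requires. -/
lemma exists_bound_integral_norm_div {g : ℂ → ℂ} (hg : Continuous g) (hc : HasCompactSupport g) :
    (∀ w, Integrable fun z => g z * (w - z)⁻¹) ∧
      ∃ C, ∀ w, ∫ z, ‖g z * (w - z)⁻¹‖ ≤ C := by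
  obtain ⟨M, hM⟩ := hg.bounded_above_of_compact_support hc
  have hM0 : 0 ≤ M := (norm_nonneg _).trans (hM 0)
  set k : ℂ → ℝ := fun z => (Set.Iio (1 : ℝ)).indicator (fun r => r⁻¹) ‖z‖
  have hk : Integrable k := integrable_indicator_ball_inv_norm
  have hkw : ∀ w, Integrable fun z => k (w - z) := fun w => hk.comp_sub_left w
  have hgi : Integrable fun z => ‖g z‖ := (hg.integrable_of_hasCompactSupport hc).norm
  have hb : ∀ w z, ‖g z * (w - z)⁻¹‖ ≤ M * k (w - z) + ‖g z‖ := by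
    intro w z
    rw [norm_mul, norm_inv]
    by_cases h : ‖w - z‖ < 1
    · have : k (w - z) = ‖w - z‖⁻¹ := by simp [k, h]
      rw [this]
      have := mul_le_mul_of_nonneg_right (hM z) (inv_nonneg.mpr (norm_nonneg (w - z)))
      linarith [norm_nonneg (g z)]
    · have : k (w - z) = 0 := by simp [k, h]
      rw [this]
      have h2 : ‖w - z‖⁻¹ ≤ 1 := inv_le_one_of_one_le₀ (not_lt.mp h)
      nlinarith [norm_nonneg (g z)]
  have hi : ∀ w, Integrable fun z => g z * (w - z)⁻¹ := by
    intro w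
    refine (((hkw w).const_mul M).add hgi).mono'
      (hg.aestronglyMeasurable.mul ?_) (Filter.Eventually.of_forall (hb w))
    exact (by fun_prop : Measurable fun z : ℂ => (w - z)⁻¹).aestronglyMeasurable
  refine ⟨hi, M * (∫ z, k z) + ∫ z, ‖g z‖, fun w => ?_⟩
  refine (integral_mono (hi w).norm (((hkw w).const_mul M).add hgi) (hb w)).trans ?_
  have := integral_sub_left_eq_self k volume w
  simp only [Pi.add_apply]
  rw [integral_add ((hkw w).const_mul M) hgi, integral_const_mul, this]

lemma oneForm_apply (p q v : ℂ) : oneForm p q v = p * v + q * (starRingEnd ℂ) v := by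
  simp [oneForm]

/-- The Cauchy kernel representation of `∫_γ f dz` for compactly supported `f`. -/
lemma curveIntegral_eq_integral_dzbar {p q : ℂ} (γ : Path p q)
    (hγ : ContDiffOn ℝ 1 γ.extend (Set.Icc 0 1)) {f : ℂ → ℂ} (hf : ContDiff ℝ 1 f)
    (hc : HasCompactSupport f) :
    Integrable (fun z => dzbar f z * curveIntegral (fun ζ => oneForm (ζ - z)⁻¹ 0) γ) ∧
    curveIntegral (fun ζ => oneForm (f ζ) 0) γ = (Real.pi : ℂ)⁻¹ *
      ∫ z, dzbar f z * curveIntegral (fun ζ => oneForm (ζ - z)⁻¹ 0) γ := by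
  set g' : ℝ → ℂ := derivWithin γ.extend (Set.Icc 0 1)
  have hg' : ContinuousOn g' (Set.Icc 0 1) :=
    hγ.continuousOn_derivWithin uniqueDiffOn_Icc_zero_one le_rfl
  have hcont : Continuous (dzbar f) := by
    have := hf.continuous_fderiv one_ne_zero
    unfold dzbar
    fun_prop
  have hsupp : HasCompactSupport (dzbar f) := by
    have := hc.fderiv ℝ
    refine this.comp_left (g := fun L : ℂ →L[ℝ] ℂ => (L 1 + Complex.I * L Complex.I) / 2) ?_
    simp
  obtain ⟨hi, C, hC⟩ := exists_bound_integral_norm_div hcont hsupp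
  set H : ℝ × ℂ → ℂ := fun x => g' x.1 * (dzbar f x.2 * (γ.extend x.1 - x.2)⁻¹)
  have hmeas : AEStronglyMeasurable g' (volume.restrict (Set.Ioc 0 1)) :=
    (hg'.mono Set.Ioc_subset_Icc_self).aestronglyMeasurable measurableSet_Ioc
  have hHm : AEStronglyMeasurable H ((volume.restrict (Set.Ioc (0 : ℝ) 1)).prod volume) := by
    refine hmeas.comp_fst.mul (Measurable.aestronglyMeasurable ?_)
    have h1 := γ.continuous_extend.measurable
    have h2 := hcont.measurable
    fun_prop
  -- Fubini applies: the velocity is bounded on `[0, 1]`, and the plane integral of the kernel is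
  -- bounded uniformly in the point of the curve.
  have hHint : Integrable H ((volume.restrict (Set.Ioc (0 : ℝ) 1)).prod volume) := by
    rw [integrable_prod_iff hHm]
    refine ⟨Filter.Eventually.of_forall fun t => (hi (γ.extend t)).const_mul (g' t), ?_⟩
    obtain ⟨B, hB⟩ := isCompact_Icc.exists_bound_of_continuousOn hg'
    refine Integrable.mono' (g := fun _ => B * C) (integrable_const _)
      hHm.norm.integral_prod_right' ?_
    rw [ae_restrict_iff' measurableSet_Ioc]
    refine Filter.Eventually.of_forall fun t ht => ?_
    have h0 : 0 ≤ B := (norm_nonneg _).trans (hB t (Set.Ioc_subset_Icc_self ht))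
    rw [Real.norm_of_nonneg (integral_nonneg fun _ => norm_nonneg _)]
    simp only [H, norm_mul (g' t)]
    rw [integral_const_mul]
    exact mul_le_mul (hB t (Set.Ioc_subset_Icc_self ht)) (hC _)
      (integral_nonneg fun _ => norm_nonneg _) h0
  have hker : ∀ z, dzbar f z * curveIntegral (fun ζ => oneForm (ζ - z)⁻¹ 0) γ =
      ∫ t in Set.Ioc (0 : ℝ) 1, H (t, z) := by
    intro z
    rw [curveIntegral_def, intervalIntegral.integral_of_le zero_le_one, ← integral_const_mul]
    refine integral_congr_ae (Filter.Eventually.of_forall fun t => ?_)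
    simp only [curveIntegralFun_def, oneForm_apply, H, g']
    ring
  refine ⟨?_, ?_⟩
  · simp_rw [hker]
    exact hHint.integral_prod_right
  · simp_rw [hker]
    rw [← integral_integral_swap (f := fun t z => H (t, z)) hHint, curveIntegral_def,
      intervalIntegral.integral_of_le zero_le_one, ← integral_const_mul]
    refine integral_congr_ae (Filter.Eventually.of_forall fun t => ?_)
    have hP := integral_dzbar_div_sub hf hc (γ.extend t)
    have h2 : ∫ z, H (t, z) = g' t * (Real.pi * f (γ.extend t)) := by
      simp only [H]
      rw [integral_const_mul]
      congr 1
      rw [← neg_inj, ← neg_mul, ← hP, ← integral_neg]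
      refine integral_congr_ae (Filter.Eventually.of_forall fun z => ?_)
      simp only
      rw [← neg_sub z, inv_neg, mul_neg, neg_neg, div_eq_mul_inv]
    have hpi : (Real.pi : ℂ) ≠ 0 := by exact_mod_cast Real.pi_ne_zero
    simp only [curveIntegralFun_def, oneForm_apply, h2]
    field_simp
    ring

/-- The curve, viewed as a map of the plane that depends only on the real part, has a singular
derivative everywhere, so its image is null. -/
lemma volume_range_arc_eq_zero {p q : ℂ} (γ : Path p q)
    (hγ : ContDiffOn ℝ 1 γ.extend (Set.Icc 0 1)) : volume (Set.range γ) = 0 := by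
  set s : Set ℂ := {z | z.re ∈ Set.Icc (0 : ℝ) 1}
  have hsub : Set.range γ ⊆ (fun z : ℂ => γ.extend z.re) '' s := by
    rintro _ ⟨t, rfl⟩
    exact ⟨((t : ℝ) : ℂ), by simp [s, t.2.1, t.2.2], by simp⟩
  refine measure_mono_null hsub ?_
  refine addHaar_image_eq_zero_of_det_fderivWithin_eq_zero volume
    (f' := fun z => (fderivWithin ℝ γ.extend (Set.Icc 0 1) z.re).comp Complex.reCLM)
    (fun z hz => ?_) (fun z _ => ?_)
  · exact ((hγ.differentiableOn one_ne_zero _ hz).hasFDerivWithinAt).comp z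
      Complex.reCLM.hasFDerivAt.hasFDerivWithinAt (fun w hw => hw)
  · by_contra h
    have h1 := LinearMap.equivOfDetNeZero _ h
    have hinj : Function.Injective (((fderivWithin ℝ γ.extend (Set.Icc 0 1) z.re).comp
        Complex.reCLM : ℂ →L[ℝ] ℂ) : ℂ →ₗ[ℝ] ℂ) :=
      (LinearMap.equivOfDetNeZero _ h).injective
    have := @hinj Complex.I 0 (by simp)
    exact Complex.I_ne_zero this

/-- A closed cycle of smooth arcs in `ℍ` which bounds the compact set `F`, in the sense that it
consists of the frontier of `F` and has winding number `1` in the interior of `F` and `0` outside. -/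
structure BoundsRegion {ι : Type*} [Fintype ι] (c : ι → Arc) (F : Set ℍ) : Prop where
  compact : IsCompact F
  smooth : ∀ i, ContDiffOn ℝ ∞ (c i).toComplex.extend (Set.Icc 0 1)
  frontier_eq : frontier F = ⋃ i, Set.range (c i).2
  inside : ∀ z ∈ interior F, windingNumber c z = 1
  outside : ∀ z ∉ F, windingNumber c z = 0

/-- The open upper half-plane as a subset of `ℂ`. -/
abbrev upperSet : Set ℂ := {z : ℂ | 0 < z.im}

lemma isOpen_upperSet : IsOpen upperSet := isOpen_lt continuous_const Complex.continuous_im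

lemma Arc.toComplex_apply (c : Arc) (t : unitInterval) : c.toComplex t = (c.2 t : ℂ) := rfl

lemma Arc.toComplex_mem (c : Arc) (t : unitInterval) : c.toComplex t ∈ upperSet :=
  (c.2 t).im_pos

lemma Arc.extend_mem (c : Arc) (t : ℝ) : c.toComplex.extend t ∈ upperSet :=
  c.toComplex_mem _

lemma measurableSet_coe_image {F : Set ℍ} (hF : IsCompact F) :
    MeasurableSet (UpperHalfPlane.coe '' F) :=
  (hF.image UpperHalfPlane.continuous_coe).isClosed.measurableSet

lemma curveIntegral_congr {ω₁ ω₂ : ℂ → ℂ →L[ℝ] ℂ} {p q : ℂ} (γ : Path p q)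
    (h : ∀ t : unitInterval, ω₁ (γ t) = ω₂ (γ t)) : curveIntegral ω₁ γ = curveIntegral ω₂ γ := by
  rw [curveIntegral_def, curveIntegral_def]
  refine intervalIntegral.integral_congr fun t _ => ?_
  simp only [curveIntegralFun_def]
  rw [show γ.extend t = γ (Set.projIcc 0 1 zero_le_one t) from rfl, h]

section

variable {ι : Type*} [Fintype ι] {c : ι → Arc} {F : Set ℍ}

lemma BoundsRegion.range_subset (hb : BoundsRegion c F) (i : ι) (t : unitInterval) :
    (c i).2 t ∈ F := by
  refine hb.compact.isClosed.frontier_subset ?_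
  rw [hb.frontier_eq]
  exact Set.mem_iUnion.mpr ⟨i, t, rfl⟩

lemma BoundsRegion.volume_frontier (hb : BoundsRegion c F) :
    volume (UpperHalfPlane.coe '' frontier F) = 0 := by
  rw [hb.frontier_eq, Set.image_iUnion]
  refine measure_iUnion_null fun i => ?_
  rw [← Set.range_comp]
  exact volume_range_arc_eq_zero (c i).toComplex ((hb.smooth i).of_le (by norm_cast))

/-- Summing the Cauchy kernel representation over the arcs produces `2πi` times the winding number,
and this is `2πi` times the indicator of `F` off the null frontier. -/
lemma BoundsRegion.sum_curveIntegral_of_compactSupport (hb : BoundsRegion c F) {f : ℂ → ℂ}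
    (hf : ContDiff ℝ 1 f) (hc : HasCompactSupport f) (hs : tsupport f ⊆ upperSet) :
    ∑ i, curveIntegral (fun z => oneForm (f z) 0) (c i).toComplex =
      2 * Complex.I * ∫ z in UpperHalfPlane.coe '' F, dzbar f z := by
  have h1 := fun i => curveIntegral_eq_integral_dzbar (c i).toComplex
    ((hb.smooth i).of_le (by norm_cast)) hf hc
  rw [Finset.sum_congr rfl fun i _ => (h1 i).2, ← Finset.mul_sum,
    ← integral_finsetSum _ fun i _ => (h1 i).1]
  have hpi : (Real.pi : ℂ) ≠ 0 := by exact_mod_cast Real.pi_ne_zero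
  have key : ∫ z, ∑ i, dzbar f z * curveIntegral (fun ζ => oneForm (ζ - z)⁻¹ 0) (c i).toComplex =
      (2 * Real.pi * Complex.I) * ∫ z in UpperHalfPlane.coe '' F, dzbar f z := by
    rw [← integral_indicator (measurableSet_coe_image hb.compact), ← integral_const_mul]
    refine integral_congr_ae ?_
    have hae : ∀ᵐ z : ℂ, z ∉ UpperHalfPlane.coe '' frontier F :=
      measure_eq_zero_iff_ae_notMem.mp hb.volume_frontier
    filter_upwards [hae] with z hz
    rw [← Finset.mul_sum]
    have hw : ∑ i, curveIntegral (fun ζ => oneForm (ζ - z)⁻¹ 0) (c i).toComplex =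
        (2 * Real.pi * Complex.I) * windingNumber c z := by
      rw [windingNumber, mul_inv_cancel_left₀]
      simp [hpi]
    rw [hw]
    by_cases hzU : z ∈ upperSet
    · lift z to ℍ using hzU
      have hzf : z ∉ frontier F := fun h => hz ⟨z, h, rfl⟩
      by_cases hzF : z ∈ F
      · have hint : z ∈ interior F := by
          by_contra h
          exact hzf ⟨subset_closure hzF, h⟩
        rw [hb.inside z hint, Set.indicator_of_mem (Set.mem_image_of_mem _ hzF)]
        ring
      · rw [hb.outside z hzF, Set.indicator_of_notMem]
        · ring
        · rintro ⟨w, hw, hwz⟩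
          exact hzF (UpperHalfPlane.coe_injective hwz ▸ hw)
    -- Nothing is assumed about winding numbers off the upper half-plane, but the support of `f`
    -- does not reach there.
    · have hf0 : dzbar f z = 0 := by
        have : fderiv ℝ f z = 0 := by
          by_contra h
          exact hzU (hs (support_fderiv_subset ℝ h))
        simp [dzbar, this]
      rw [Set.indicator_of_notMem, hf0]
      · ring
      · rintro ⟨w, hw, hwz⟩
        exact hzU (hwz ▸ w.im_pos)
  rw [key]
  field_simp

/-- A smooth cutoff function for a compact subset of the upper half-plane. -/
lemma exists_cutoff {K : Set ℂ} (hK : IsCompact K) (hKU : K ⊆ upperSet) :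
    ∃ χ : ℂ → ℝ, ContDiff ℝ ∞ χ ∧ HasCompactSupport χ ∧ tsupport χ ⊆ upperSet ∧
      ∀ᶠ z in nhdsSet K, χ z = 1 := by
  obtain ⟨L, hL, hKL, hLU⟩ := exists_compact_between hK isOpen_upperSet hKU
  obtain ⟨χ, h1, h0, -⟩ := exists_contMDiffMap_one_nhds_of_subset_interior (n := ⊤)
    (modelWithCornersSelf ℝ ℂ) hK.isClosed hKL
  have hsub : tsupport χ ⊆ L := by
    refine closure_minimal (fun z hz => ?_) hL.isClosed
    by_contra h
    exact hz (h0 z h)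
  exact ⟨χ, χ.contMDiff.contDiff, hL.of_isClosed_subset (isClosed_tsupport _) hsub,
    hsub.trans hLU, h1⟩

lemma contDiff_cutoff_mul {f : ℂ → ℂ} (hf : ContDiffOn ℝ 1 f upperSet) {χ : ℂ → ℝ}
    (hχ : ContDiff ℝ ∞ χ) (hs : tsupport χ ⊆ upperSet) :
    ContDiff ℝ 1 fun z => (χ z : ℂ) * f z := by
  rw [contDiff_iff_contDiffAt]
  intro z
  by_cases hz : z ∈ upperSet
  · refine ContDiffAt.mul ?_ (hf.contDiffAt (isOpen_upperSet.mem_nhds hz))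
    exact (Complex.ofRealCLM.contDiff.comp (hχ.of_le (by norm_cast))).contDiffAt
  · have h0 := notMem_tsupport_iff_eventuallyEq.mp fun h => hz (hs h)
    refine (contDiffAt_const (c := (0 : ℂ))).congr_of_eventuallyEq ?_
    filter_upwards [h0] with w hw
    simp [hw]

/-- Stokes' theorem: `∮_{∂F} f dz = 2i ∬_F f_{z̄} dx dy`. -/
theorem BoundsRegion.sum_curveIntegral (hb : BoundsRegion c F) {f : ℂ → ℂ}
    (hf : ContDiffOn ℝ 1 f upperSet) :
    ∑ i, curveIntegral (fun z => oneForm (f z) 0) (c i).toComplex =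
      2 * Complex.I * ∫ z in UpperHalfPlane.coe '' F, dzbar f z := by
  -- The cutoff equals `1` on a neighbourhood of `F`, frontier included, so multiplying by it
  -- changes neither side of the formula.
  obtain ⟨χ, hχ, hχc, hχs, hχ1⟩ := exists_cutoff
    (hb.compact.image UpperHalfPlane.continuous_coe) (by rintro _ ⟨z, _, rfl⟩; exact z.im_pos)
  have hsupp : tsupport (fun z => (χ z : ℂ) * f z) ⊆ tsupport χ := by
    refine closure_mono fun z hz h => hz ?_
    simp [h]
  have h := hb.sum_curveIntegral_of_compactSupport (contDiff_cutoff_mul hf hχ hχs)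
    (hχc.of_isClosed_subset (isClosed_tsupport _) hsupp) (hsupp.trans hχs)
  have hloc : ∀ z ∈ UpperHalfPlane.coe '' F, (fun z => (χ z : ℂ) * f z) =ᶠ[nhds z] f := by
    intro z hz
    filter_upwards [(Filter.eventually_of_mem hχ1 fun _ h => h).filter_mono (nhds_le_nhdsSet hz)]
      with w hw
    simp [show χ w = 1 from hw]
  rw [setIntegral_congr_fun (measurableSet_coe_image hb.compact)
    (g := dzbar f) fun z hz => by simp only [dzbar, (hloc z hz).fderiv_eq]] at h
  rw [← h]
  refine Finset.sum_congr rfl fun i _ => curveIntegral_congr _ fun t => ?_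
  exact congrArg (oneForm · 0) (hloc ((c i).toComplex t) ⟨_, hb.range_subset i t, rfl⟩).self_of_nhds.symm

end

/-! ### Möbius transformations in the coordinate `z` -/

lemma coord_coe {E : Type*} (f : ℍ → E) (z : ℍ) : coord f z = f z := by
  simp [coord]

lemma coe_ofComplex {z : ℂ} (hz : z ∈ upperSet) : ((UpperHalfPlane.ofComplex z : ℍ) : ℂ) = z := by
  rw [UpperHalfPlane.ofComplex_apply_of_im_pos hz]

lemma coe_mem_upperSet (z : ℍ) : (z : ℂ) ∈ upperSet := z.im_pos

lemma mob_coe (γ : PSL(2, ℝ)) (z : ℍ) : mob γ z = (γ • z : ℍ) := by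
  simp [mob, coord]

lemma mob_mem (γ : PSL(2, ℝ)) (z : ℂ) : mob γ z ∈ upperSet := (γ • UpperHalfPlane.ofComplex z).im_pos

lemma coord_mob {E : Type*} (f : ℍ → E) (γ : PSL(2, ℝ)) (z : ℂ) :
    coord f (mob γ z) = f (γ • UpperHalfPlane.ofComplex z) := by
  simp [coord, mob]

lemma linear_ne_zero {a b c d : ℝ} (h : a * d - b * c = 1) {z : ℂ} (hz : z ∈ upperSet) :
    (c : ℂ) * z + d ≠ 0 := by
  intro h0
  have h1 := congrArg Complex.im h0
  have h2 := congrArg Complex.re h0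
  simp only [Complex.add_im, Complex.mul_im, Complex.ofReal_re, Complex.ofReal_im, Complex.zero_im,
    Complex.add_re, Complex.mul_re, Complex.zero_re] at h1 h2
  have hc : c = 0 := by
    have : c * z.im = 0 := by linarith
    exact (mul_eq_zero.mp this).resolve_right (ne_of_gt hz)
  subst hc
  have hd : d = 0 := by linarith
  subst hd
  simp at h

lemma exists_mobius (γ : PSL(2, ℝ)) : ∃ a b c d : ℝ, a * d - b * c = 1 ∧
    ∀ z ∈ upperSet, mob γ z = (a * z + b) / (c * z + d) := by
  obtain ⟨A, rfl⟩ := QuotientGroup.mk_surjective γ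
  refine ⟨A 0 0, A 0 1, A 1 0, A 1 1, ?_, fun z hz => ?_⟩
  · have := A.det_coe
    rwa [Matrix.det_fin_two] at this
  · lift z to ℍ using hz
    rw [mob_coe, mk_smul, UpperHalfPlane.coe_specialLinearGroup_apply]
    simp

lemma hasDerivAt_mobius {a b c d : ℝ} (h : a * d - b * c = 1) {z : ℂ} (hz : z ∈ upperSet) :
    HasDerivAt (fun z : ℂ => ((a : ℂ) * z + b) / (c * z + d)) (1 / (c * z + d) ^ 2) z := by
  have hne := linear_ne_zero h hz
  have h1 : HasDerivAt (fun z : ℂ => (a : ℂ) * z + b) a z := by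
    simpa using ((hasDerivAt_id z).const_mul (a : ℂ)).add_const (b : ℂ)
  have h2 : HasDerivAt (fun z : ℂ => (c : ℂ) * z + d) c z := by
    simpa using ((hasDerivAt_id z).const_mul (c : ℂ)).add_const (d : ℂ)
  refine (h1.div h2 hne).congr_deriv ?_
  have h' : (a : ℂ) * d - b * c = 1 := by exact_mod_cast h
  congr 1
  linear_combination h'

lemma eventually_upperSet {z : ℂ} (hz : z ∈ upperSet) : ∀ᶠ w in nhds z, w ∈ upperSet :=
  isOpen_upperSet.mem_nhds hz

lemma deriv_mob_eq {γ : PSL(2, ℝ)} {a b c d : ℝ} (h : a * d - b * c = 1)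
    (hm : ∀ z ∈ upperSet, mob γ z = (a * z + b) / (c * z + d)) {z : ℂ} (hz : z ∈ upperSet) :
    deriv (mob γ) z = 1 / (c * z + d) ^ 2 := by
  refine ((hasDerivAt_mobius h hz).congr_of_eventuallyEq ?_).deriv
  filter_upwards [eventually_upperSet hz] with w hw using hm w hw

lemma deriv_deriv_mob_eq {γ : PSL(2, ℝ)} {a b c d : ℝ} (h : a * d - b * c = 1)
    (hm : ∀ z ∈ upperSet, mob γ z = (a * z + b) / (c * z + d)) {z : ℂ} (hz : z ∈ upperSet) :
    deriv (deriv (mob γ)) z = -2 * c / (c * z + d) ^ 3 := by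
  have hne := linear_ne_zero h hz
  have h2 : HasDerivAt (fun z : ℂ => (c : ℂ) * z + d) c z := by
    simpa using ((hasDerivAt_id z).const_mul (c : ℂ)).add_const (d : ℂ)
  have h3 := (h2.pow 2).inv (pow_ne_zero 2 hne)
  have h4 : HasDerivAt (fun z : ℂ => 1 / ((c : ℂ) * z + d) ^ 2) (-2 * c / (c * z + d) ^ 3) z := by
    have h5 : (fun z : ℂ => 1 / ((c : ℂ) * z + d) ^ 2) = ((fun z : ℂ => (c : ℂ) * z + d) ^ 2)⁻¹ := by
      funext w
      simp
    rw [h5]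
    refine h3.congr_deriv ?_
    simp only [Pi.pow_apply]
    push_cast
    field_simp
  refine (h4.congr_of_eventuallyEq ?_).deriv
  filter_upwards [eventually_upperSet hz] with w hw using deriv_mob_eq h hm hw

lemma differentiableOn_mob (γ : PSL(2, ℝ)) : DifferentiableOn ℂ (mob γ) upperSet := by
  obtain ⟨a, b, c, d, h, hm⟩ := exists_mobius γ
  intro z hz
  exact ((hasDerivAt_mobius h hz).differentiableAt.differentiableWithinAt).congr
    (fun w hw => hm w hw) (hm z hz)

lemma hasDerivAt_mob (γ : PSL(2, ℝ)) {z : ℂ} (hz : z ∈ upperSet) :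
    HasDerivAt (mob γ) (deriv (mob γ) z) z :=
  ((differentiableOn_mob γ).differentiableAt (isOpen_upperSet.mem_nhds hz)).hasDerivAt

lemma contDiffOn_mob (γ : PSL(2, ℝ)) {n : WithTop ℕ∞} : ContDiffOn ℂ n (mob γ) upperSet :=
  (differentiableOn_mob γ).contDiffOn isOpen_upperSet

lemma differentiableOn_deriv_mob (γ : PSL(2, ℝ)) : DifferentiableOn ℂ (deriv (mob γ)) upperSet :=
  (differentiableOn_mob γ).deriv isOpen_upperSet

lemma contDiffOn_deriv_mob (γ : PSL(2, ℝ)) {n : WithTop ℕ∞} :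
    ContDiffOn ℂ n (deriv (mob γ)) upperSet :=
  (differentiableOn_deriv_mob γ).contDiffOn isOpen_upperSet

lemma hasDerivAt_deriv_mob (γ : PSL(2, ℝ)) {z : ℂ} (hz : z ∈ upperSet) :
    HasDerivAt (deriv (mob γ)) (deriv (deriv (mob γ)) z) z :=
  ((differentiableOn_deriv_mob γ).differentiableAt (isOpen_upperSet.mem_nhds hz)).hasDerivAt

lemma deriv_mob_ne_zero (γ : PSL(2, ℝ)) {z : ℂ} (hz : z ∈ upperSet) : deriv (mob γ) z ≠ 0 := by
  obtain ⟨a, b, c, d, h, hm⟩ := exists_mobius γ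
  rw [deriv_mob_eq h hm hz]
  exact one_div_ne_zero (pow_ne_zero 2 (linear_ne_zero h hz))

lemma im_mob (γ : PSL(2, ℝ)) {z : ℂ} (hz : z ∈ upperSet) :
    (mob γ z).im = z.im * ‖deriv (mob γ) z‖ := by
  obtain ⟨a, b, c, d, h, hm⟩ := exists_mobius γ
  have hne := linear_ne_zero h hz
  rw [deriv_mob_eq h hm hz, hm z hz, norm_div, norm_one, norm_pow, ← Complex.normSq_eq_norm_sq]
  have hN : Complex.normSq (c * z + d) ≠ 0 := by simpa using hne
  have e : (a * z + b : ℂ).im * (c * z + d : ℂ).re - (a * z + b : ℂ).re * (c * z + d : ℂ).im =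
      z.im := by
    simp
    linear_combination z.im * h
  rw [Complex.div_im, ← sub_div, e, mul_one_div]

lemma mob_mul (γ δ : PSL(2, ℝ)) (z : ℂ) : mob (γ * δ) z = mob γ (mob δ z) := by
  simp [mob, coord, mul_smul]

lemma deriv_mob_mul (γ δ : PSL(2, ℝ)) {z : ℂ} (hz : z ∈ upperSet) :
    deriv (mob (γ * δ)) z = deriv (mob γ) (mob δ z) * deriv (mob δ) z := by
  have h := (hasDerivAt_mob γ (mob_mem δ z)).comp z (hasDerivAt_mob δ hz)
  refine (h.congr_of_eventuallyEq ?_).deriv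
  exact Filter.Eventually.of_forall fun w => mob_mul γ δ w

lemma deriv_mob_one {z : ℂ} (hz : z ∈ upperSet) : deriv (mob 1) z = 1 := by
  refine ((hasDerivAt_id z).congr_of_eventuallyEq ?_).deriv
  filter_upwards [eventually_upperSet hz] with w hw
  simp [mob, coord, coe_ofComplex hw]

lemma dist_smul_smul (γ : PSL(2, ℝ)) (z w : ℍ) : dist (γ • z) (γ • w) = dist z w := by
  obtain ⟨A, rfl⟩ := QuotientGroup.mk_surjective γ
  rw [mk_smul, mk_smul, dist_smul]

instance : SMulInvariantMeasure PSL(2, ℝ) ℍ volume where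
  measure_preimage_smul γ s hs := by
    obtain ⟨A, rfl⟩ := QuotientGroup.mk_surjective γ
    exact MeasureTheory.measure_preimage_smul volume (A : GL (Fin 2) ℝ) s

/-! ### Wirtinger derivatives -/

/-- Writing real differentials as `p dz + q dz̄` turns the chain and product rules into identities
between coefficients, from which `dz_eq` and `dzbar_eq` extract the Wirtinger derivatives. -/
lemma clm_eq_oneForm (L : ℂ →L[ℝ] ℂ) :
    L = oneForm ((L 1 - Complex.I * L Complex.I) / 2) ((L 1 + Complex.I * L Complex.I) / 2) := by
  refine ContinuousLinearMap.ext fun z => ?_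
  have h1 : z = z.re • (1 : ℂ) + z.im • Complex.I := by simp
  conv_lhs => rw [h1, map_add, map_smul, map_smul]
  rw [oneForm_apply]
  conv_rhs => rw [h1]
  simp only [Complex.real_smul, map_add, map_mul, Complex.conj_ofReal, Complex.conj_I, map_one]
  linear_combination (z.im : ℂ) * (L Complex.I) * Complex.I_sq

lemma hasFDerivAt_oneForm {f : ℂ → ℂ} {z : ℂ} (h : DifferentiableAt ℝ f z) :
    HasFDerivAt f (oneForm (dz f z) (dzbar f z)) z := by
  have := h.hasFDerivAt
  rwa [clm_eq_oneForm (fderiv ℝ f z)] at this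

lemma dz_eq {f : ℂ → ℂ} {z p q : ℂ} (h : HasFDerivAt f (oneForm p q) z) : dz f z = p := by
  rw [dz, h.fderiv, oneForm_apply, oneForm_apply]
  simp only [map_one, Complex.conj_I]
  linear_combination (-(p - q) / 2) * Complex.I_sq

lemma dzbar_eq {f : ℂ → ℂ} {z p q : ℂ} (h : HasFDerivAt f (oneForm p q) z) : dzbar f z = q := by
  rw [dzbar, h.fderiv, oneForm_apply, oneForm_apply]
  simp only [map_one, Complex.conj_I]
  linear_combination ((p - q) / 2) * Complex.I_sq

lemma oneForm_add (p q p' q' : ℂ) : oneForm p q + oneForm p' q' = oneForm (p + p') (q + q') := by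
  ext
  simp only [add_apply, oneForm_apply]
  ring

lemma smul_oneForm (c p q : ℂ) : c • oneForm p q = oneForm (c * p) (c * q) := by
  ext
  simp only [smul_apply, oneForm_apply, smul_eq_mul]
  ring

lemma oneForm_neg (p q : ℂ) : -oneForm p q = oneForm (-p) (-q) := by
  ext
  simp only [neg_apply, oneForm_apply]
  ring

lemma hasFDerivAt_oneForm_of_hasDerivAt {f : ℂ → ℂ} {f' z : ℂ} (h : HasDerivAt f f' z) :
    HasFDerivAt f (oneForm f' 0) z := by
  refine (h.hasFDerivAt.restrictScalars ℝ).congr_fderiv ?_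
  ext v
  simp [oneForm_apply, mul_comm]

lemma hasFDerivAt_oneForm_comp {f g : ℂ → ℂ} {z p q g' : ℂ} (hf : HasFDerivAt f (oneForm p q) (g z))
    (hg : HasDerivAt g g' z) :
    HasFDerivAt (fun z => f (g z)) (oneForm (p * g') (q * (starRingEnd ℂ) g')) z := by
  refine (hf.comp z (hasFDerivAt_oneForm_of_hasDerivAt hg)).congr_fderiv ?_
  ext v
  simp only [ContinuousLinearMap.comp_apply, oneForm_apply, map_add, map_mul, map_zero]
  ring

lemma hasFDerivAt_oneForm_mul {f g : ℂ → ℂ} {z p q p' q' : ℂ} (hf : HasFDerivAt f (oneForm p q) z)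
    (hg : HasFDerivAt g (oneForm p' q') z) :
    HasFDerivAt (fun z => f z * g z) (oneForm (f z * p' + g z * p) (f z * q' + g z * q)) z := by
  refine (hf.mul hg).congr_fderiv ?_
  rw [smul_oneForm, smul_oneForm, oneForm_add]

lemma hasFDerivAt_re {f : ℂ → ℂ} {f' z : ℂ} (h : HasDerivAt f f' z) :
    HasFDerivAt (fun z => ((f z).re : ℂ)) (oneForm (f' / 2) ((starRingEnd ℂ) (f' / 2))) z := by
  have h1 := (Complex.ofRealCLM.comp Complex.reCLM).hasFDerivAt.comp z
    (hasFDerivAt_oneForm_of_hasDerivAt h)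
  refine h1.congr_fderiv ?_
  ext v
  simp only [ContinuousLinearMap.comp_apply, oneForm_apply, Complex.ofRealCLM_apply,
    Complex.reCLM_apply, Complex.re_eq_add_conj, map_mul, map_div₀, zero_mul, add_zero,
    Complex.conj_ofNat]
  ring

/-- Up to a constant, `log |f|²` is `2 Re log (f / f(z))`. Dividing by the value at `z` moves the
argument of the logarithm near `1`, away from the branch cut. -/
lemma hasFDerivAt_log_norm_sq {f : ℂ → ℂ} {f' z : ℂ} (h : HasDerivAt f f' z) (h0 : f z ≠ 0) :
    HasFDerivAt (fun z => ((Real.log (‖f z‖ ^ 2) : ℝ) : ℂ))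
      (oneForm (f' / f z) ((starRingEnd ℂ) (f' / f z))) z := by
  have h1 : HasDerivAt (fun w => Complex.log (f w / f z)) (f' / f z) z := by
    have := (h.div_const (f z)).clog (by simp [h0])
    simpa [h0] using this
  have h2 := hasFDerivAt_re ((h1.const_mul 2).add_const ((Real.log (‖f z‖ ^ 2) : ℝ) : ℂ))
  have e0 : 2 * (f' / f z) / 2 = f' / f z := by ring
  rw [e0] at h2
  refine h2.congr_of_eventuallyEq ?_
  · have hne : ∀ᶠ w in nhds z, f w ≠ 0 := h.continuousAt.eventually_ne h0
    filter_upwards [hne] with w hw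
    have e1 : ‖f w‖ = ‖f w / f z‖ * ‖f z‖ := by
      rw [norm_div, div_mul_cancel₀ _ (norm_ne_zero_iff.mpr h0)]
    have e2 : ‖f w / f z‖ ≠ 0 := by simp [hw, h0]
    simp only [Complex.add_re, Complex.mul_re, Complex.re_ofNat, Complex.im_ofNat, zero_mul,
      sub_zero, Complex.log_re, Complex.ofReal_re]
    rw [e1, mul_pow, Real.log_mul (pow_ne_zero 2 e2) (pow_ne_zero 2 (norm_ne_zero_iff.mpr h0)),
      Real.log_pow ]
    push_cast
    ring

lemma dzbar_coordC (f : ℍ → ℝ) {z : ℂ} (h : DifferentiableAt ℝ (coordC f) z) :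
    dzbar (coordC f) z = (starRingEnd ℂ) (dz (coordC f) z) := by
  have hre : ∀ v, (starRingEnd ℂ) (fderiv ℝ (coordC f) z v) = fderiv ℝ (coordC f) z v := by
    intro v
    have h1 := (Complex.conjCLE : ℂ →L[ℝ] ℂ).hasFDerivAt.comp z h.hasFDerivAt
    have h2 : (⇑(Complex.conjCLE : ℂ →L[ℝ] ℂ) ∘ coordC f) = coordC f := by
      funext w
      simp [coordC]
    rw [h2] at h1
    conv_rhs => rw [h1.fderiv]
    simp
  rw [dz, dzbar, map_div₀, map_sub, map_mul, hre, hre, Complex.conj_I, Complex.conj_ofNat]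
  ring

/-! ### The homological identity behind the Liouville action -/

lemma MarkedFuchsianGroup.prod_comm {g : ℕ} (M : MarkedFuchsianGroup g) :
    (List.ofFn M.comm).prod = 1 := by
  have h : surfaceRelator g ∈ (FreeGroup.lift (Sum.elim M.α M.β)).ker := by
    rw [M.single_relation]
    exact Subgroup.subset_normalClosure rfl
  rw [MonoidHom.mem_ker, surfaceRelator, map_list_prod, List.map_ofFn] at h
  rw [← h]
  congr 2
  funext k
  simp [MarkedFuchsianGroup.comm]

namespace FundamentalPolygon

variable {g : ℕ} {M : MarkedFuchsianGroup g} (P : FundamentalPolygon M)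

lemma smul_a_start (k : Fin g) : (M.α k)⁻¹ • (P.a k).1.1 = (P.b k).1.2 := P.vertex₃ k

lemma smul_b_start (k : Fin g) : (M.β k)⁻¹ • (P.b k).1.1 = (P.a k).1.2 := (P.vertex₁ k).symm

/-- Each letter of the commutator moves the point to another corner of the handle: `b_k(0)`,
`a_k(1)`, `β_k⁻¹ b_k(1)`, `b_k(1)`, `a_k(0)`. -/
lemma comm_smul_b_start (k : Fin g) : M.comm k • (P.b k).1.1 = (P.a k).1.1 := by
  rw [MarkedFuchsianGroup.comm, mul_smul, P.smul_b_start, mul_smul, mul_smul, ← P.vertex₂,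
    smul_inv_smul, ← P.vertex₃, smul_inv_smul]

/-- The group elements `γ_g⁻¹ ⋯ γ_{k+1}⁻¹`. -/
def tailWord (M : MarkedFuchsianGroup g) (k : ℕ) : M.Γ :=
  (((List.ofFn M.comm).drop k).map (·⁻¹)).reverse.prod

lemma tailWord_eq_inv (M : MarkedFuchsianGroup g) (k : ℕ) :
    tailWord M k = (((List.ofFn M.comm).drop k).prod)⁻¹ := by
  rw [tailWord, List.prod_inv_reverse]

lemma tailWord_zero (M : MarkedFuchsianGroup g) : tailWord M 0 = 1 := by
  rw [tailWord_eq_inv, List.drop_zero, M.prod_comm, inv_one]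

lemma tailWord_self (M : MarkedFuchsianGroup g) : tailWord M g = 1 := by
  rw [tailWord, List.drop_eq_nil_of_le (by simp)]
  rfl

lemma tailWord_succ (M : MarkedFuchsianGroup g) (k : Fin g) :
    tailWord M (k + 1) * (M.comm k)⁻¹ = tailWord M k := by
  rw [tailWord_eq_inv, tailWord_eq_inv, List.drop_eq_getElem_cons (i := (k : ℕ)) (by simp),
    List.prod_cons, mul_inv_rev]
  simp

/-- Descending induction from the last handle: each further commutator carries `b_{k+1}(0)` to
`a_{k+1}(0)`, which is `b_k(0)`. -/
lemma tailWord_inv_smul (j : Fin g) (hj : (j : ℕ) + 1 = g) (k : Fin g) :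
    (tailWord M (k + 1))⁻¹ • (P.b j).1.1 = (P.b k).1.1 := by
  obtain ⟨g, rfl⟩ : ∃ n, g = n + 1 := ⟨j, hj.symm⟩
  have hlast : j = Fin.last g := by
    ext
    simpa using hj
  subst hlast
  induction k using Fin.reverseInduction with
  | last => simp [tailWord_self]
  | cast i ih =>
    have h1 := tailWord_succ M i.succ
    have h2 : ((i.castSucc : Fin (g + 1)) : ℕ) + 1 = (i.succ : Fin (g + 1)) := by simp
    rw [h2, ← h1, mul_inv_rev, inv_inv, mul_smul, ih, P.comm_smul_b_start, P.vertex₄]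
    congr 3
    rw [finRotate_apply, Fin.coeSucc_eq_succ]

/-- The value of the coboundary of `l` on the `0`-chain `V` only involves the end points of the
sides of the polygon. -/
lemma sum_coboundary {A : Type*} [AddCommGroup A] (hg : 0 < g) (l : M.Γ → ℍ → A) (hl : l 1 = 0)
    (Θ : M.Γ → M.Γ → ℍ → A)
    (hΘ : ∀ γ₁ γ₂ z, Θ γ₁ γ₂ z = l γ₂ (γ₁⁻¹ • z) - l (γ₁ * γ₂) z + l γ₁ z) :
    ∑ k, (Θ (M.α k) (M.β k) (P.a k).1.1 - Θ (M.β k) (M.α k) (P.b k).1.1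
        + Θ (M.comm k)⁻¹ (M.α k * M.β k) (P.b k).1.1)
      - ∑ k : Fin g, ∑ j : Fin g, (if (k : ℕ) + 1 < g ∧ (j : ℕ) + 1 = g then
          Θ (tailWord M (k + 1)) (M.comm k)⁻¹ (P.b j).1.1 else 0) =
    ∑ k, ((l (M.β k) (P.b k).1.2 - l (M.β k) (P.b k).1.1)
      - (l (M.α k) (P.a k).1.2 - l (M.α k) (P.a k).1.1)) := by
  obtain ⟨n, rfl⟩ : ∃ n, g = n + 1 := ⟨g - 1, by omega⟩
  set p := (P.b (Fin.last n)).1.1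
  -- All these terms are based at the same vertex `b_g(0)`, so the values of `l` on the partial
  -- words telescope over `k`.
  have hterm : ∀ k : Fin (n + 1), Θ (tailWord M (k + 1)) (M.comm k)⁻¹ p =
      l (M.comm k)⁻¹ (P.b k).1.1 + (l (tailWord M (k + 1)) p - l (tailWord M k) p) := by
    intro k
    rw [hΘ, P.tailWord_inv_smul (Fin.last n) (by simp) k, tailWord_succ]
    abel
  have h2 : ∑ k : Fin (n + 1), ∑ j : Fin (n + 1),
      (if (k : ℕ) + 1 < n + 1 ∧ (j : ℕ) + 1 = n + 1 then
          Θ (tailWord M (k + 1)) (M.comm k)⁻¹ (P.b j).1.1 else 0) =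
      ∑ k : Fin (n + 1), l (M.comm k)⁻¹ (P.b k).1.1 := by
    have h3 : ∀ k : Fin (n + 1), ∑ j : Fin (n + 1),
        (if (k : ℕ) + 1 < n + 1 ∧ (j : ℕ) + 1 = n + 1 then
          Θ (tailWord M (k + 1)) (M.comm k)⁻¹ (P.b j).1.1 else 0) =
        Θ (tailWord M (k + 1)) (M.comm k)⁻¹ p := by
      intro k
      rw [Finset.sum_eq_single (Fin.last n)]
      · by_cases hk : (k : ℕ) + 1 < n + 1
        · rw [if_pos ⟨hk, by simp⟩]
        -- The sum in `V` stops before the last index, but the missing term is zero because its word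
        -- is empty and `l 1 = 0`. Hence the sum may run over all `k`.
        · rw [if_neg (by tauto)]
          have hk' : k = Fin.last n := by
            ext
            have := k.isLt
            simp
            omega
          rw [hΘ, hk']
          simp [tailWord_self, hl, p]
      · intro j _ hj
        rw [if_neg]
        rintro ⟨-, h⟩
        exact hj (by ext; simpa using h)
      · simp
    rw [Finset.sum_congr rfl fun k _ => (h3 k).trans (hterm k), Finset.sum_add_distrib]
    have h4 : ∑ k : Fin (n + 1), (l (tailWord M (k + 1)) p - l (tailWord M k) p) =
        l (tailWord M (n + 1)) p - l (tailWord M 0) p := by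
      rw [Fin.sum_univ_eq_sum_range (fun k => l (tailWord M (k + 1)) p - l (tailWord M k) p),
        Finset.sum_range_sub (fun k => l (tailWord M k) p)]
    -- Both ends of the telescope are the trivial word; for `tailWord M 0` this is the surface
    -- relation.
    rw [h4, tailWord_zero, tailWord_self, sub_self, add_zero]
  rw [h2, ← Finset.sum_sub_distrib]
  refine Finset.sum_congr rfl fun k _ => ?_
  -- With this relation the values of `l` at `α_k β_k` and at `β_k α_k` cancel, leaving only values
  -- at the generators.
  have e1 : (M.comm k)⁻¹ * (M.α k * M.β k) = M.β k * M.α k := by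
    simp only [MarkedFuchsianGroup.comm]
    group
  rw [hΘ, hΘ, hΘ, e1, inv_inv, P.comm_smul_b_start, P.smul_a_start, P.smul_b_start]
  abel

lemma pair02_neg_V (hg : 0 < g) (l : M.Γ → ℍ → ℂ) (hl : l 1 = 0) :
    pair02 (fun γ₁ γ₂ z => -Theta l γ₁ γ₂ z) (-P.V) =
    ∑ k, ((l (M.β k) (P.b k).1.2 - l (M.β k) (P.b k).1.1)
      - (l (M.α k) (P.a k).1.2 - l (M.α k) (P.a k).1.1)) := by
  rw [← P.sum_coboundary hg l hl (Theta l) (fun _ _ _ => rfl)]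
  set φ : Chain02 M.Γ →+ ℂ := Finsupp.liftAddHom fun x : ℍ × M.Γ × M.Γ =>
    (AddMonoidHom.mulRight (-Theta l x.2.1 x.2.2 x.1)).comp (Int.castAddHom ℂ)
  have hφ : ∀ c, pair02 (fun γ₁ γ₂ z => -Theta l γ₁ γ₂ z) c = φ c := fun c => rfl
  have hs : ∀ z γ₁ γ₂, φ (Finsupp.single (z, γ₁, γ₂) 1) = -Theta l γ₁ γ₂ z := by
    intro z γ₁ γ₂
    rw [← hφ]
    simp [pair02]
  have hite : ∀ k j : Fin g, φ (if (k : ℕ) + 1 < g ∧ (j : ℕ) + 1 = g then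
      Finsupp.single ((P.b j).1.1,
        (((List.ofFn M.comm).drop (k + 1)).map (·⁻¹)).reverse.prod, (M.comm k)⁻¹) 1
    else 0) = -(if (k : ℕ) + 1 < g ∧ (j : ℕ) + 1 = g then
      Theta l (tailWord M (k + 1)) (M.comm k)⁻¹ (P.b j).1.1 else 0) := by
    intro k j
    split_ifs
    · exact hs _ _ _
    · simp
  rw [hφ, V, map_neg, map_sub, map_sum, map_sum]
  simp only [map_add, map_sub, map_sum, hs, hite, Finset.sum_neg_distrib]
  simp only [Finset.sum_add_distrib, Finset.sum_sub_distrib, Finset.sum_neg_distrib]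
  ring

lemma pair11_L (ϖ : M.Γ → ℂ → ℂ →L[ℝ] ℂ) :
    pair11 ϖ P.L = ∑ k, (curveIntegral (ϖ (M.β k)) (P.b k).toComplex
      - curveIntegral (ϖ (M.α k)) (P.a k).toComplex) := by
  set φ : Chain11 M.Γ →+ ℂ := Finsupp.liftAddHom fun x : Arc × M.Γ =>
    (AddMonoidHom.mulRight (curveIntegral (ϖ x.2) x.1.toComplex)).comp (Int.castAddHom ℂ)
  have hφ : ∀ c, pair11 ϖ c = φ c := fun c => rfl
  have hs : ∀ c γ, φ (Finsupp.single (c, γ) 1) = curveIntegral (ϖ γ) c.toComplex := by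
    intro c γ
    rw [← hφ]
    simp [pair11]
  rw [hφ, L, map_sum]
  simp only [map_sub, hs]

end FundamentalPolygon

/-! ### Integrals along the sides of the polygon -/

/-- Smoothness of a path in `ℍ`. -/
def Arc.IsSmooth (c : Arc) : Prop := ContDiffOn ℝ ∞ c.toComplex.extend (Set.Icc 0 1)

lemma Arc.IsSmooth.contDiffOn_one {c : Arc} (hc : c.IsSmooth) :
    ContDiffOn ℝ 1 c.toComplex.extend (Set.Icc 0 1) := ContDiffOn.of_le hc (by norm_cast)

lemma Arc.extend_translate (γ : PSL(2, ℝ)) (c : Arc) (t : ℝ) :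
    (c.translate γ).toComplex.extend t = mob γ (c.toComplex.extend t) :=
  (mob_coe γ _).symm

lemma contDiffOn_mob_real (γ : PSL(2, ℝ)) {n : WithTop ℕ∞} : ContDiffOn ℝ n (mob γ) upperSet :=
  (contDiffOn_mob γ).restrict_scalars ℝ

lemma Arc.IsSmooth.translate {c : Arc} (hc : c.IsSmooth) (γ : PSL(2, ℝ)) :
    (c.translate γ).IsSmooth := by
  have h := (contDiffOn_mob_real γ (n := ∞)).comp hc fun t _ => c.extend_mem t
  exact h.congr fun t _ => c.extend_translate γ t

lemma Arc.extend_reverse (c : Arc) (t : ℝ) :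
    c.reverse.toComplex.extend t = c.toComplex.extend (1 - t) := by
  exact c.toComplex.extend_symm_apply t

lemma Arc.IsSmooth.reverse {c : Arc} (hc : c.IsSmooth) : c.reverse.IsSmooth := by
  have h := ContDiffOn.comp (t := Set.Icc (0 : ℝ) 1) hc
    (f := fun t : ℝ => 1 - t) (s := Set.Icc 0 1) (contDiff_const.sub contDiff_id).contDiffOn
    (fun t ht => ⟨by linarith [ht.2], by linarith [ht.1]⟩)
  exact h.congr fun t _ => c.extend_reverse t

lemma curveIntegral_reverse (η : ℂ → ℂ →L[ℝ] ℂ) (c : Arc) :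
    curveIntegral η c.reverse.toComplex = -curveIntegral η c.toComplex :=
  curveIntegral_symm η c.toComplex

/-- The pull-back of a `1`-form by `γ`. -/
def pullback (γ : PSL(2, ℝ)) (η : ℂ → ℂ →L[ℝ] ℂ) (z : ℂ) : ℂ →L[ℝ] ℂ :=
  (η (mob γ z)).comp (oneForm (deriv (mob γ) z) 0)

lemma curveIntegral_translate {c : Arc} (hc : c.IsSmooth) (γ : PSL(2, ℝ))
    (η : ℂ → ℂ →L[ℝ] ℂ) :
    curveIntegral η (c.translate γ).toComplex = curveIntegral (pullback γ η) c.toComplex := by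
  rw [curveIntegral_def, curveIntegral_def]
  refine intervalIntegral.integral_congr fun t ht => ?_
  rw [Set.uIcc_of_le zero_le_one] at ht
  simp only [curveIntegralFun_def]
  have h1 := (hc.contDiffOn_one.differentiableOn one_ne_zero t ht).hasDerivWithinAt
  have h2 := (hasDerivAt_mob γ (c.extend_mem t)).comp_hasDerivWithinAt t h1
  have h3 : (c.translate γ).toComplex.extend = mob γ ∘ c.toComplex.extend :=
    funext fun t => c.extend_translate γ t
  rw [h3, h2.derivWithin (uniqueDiffOn_Icc_zero_one t ht), pullback,
    ContinuousLinearMap.comp_apply, oneForm_apply]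
  simp

lemma curveIntegrable_of_continuousOn {c : Arc} (hc : c.IsSmooth) {η : ℂ → ℂ →L[ℝ] ℂ}
    (hη : ContinuousOn η upperSet) : CurveIntegrable η c.toComplex :=
  hη.curveIntegrable_of_contDiffOn hc.contDiffOn_one c.toComplex_mem

lemma curveIntegral_eq_sub {c : Arc} (hc : c.IsSmooth) {η : ℂ → ℂ →L[ℝ] ℂ}
    (hη : ContinuousOn η upperSet) {G : ℂ → ℂ} (hG : ∀ z ∈ upperSet, HasFDerivAt G (η z) z) :
    curveIntegral η c.toComplex = G c.1.2 - G c.1.1 := by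
  have h1 : ContinuousOn (fun t => G (c.toComplex.extend t)) (Set.Icc 0 1) := fun t _ =>
    ((hG _ (c.extend_mem t)).continuousAt.comp c.toComplex.continuous_extend.continuousAt)
      |>.continuousWithinAt
  have h2 := intervalIntegral.integral_eq_sub_of_hasDerivAt_of_le zero_le_one h1
    (f' := curveIntegralFun η c.toComplex) (fun t ht => ?_)
    (curveIntegrable_of_continuousOn hc hη)
  · rw [curveIntegral_def, h2]
    simp
  · have hIcc := Set.Ioo_subset_Icc_self ht
    have h3 := ((hc.contDiffOn_one.differentiableOn one_ne_zero t hIcc).hasDerivWithinAt).hasDerivAt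
      (Icc_mem_nhds ht.1 ht.2)
    rw [curveIntegralFun_def]
    exact (hG _ (c.extend_mem t)).comp_hasDerivAt t h3

lemma continuousOn_oneForm {p q : ℂ → ℂ} {s : Set ℂ} (hp : ContinuousOn p s)
    (hq : ContinuousOn q s) : ContinuousOn (fun z => oneForm (p z) (q z)) s :=
  (hp.smul continuousOn_const).add (hq.smul continuousOn_const)

lemma continuousOn_pullback (γ : PSL(2, ℝ)) {η : ℂ → ℂ →L[ℝ] ℂ} (hη : ContinuousOn η upperSet) :
    ContinuousOn (pullback γ η) upperSet := by
  refine ContinuousOn.clm_comp (hη.comp (contDiffOn_mob γ (n := 0)).continuousOn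
    fun z _ => mob_mem γ z) (continuousOn_oneForm ?_ continuousOn_const)
  exact (contDiffOn_deriv_mob γ (n := 0)).continuousOn

namespace FundamentalPolygon

variable {g : ℕ} {M : MarkedFuchsianGroup g} (P : FundamentalPolygon M)

/-- The sides of the polygon. -/
abbrev side (i : Fin g × Fin 4) : Arc := boundarySide M P.a P.b i.1 i.2

lemma a_smooth (k : Fin g) : (P.a k).IsSmooth := (P.a_geodesic k).smooth

lemma b_smooth (k : Fin g) : (P.b k).IsSmooth := (P.b_geodesic k).smooth

lemma side_smooth (i : Fin g × Fin 4) : (P.side i).IsSmooth := by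
  obtain ⟨k, j⟩ := i
  fin_cases j
  · exact P.a_smooth k
  · exact (P.b_smooth k).translate _
  · exact ((P.a_smooth k).translate _).reverse
  · exact (P.b_smooth k).reverse

lemma boundsRegion : BoundsRegion P.side P.F where
  compact := P.compact
  smooth := P.side_smooth
  frontier_eq := P.frontier_eq
  inside := P.winding_inside
  outside := P.winding_outside

/-- Pulling the primed sides back to `a_k` and `b_k`, where they occur with opposite orientation,
leaves only the defect of invariance `η - γ^* η`. -/
lemma sum_side (η : ℂ → ℂ →L[ℝ] ℂ) (hη : ContinuousOn η upperSet) :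
    ∑ i, curveIntegral η (P.side i).toComplex =
      ∑ k, (curveIntegral (fun z => η z - pullback ((M.α k : PSL(2, ℝ))⁻¹) η z) (P.a k).toComplex
        - curveIntegral (fun z => η z - pullback ((M.β k : PSL(2, ℝ))⁻¹) η z)
          (P.b k).toComplex) := by
  rw [Fintype.sum_prod_type]
  refine Finset.sum_congr rfl fun k _ => ?_
  have ia := curveIntegrable_of_continuousOn (P.a_smooth k) hη
  have ib := curveIntegrable_of_continuousOn (P.b_smooth k) hη
  have ia' := curveIntegrable_of_continuousOn (P.a_smooth k)
    (continuousOn_pullback ((M.α k : PSL(2, ℝ))⁻¹) hη)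
  have ib' := curveIntegrable_of_continuousOn (P.b_smooth k)
    (continuousOn_pullback ((M.β k : PSL(2, ℝ))⁻¹) hη)
  rw [curveIntegral_fun_sub ia ia', curveIntegral_fun_sub ib ib', Fin.sum_univ_four,
    ← curveIntegral_translate (P.a_smooth k), ← curveIntegral_translate (P.b_smooth k)]
  have h2 : curveIntegral η (P.side (k, 2)).toComplex =
      -curveIntegral η ((P.a k).translate ((M.α k : PSL(2, ℝ))⁻¹)).toComplex :=
    curveIntegral_reverse η _
  have h3 : curveIntegral η (P.side (k, 3)).toComplex = -curveIntegral η (P.b k).toComplex :=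
    curveIntegral_reverse η _
  have h0 : curveIntegral η (P.side (k, 0)).toComplex = curveIntegral η (P.a k).toComplex := rfl
  have h1 : curveIntegral η (P.side (k, 1)).toComplex =
      curveIntegral η ((P.b k).translate ((M.β k : PSL(2, ℝ))⁻¹)).toComplex := rfl
  rw [h0, h1, h2, h3]
  ring

end FundamentalPolygon

/-! ### The `1`-forms `κ_γ` -/

/-- The logarithmic derivative `γ'' / γ'`. -/
def preSchwarzian (γ : PSL(2, ℝ)) (z : ℂ) : ℂ := deriv (deriv (mob γ)) z / deriv (mob γ) z

lemma continuousOn_preSchwarzian (γ : PSL(2, ℝ)) : ContinuousOn (preSchwarzian γ) upperSet :=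
  ((differentiableOn_deriv_mob γ).deriv isOpen_upperSet).continuousOn.div
    (differentiableOn_deriv_mob γ).continuousOn fun _ hz => deriv_mob_ne_zero γ hz

/-- The `1`-form `h''/h' dz - conj (h''/h') dz̄` with `h = γ⁻¹`. -/
def kappa (γ : PSL(2, ℝ)) (z : ℂ) : ℂ →L[ℝ] ℂ :=
  oneForm (preSchwarzian γ⁻¹ z) (-(starRingEnd ℂ) (preSchwarzian γ⁻¹ z))

lemma continuousOn_kappa (γ : PSL(2, ℝ)) : ContinuousOn (kappa γ) upperSet :=
  continuousOn_oneForm (continuousOn_preSchwarzian _)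
    (Complex.continuous_conj.comp_continuousOn (continuousOn_preSchwarzian _)).neg

lemma re_kappa_apply (γ : PSL(2, ℝ)) (z v : ℂ) : (kappa γ z v).re = 0 := by
  rw [kappa, oneForm_apply]
  simp

lemma IsSmooth.continuousOn_coordC {f : ℍ → ℝ} (hf : IsSmooth f) :
    ContinuousOn (coordC f) upperSet :=
  Complex.continuous_ofReal.comp_continuousOn (ContDiffOn.continuousOn hf)

lemma IsSmooth.contDiffOn_coordC {f : ℍ → ℝ} (hf : IsSmooth f) :
    ContDiffOn ℝ ∞ (coordC f) upperSet :=
  Complex.ofRealCLM.contDiff.comp_contDiffOn hf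

lemma continuousOn_log_deriv_mob (γ : PSL(2, ℝ)) :
    ContinuousOn (fun z => Real.log (‖deriv (mob γ) z‖ ^ 2)) upperSet :=
  (((differentiableOn_deriv_mob γ).continuousOn.norm).pow 2).log fun _ hz =>
    pow_ne_zero 2 (norm_ne_zero_iff.mpr (deriv_mob_ne_zero γ hz))

lemma theta_eq (φ : ℍ → ℝ) (γ : PSL(2, ℝ)) (z : ℂ) : theta φ γ z =
    ((coord φ z - 1 / 2 * Real.log (‖deriv (mob γ⁻¹) z‖ ^ 2) : ℝ) : ℂ) • kappa γ z := rfl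

lemma continuousOn_theta {φ : ℍ → ℝ} (hφ : ContinuousOn (coord φ) upperSet) (γ : PSL(2, ℝ)) :
    ContinuousOn (theta φ γ) upperSet := by
  simp only [funext (theta_eq φ γ)]
  exact (Complex.continuous_ofReal.comp_continuousOn
    (hφ.sub ((continuousOn_log_deriv_mob _).const_smul (1 / 2 : ℝ)))).smul (continuousOn_kappa γ)

lemma coord_phiHyp {z : ℂ} (hz : z ∈ upperSet) : coord phiHyp z = -2 * Real.log z.im := by
  rw [coord, phiHyp, ← UpperHalfPlane.coe_im, coe_ofComplex hz]

lemma isSmooth_phiHyp : IsSmooth phiHyp := by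
  have h : ContDiffOn ℝ ∞ (fun z : ℂ => -2 * Real.log z.im) upperSet := by
    refine contDiffOn_const.mul (ContDiffOn.log Complex.imCLM.contDiff.contDiffOn ?_)
    exact fun z hz => ne_of_gt hz
  exact h.congr fun z hz => coord_phiHyp hz

lemma curveIntegral_smul_kappa_add {c : Arc} (hc : c.IsSmooth) (γ : PSL(2, ℝ)) {u v : ℍ → ℝ}
    (hu : IsSmooth u) (hv : IsSmooth v) (r : ℝ) :
    curveIntegral (fun z => coordC (u + r • v) z • kappa γ z) c.toComplex =
      curveIntegral (fun z => coordC u z • kappa γ z) c.toComplex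
      + r * curveIntegral (fun z => coordC v z • kappa γ z) c.toComplex := by
  have iu := curveIntegrable_of_continuousOn hc
    (hu.continuousOn_coordC.smul (continuousOn_kappa γ))
  have iv := curveIntegrable_of_continuousOn hc
    (hv.continuousOn_coordC.smul (continuousOn_kappa γ))
  have h1 : (fun z => coordC (u + r • v) z • kappa γ z) =
      (fun z => coordC u z • kappa γ z) + r • (fun z => coordC v z • kappa γ z) := by
    funext z
    ext v
    simp only [coordC, coord, Pi.add_apply, Pi.smul_apply, smul_apply, add_apply, smul_eq_mul,
      Complex.ofReal_add, Complex.ofReal_mul, Complex.real_smul]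
    ring
  have h2 := curveIntegral_add iu (iv.smul (c := r))
  rw [h1]
  refine h2.trans ?_
  rw [curveIntegral_smul, Complex.real_smul]
  rfl

/-- The form `kappa` is a difference of complex conjugates, hence purely imaginary on tangent
vectors, while `u` is real. The reality of `S` rests on this. -/
lemma re_curveIntegral_smul_kappa (c : Arc) (γ : PSL(2, ℝ)) (u : ℍ → ℝ) :
    (curveIntegral (fun z => coordC u z • kappa γ z) c.toComplex).re = 0 := by
  rw [curveIntegral_def]
  have h : ∀ t, curveIntegralFun (fun z => coordC u z • kappa γ z) c.toComplex t =
      ((curveIntegralFun (fun z => coordC u z • kappa γ z) c.toComplex t).im : ℂ) * Complex.I := by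
    intro t
    rw [curveIntegralFun_def]
    apply Complex.ext
    · simp [re_kappa_apply, coordC]
    · simp
  rw [intervalIntegral.integral_congr fun t _ => h t, intervalIntegral.integral_mul_const,
    intervalIntegral.integral_ofReal]
  simp

namespace FundamentalPolygon

variable {g : ℕ} {M : MarkedFuchsianGroup g} (P : FundamentalPolygon M)

/-- The boundary functional `∑ (∫_{b_k} u κ_{β_k} - ∫_{a_k} u κ_{α_k})`. -/
def kappaPairing (u : ℍ → ℝ) : ℂ :=
  ∑ k, (curveIntegral (fun z => coordC u z • kappa (M.β k) z) (P.b k).toComplex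
    - curveIntegral (fun z => coordC u z • kappa (M.α k) z) (P.a k).toComplex)

lemma kappaPairing_add_smul {u v : ℍ → ℝ} (hu : IsSmooth u) (hv : IsSmooth v) (r : ℝ) :
    P.kappaPairing (u + r • v) = P.kappaPairing u + r * P.kappaPairing v := by
  simp only [kappaPairing, Finset.mul_sum, ← Finset.sum_add_distrib]
  refine Finset.sum_congr rfl fun k _ => ?_
  rw [curveIntegral_smul_kappa_add (P.b_smooth k) _ hu hv,
    curveIntegral_smul_kappa_add (P.a_smooth k) _ hu hv]
  ring

lemma re_kappaPairing (u : ℍ → ℝ) : (P.kappaPairing u).re = 0 := by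
  rw [kappaPairing, Complex.re_sum]
  refine Finset.sum_eq_zero fun k _ => ?_
  rw [Complex.sub_re, re_curveIntegral_smul_kappa, re_curveIntegral_smul_kappa, sub_zero]

/-- The Liouville action does not involve the choice of `l`: it is the Dirichlet type integral
corrected by a boundary term which vanishes for `φ_hyp`. -/
theorem evaluation_eq (hg : 0 < g) {l : M.Γ → ℍ → ℂ} (hl : IsPrimitive M.Γ l) {φ : ℍ → ℝ}
    (hφ : IsSmooth φ) :
    P.evaluation l φ = ((∫ z in UpperHalfPlane.coe '' P.F,
        (‖dz (coordC φ) z‖ ^ 2 + Real.exp (coord φ z))) +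
      1 / 2 * (P.kappaPairing (φ - phiHyp)).im : ℝ) := by
  have hside : ∀ (c : Arc) (_ : c.IsSmooth) (γ : M.Γ),
      curveIntegral (fun z => -theta φ γ z) c.toComplex + (l γ c.1.2 - l γ c.1.1) =
        -curveIntegral (fun z => coordC (φ - phiHyp) z • kappa γ z) c.toComplex := by
    intro c hc γ
    have h0 := continuousOn_theta (ContDiffOn.continuousOn isSmooth_phiHyp) (γ : PSL(2, ℝ))
    have h1 := curveIntegral_eq_sub hc h0 (G := coord (l γ)) (fun z hz => by
      lift z to ℍ using hz
      exact hl.hasFDerivAt γ z)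
    rw [coord_coe, coord_coe] at h1
    have i1 := curveIntegrable_of_continuousOn hc
      (continuousOn_theta (ContDiffOn.continuousOn hφ) (γ : PSL(2, ℝ)))
    have i0 := curveIntegrable_of_continuousOn hc h0
    -- The term `½ log |h'|²` is the same for both metrics and drops out of the difference.
    have h2 : (fun z => coordC (φ - phiHyp) z • kappa γ z) =
        fun z => theta φ γ z - theta phiHyp γ z := by
      funext z
      ext v
      simp only [theta_eq, coordC, coord, Pi.sub_apply, smul_apply, sub_apply, smul_eq_mul]
      push_cast
      ring
    rw [← h1, h2, curveIntegral_fun_sub i1 i0, curveIntegral_fun_neg]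
    ring
  have hsum : pair11 (fun γ z => -theta φ (γ : PSL(2, ℝ)) z) P.L
      + pair02 (fun γ₁ γ₂ z => -Theta l γ₁ γ₂ z) (-P.V) = -P.kappaPairing (φ - phiHyp) := by
    rw [pair11_L, pair02_neg_V P hg l hl.normalized, ← Finset.sum_add_distrib, kappaPairing,
      ← Finset.sum_neg_distrib]
    refine Finset.sum_congr rfl fun k _ => ?_
    have e1 := hside _ (P.b_smooth k) (M.β k)
    have e2 := hside _ (P.a_smooth k) (M.α k)
    linear_combination e1 - e2
  have hk : P.kappaPairing (φ - phiHyp) = (P.kappaPairing (φ - phiHyp)).im * Complex.I := by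
    apply Complex.ext
    · simp [P.re_kappaPairing]
    · simp
  have h20 : pair20 (omega φ) P.F = -2 * Complex.I * ((∫ z in UpperHalfPlane.coe '' P.F,
        (‖dz (coordC φ) z‖ ^ 2 + Real.exp (coord φ z)) : ℝ) : ℂ) := by
    rw [pair20, integral_mul_const, ← integral_complex_ofReal, mul_comm]
    rfl
  rw [evaluation, add_assoc, hsum, hk, h20]
  push_cast
  set A := ((∫ z in UpperHalfPlane.coe '' P.F,
        (‖dz (coordC φ) z‖ ^ 2 + Real.exp (coord φ z)) : ℝ) : ℂ)
  set B := ((P.kappaPairing (φ - phiHyp)).im : ℂ)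
  rw [show ((B * Complex.I).im : ℂ) = B by simp [B]]
  linear_combination (-A - B / 2) * Complex.I_sq

theorem liouvilleAction_eq (hg : 0 < g) {l : M.Γ → ℍ → ℂ} (hl : IsPrimitive M.Γ l) {φ : ℍ → ℝ}
    (hφ : IsSmooth φ) :
    P.liouvilleAction l φ = (∫ z in UpperHalfPlane.coe '' P.F,
        (‖dz (coordC φ) z‖ ^ 2 + Real.exp (coord φ z))) +
      1 / 2 * (P.kappaPairing (φ - phiHyp)).im := by
  rw [liouvilleAction, P.evaluation_eq hg hl hφ, Complex.ofReal_re]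

end FundamentalPolygon

/-! ### Smooth functions and conformal metrics -/

lemma contDiffOn_dz {f : ℂ → ℂ} (hf : ContDiffOn ℝ ∞ f upperSet) :
    ContDiffOn ℝ ∞ (dz f) upperSet := by
  have h := hf.fderiv_of_isOpen isOpen_upperSet (m := ∞) le_rfl
  exact ((h.clm_apply contDiffOn_const).sub
    (contDiffOn_const.mul (h.clm_apply contDiffOn_const))).div_const 2

lemma contDiffOn_dzbar {f : ℂ → ℂ} (hf : ContDiffOn ℝ ∞ f upperSet) :
    ContDiffOn ℝ ∞ (dzbar f) upperSet := by
  have h := hf.fderiv_of_isOpen isOpen_upperSet (m := ∞) le_rfl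
  exact ((h.clm_apply contDiffOn_const).add
    (contDiffOn_const.mul (h.clm_apply contDiffOn_const))).div_const 2

lemma differentiableAt_of_contDiffOn {f : ℂ → ℂ} (hf : ContDiffOn ℝ ∞ f upperSet) {z : ℂ}
    (hz : z ∈ upperSet) : DifferentiableAt ℝ f z :=
  (hf.contDiffAt (isOpen_upperSet.mem_nhds hz)).differentiableAt (by simp)

lemma hasFDerivAt_conj {f : ℂ → ℂ} {z p q : ℂ} (h : HasFDerivAt f (oneForm p q) z) :
    HasFDerivAt (fun z => (starRingEnd ℂ) (f z))
      (oneForm ((starRingEnd ℂ) q) ((starRingEnd ℂ) p)) z := by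
  refine ((Complex.conjCLE : ℂ →L[ℝ] ℂ).hasFDerivAt.comp z h).congr_fderiv ?_
  ext v
  simp [oneForm_apply, add_comm]

lemma IsSmooth.hasFDerivAt {f : ℍ → ℝ} (hf : IsSmooth f) {z : ℂ} (hz : z ∈ upperSet) :
    HasFDerivAt (coordC f) (oneForm (dz (coordC f) z) ((starRingEnd ℂ) (dz (coordC f) z))) z := by
  have h := differentiableAt_of_contDiffOn hf.contDiffOn_coordC hz
  rw [← dzbar_coordC f h]
  exact hasFDerivAt_oneForm h

lemma IsSmooth.add_smul {u v : ℍ → ℝ} (hu : IsSmooth u) (hv : IsSmooth v) (r : ℝ) :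
    IsSmooth (u + r • v) := ContDiffOn.add hu (contDiffOn_const.smul hv)

lemma IsSmooth.sub {u v : ℍ → ℝ} (hu : IsSmooth u) (hv : IsSmooth v) :
    IsSmooth (u - v) := ContDiffOn.sub hu hv

lemma IsSmooth.continuous {u : ℍ → ℝ} (hu : IsSmooth u) : Continuous u := by
  have h := (ContDiffOn.continuousOn hu).comp_continuous UpperHalfPlane.continuous_coe
    coe_mem_upperSet
  exact h.congr fun z => coord_coe u z

lemma dz_coordC_add_smul {u v : ℍ → ℝ} (hu : IsSmooth u) (hv : IsSmooth v) (r : ℝ) {z : ℂ}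
    (hz : z ∈ upperSet) :
    dz (coordC (u + r • v)) z = dz (coordC u) z + r * dz (coordC v) z := by
  have h := (hu.hasFDerivAt hz).add ((hv.hasFDerivAt hz).const_smul (r : ℂ))
  rw [smul_oneForm, oneForm_add] at h
  refine dz_eq (h.congr_of_eventuallyEq (Filter.Eventually.of_forall fun w => ?_))
  simp [coordC, coord]

/-! ### Transformation laws of `φ_z`, `φ_{z z̄}` and the curvature under the group. -/

lemma coordC_mob {φ : ℍ → ℝ} {γ : PSL(2, ℝ)}
    (h : ∀ z : ℍ, φ (γ • z) + Real.log (‖deriv (mob γ) z‖ ^ 2) = φ z) {z : ℂ} (hz : z ∈ upperSet) :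
    coordC φ (mob γ z) = coordC φ z - ((Real.log (‖deriv (mob γ) z‖ ^ 2) : ℝ) : ℂ) := by
  lift z to ℍ using hz
  rw [coordC, coordC, coord_mob, coord_coe, UpperHalfPlane.ofComplex_apply, ← h z]
  push_cast
  ring

/-- Differentiation of the automorphy relation: `φ_z dz` transforms like a connection form, with
defect `γ''/γ' dz`. This defect is the source of the boundary terms of the action. -/
lemma dz_conformal_mob {φ : ℍ → ℝ} (hφ : IsSmooth φ) {γ : PSL(2, ℝ)}
    (h : ∀ z : ℍ, φ (γ • z) + Real.log (‖deriv (mob γ) z‖ ^ 2) = φ z) {z : ℂ} (hz : z ∈ upperSet) :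
    dz (coordC φ) (mob γ z) * deriv (mob γ) z = dz (coordC φ) z - preSchwarzian γ z := by
  have h1 := hasFDerivAt_oneForm_comp (hφ.hasFDerivAt (mob_mem γ z)) (hasDerivAt_mob γ hz)
  have h2 := (hφ.hasFDerivAt hz).sub
    (hasFDerivAt_log_norm_sq (hasDerivAt_deriv_mob γ hz) (deriv_mob_ne_zero γ hz))
  rw [sub_eq_add_neg (oneForm _ _), oneForm_neg, oneForm_add] at h2
  rw [← dz_eq h1]
  refine dz_eq (h2.congr_of_eventuallyEq ?_)
  filter_upwards [eventually_upperSet hz] with w hw using coordC_mob h hw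

/-- In the law for `φ_{z̄}` the defect and the factor `conj γ'` are antiholomorphic, so `∂/∂z` kills
the first and treats the second as a constant. -/
lemma laplacian_conformal_mob {φ : ℍ → ℝ} (hφ : IsSmooth φ) {γ : PSL(2, ℝ)}
    (h : ∀ z : ℍ, φ (γ • z) + Real.log (‖deriv (mob γ) z‖ ^ 2) = φ z) {z : ℂ} (hz : z ∈ upperSet) :
    dz (dzbar (coordC φ)) (mob γ z) * (‖deriv (mob γ) z‖ ^ 2 : ℝ) =
      dz (dzbar (coordC φ)) z := by
  have hd : ∀ w ∈ upperSet, DifferentiableAt ℝ (dzbar (coordC φ)) w := fun w hw =>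
    differentiableAt_of_contDiffOn (contDiffOn_dzbar hφ.contDiffOn_coordC) hw
  have e1 : ∀ w ∈ upperSet, dzbar (coordC φ) (mob γ w) * (starRingEnd ℂ) (deriv (mob γ) w) +
      (starRingEnd ℂ) (preSchwarzian γ w) = dzbar (coordC φ) w := by
    intro w hw
    have h1 := congrArg (starRingEnd ℂ) (dz_conformal_mob hφ h hw)
    rw [map_mul, map_sub, ← dzbar_coordC φ (differentiableAt_of_contDiffOn
      hφ.contDiffOn_coordC hw), ← dzbar_coordC φ (differentiableAt_of_contDiffOn
      hφ.contDiffOn_coordC (mob_mem γ w))] at h1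
    rw [h1, sub_add_cancel]
  have hq : HasDerivAt (preSchwarzian γ) (deriv (preSchwarzian γ) z) z := by
    have : DifferentiableOn ℂ (preSchwarzian γ) upperSet :=
      ((differentiableOn_deriv_mob γ).deriv isOpen_upperSet).div
        (differentiableOn_deriv_mob γ) fun _ hz => deriv_mob_ne_zero γ hz
    exact (this.differentiableAt (isOpen_upperSet.mem_nhds hz)).hasDerivAt
  have h1 := hasFDerivAt_oneForm_comp (hasFDerivAt_oneForm (hd _ (mob_mem γ z)))
    (hasDerivAt_mob γ hz)
  have h2 := hasFDerivAt_conj (hasFDerivAt_oneForm_of_hasDerivAt (hasDerivAt_deriv_mob γ hz))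
  have h3 := (hasFDerivAt_oneForm_mul h1 h2).add
    (hasFDerivAt_conj (hasFDerivAt_oneForm_of_hasDerivAt hq))
  rw [oneForm_add] at h3
  have h4 := dz_eq (h3.congr_of_eventuallyEq (f₁ := dzbar (coordC φ)) (by
    filter_upwards [eventually_upperSet hz] with w hw using (e1 w hw).symm))
  rw [h4, map_zero, ← Complex.normSq_eq_norm_sq, Complex.normSq_eq_conj_mul_self]
  ring

lemma curvature_smul {φ : ℍ → ℝ} (hφ : IsSmooth φ) {γ : PSL(2, ℝ)}
    (h : ∀ z : ℍ, φ (γ • z) + Real.log (‖deriv (mob γ) z‖ ^ 2) = φ z) (z : ℍ) :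
    curvature φ (γ • z) = curvature φ z := by
  have h1 := congrArg Complex.re (laplacian_conformal_mob hφ h (coe_mem_upperSet z))
  rw [Complex.re_mul_ofReal, mob_coe] at h1
  rw [curvature, curvature, ← h1, ← h z, neg_add, Real.exp_add, Real.exp_neg (Real.log _),
    Real.exp_log (by
      have := norm_pos_iff.mpr (deriv_mob_ne_zero γ (coe_mem_upperSet z))
      positivity)]
  have := norm_ne_zero_iff.mpr (deriv_mob_ne_zero γ (coe_mem_upperSet z))
  field_simp

lemma isSmooth_curvature {φ : ℍ → ℝ} (hφ : IsSmooth φ) : IsSmooth (curvature φ) := by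
  have h1 : ContDiffOn ℝ ∞ (fun z => -2 * Real.exp (-coord φ z) *
      (dz (dzbar (coordC φ)) z).re) upperSet := by
    refine (contDiffOn_const.mul (ContDiffOn.exp (ContDiffOn.neg hφ))).mul ?_
    exact Complex.reCLM.contDiff.comp_contDiffOn
      (contDiffOn_dz (contDiffOn_dzbar hφ.contDiffOn_coordC))
  refine h1.congr fun z hz => ?_
  rw [coord, curvature, coe_ofComplex hz]
  rfl

/-- Makes `K + 1` an admissible direction of variation, the one that yields the Euler–Lagrange
equation. -/
lemma curvature_add_one_mem {Γ : Subgroup PSL(2, ℝ)} {φ : ℍ → ℝ} (hφ : φ ∈ conformalMetrics Γ) :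
    (fun z => curvature φ z + 1) ∈ smoothFunctions Γ :=
  ⟨ContDiffOn.add (isSmooth_curvature hφ.1) contDiffOn_const, fun γ hγ z => by
    simp only [curvature_smul hφ.1 (hφ.2 γ hγ)]⟩

/-! ### The hyperbolic metric -/

lemma phiHyp_mem (Γ : Subgroup PSL(2, ℝ)) : phiHyp ∈ conformalMetrics Γ := by
  refine ⟨isSmooth_phiHyp, fun γ _ z => ?_⟩
  have h := im_mob γ (coe_mem_upperSet z)
  rw [mob_coe, UpperHalfPlane.coe_im, UpperHalfPlane.coe_im] at h
  have h0 := norm_ne_zero_iff.mpr (deriv_mob_ne_zero γ (coe_mem_upperSet z))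
  rw [phiHyp, phiHyp, h, Real.log_mul z.im_ne_zero h0, Real.log_pow]
  push_cast
  ring

lemma hasFDerivAt_im (z : ℂ) : HasFDerivAt (fun z : ℂ => (z.im : ℂ))
    (oneForm (-Complex.I / 2) (Complex.I / 2)) z := by
  refine (Complex.ofRealCLM.comp Complex.imCLM).hasFDerivAt.congr_fderiv ?_
  ext v
  rw [oneForm_apply]
  simp only [ContinuousLinearMap.comp_apply, Complex.ofRealCLM_apply, Complex.imCLM_apply,
    Complex.im_eq_sub_conj]
  field_simp
  rw [Complex.I_sq]
  ring

lemma hasFDerivAt_real_comp_im {f : ℝ → ℝ} {f' : ℝ} {z : ℂ} (h : HasDerivAt f f' z.im) :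
    HasFDerivAt (fun z : ℂ => (f z.im : ℂ))
      (oneForm (f' * (-Complex.I / 2)) (f' * (Complex.I / 2))) z := by
  have h1 := Complex.ofRealCLM.hasFDerivAt.comp z (h.hasFDerivAt.comp z Complex.imCLM.hasFDerivAt)
  refine h1.congr_fderiv ?_
  have h2 := (hasFDerivAt_im z).unique (Complex.ofRealCLM.comp Complex.imCLM).hasFDerivAt
  rw [← smul_oneForm, h2]
  ext v
  simp [mul_comm]

lemma hasFDerivAt_phiHyp {z : ℂ} (hz : z ∈ upperSet) :
    HasFDerivAt (coordC phiHyp) (oneForm (Complex.I / z.im) (-Complex.I / z.im)) z := by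
  have h := hasFDerivAt_real_comp_im ((Real.hasDerivAt_log (ne_of_gt hz)).const_mul (-2))
  have e : oneForm (Complex.I / z.im) (-Complex.I / z.im) =
      oneForm (((-2 * z.im⁻¹ : ℝ) : ℂ) * (-Complex.I / 2))
        (((-2 * z.im⁻¹ : ℝ) : ℂ) * (Complex.I / 2)) := by
    congr 1 <;> push_cast <;> ring
  rw [e]
  refine h.congr_of_eventuallyEq ?_
  filter_upwards [eventually_upperSet hz] with w hw
  rw [coordC, coord_phiHyp hw]

lemma dz_phiHyp {z : ℂ} (hz : z ∈ upperSet) : dz (coordC phiHyp) z = Complex.I / z.im :=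
  dz_eq (hasFDerivAt_phiHyp hz)

lemma dz_dzbar_phiHyp {z : ℂ} (hz : z ∈ upperSet) :
    dz (dzbar (coordC phiHyp)) z = 1 / (2 * z.im ^ 2) := by
  have h := (hasFDerivAt_real_comp_im (hasDerivAt_inv (ne_of_gt hz))).const_smul (-Complex.I)
  rw [smul_oneForm] at h
  have h1 := dz_eq (h.congr_of_eventuallyEq (f₁ := dzbar (coordC phiHyp)) (by
    filter_upwards [eventually_upperSet hz] with w hw
    rw [dzbar_eq (hasFDerivAt_phiHyp hw)]
    simp [div_eq_mul_inv]))
  have hne : (z.im : ℂ) ≠ 0 := by exact_mod_cast ne_of_gt hz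
  rw [h1]
  push_cast
  field_simp
  rw [Complex.I_sq]
  ring

lemma curvature_phiHyp (z : ℍ) : curvature phiHyp z = -1 := by
  have hz := z.im_pos
  have e : dz (dzbar (coordC phiHyp)) z = ((1 / (2 * z.im ^ 2) : ℝ) : ℂ) := by
    rw [dz_dzbar_phiHyp (coe_mem_upperSet z)]
    push_cast
    rfl
  rw [curvature, e, Complex.ofReal_re, phiHyp]
  rw [show -(-2 * Real.log z.im) = Real.log (z.im ^ 2) by rw [Real.log_pow]; push_cast; ring,
    Real.exp_log (by positivity)]
  field_simp

/-! ### The first variation -/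

lemma integrableOn_coe_image {F : Set ℍ} (hF : IsCompact F) {E : Type*} [NormedAddCommGroup E]
    {f : ℂ → E} (hf : ContinuousOn f upperSet) : IntegrableOn f (UpperHalfPlane.coe '' F) :=
  (hf.mono (by rintro _ ⟨z, _, rfl⟩; exact z.im_pos)).integrableOn_compact
    (hF.image UpperHalfPlane.continuous_coe)

lemma forall_coe_image {F : Set ℍ} {p : ℂ → Prop} (h : ∀ z ∈ upperSet, p z) :
    ∀ z ∈ UpperHalfPlane.coe '' F, p z := by
  rintro _ ⟨z, _, rfl⟩
  exact h _ z.im_pos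

/-- Differentiation under the integral sign; on the compact set and for `|t| ≤ 1` everything is
bounded by a constant. The weight is `1` in the first variation and the second direction in the
second variation. -/
lemma hasDerivAt_integral_exp {F : Set ℍ} (hF : IsCompact F) {w u v : ℂ → ℝ}
    (hw : ContinuousOn w upperSet) (hu : ContinuousOn u upperSet) (hv : ContinuousOn v upperSet) :
    HasDerivAt (fun t : ℝ => ∫ z in UpperHalfPlane.coe '' F, w z * Real.exp (u z + t * v z))
      (∫ z in UpperHalfPlane.coe '' F, w z * v z * Real.exp (u z)) 0 := by
  have hK := hF.image UpperHalfPlane.continuous_coe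
  have hsub : UpperHalfPlane.coe '' F ⊆ upperSet := forall_coe_image fun z hz => hz
  obtain ⟨W, hW⟩ := hK.exists_bound_of_continuousOn (hw.mono hsub)
  obtain ⟨U, hU⟩ := hK.exists_bound_of_continuousOn (hu.mono hsub)
  obtain ⟨V, hV⟩ := hK.exists_bound_of_continuousOn (hv.mono hsub)
  have hc : ∀ t : ℝ, ContinuousOn (fun z => w z * Real.exp (u z + t * v z)) upperSet := fun t =>
    hw.mul (Real.continuous_exp.comp_continuousOn (hu.add (continuousOn_const.mul hv)))
  have hc' : ContinuousOn (fun z => w z * v z * Real.exp (u z + 0 * v z)) upperSet :=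
    (hw.mul hv).mul (Real.continuous_exp.comp_continuousOn (hu.add (continuousOn_const.mul hv)))
  have h := hasDerivAt_integral_of_dominated_loc_of_deriv_le
    (μ := volume.restrict (UpperHalfPlane.coe '' F)) (x₀ := (0 : ℝ)) (s := Metric.ball 0 1)
    (F := fun t z => w z * Real.exp (u z + t * v z))
    (F' := fun t z => w z * v z * Real.exp (u z + t * v z))
    (bound := fun _ => W * V * Real.exp (U + V))
    (Metric.ball_mem_nhds _ one_pos)
    (Filter.Eventually.of_forall fun t => (integrableOn_coe_image hF (hc t)).aestronglyMeasurable)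
    (integrableOn_coe_image hF (hc 0)) (integrableOn_coe_image hF hc').aestronglyMeasurable
    ?_ (integrableOn_const hK.measure_lt_top.ne) ?_
  · simpa using h.2
  · rw [ae_restrict_iff' (measurableSet_coe_image hF)]
    refine Filter.Eventually.of_forall fun z hz t ht => ?_
    have ht' : |t| ≤ 1 := by
      have := Metric.mem_ball.mp ht
      rw [dist_zero_right, Real.norm_eq_abs] at this
      exact this.le
    rw [norm_mul, norm_mul, Real.norm_of_nonneg (Real.exp_pos _).le]
    have h0 : 0 ≤ W := (norm_nonneg _).trans (hW z hz)
    have h1 : 0 ≤ V := (norm_nonneg _).trans (hV z hz)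
    refine mul_le_mul (mul_le_mul (hW z hz) (hV z hz) (norm_nonneg _) h0)
      (Real.exp_le_exp.mpr (add_le_add ((le_abs_self _).trans (hU z hz)) ?_))
      (Real.exp_pos _).le (mul_nonneg h0 h1)
    refine (le_abs_self _).trans ?_
    rw [abs_mul]
    have := mul_le_mul ht' (hV z hz) (norm_nonneg _) zero_le_one
    rwa [one_mul] at this
  · refine Filter.Eventually.of_forall fun z t _ => ?_
    have h1 : HasDerivAt (fun t : ℝ => u z + t * v z) (v z) t := by
      simpa using ((hasDerivAt_id t).mul_const (v z)).const_add (u z)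
    exact (h1.exp.const_mul (w z)).congr_deriv (by ring)

/-- The real inner product `2 Re (φ_z conj(σ_z)) = ½ ∇φ·∇σ`. -/
def gradPair (φ σ : ℍ → ℝ) (z : ℂ) : ℝ :=
  2 * (dz (coordC φ) z * (starRingEnd ℂ) (dz (coordC σ) z)).re

lemma continuousOn_gradPair {φ σ : ℍ → ℝ} (hφ : IsSmooth φ) (hσ : IsSmooth σ) :
    ContinuousOn (gradPair φ σ) upperSet :=
  continuousOn_const.mul (Complex.continuous_re.comp_continuousOn
    ((contDiffOn_dz hφ.contDiffOn_coordC).continuousOn.mul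
      (Complex.continuous_conj.comp_continuousOn
        (contDiffOn_dz hσ.contDiffOn_coordC).continuousOn)))

lemma gradPair_comm (φ σ : ℍ → ℝ) (z : ℂ) : gradPair φ σ z = gradPair σ φ z := by
  simp only [gradPair, Complex.mul_re, Complex.conj_re, Complex.conj_im]
  ring

lemma gradPair_self (φ : ℍ → ℝ) (z : ℂ) : gradPair φ φ z = 2 * ‖dz (coordC φ) z‖ ^ 2 := by
  rw [gradPair, Complex.mul_conj, Complex.ofReal_re, Complex.normSq_eq_norm_sq]

lemma gradPair_add_smul {u v : ℍ → ℝ} (hu : IsSmooth u) (hv : IsSmooth v) (r : ℝ) (σ : ℍ → ℝ)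
    {z : ℂ} (hz : z ∈ upperSet) :
    gradPair (u + r • v) σ z = gradPair u σ z + r * gradPair v σ z := by
  simp only [gradPair, dz_coordC_add_smul hu hv r hz, add_mul, Complex.add_re, mul_assoc,
    Complex.re_ofReal_mul]
  ring

lemma norm_sq_dz_add_smul {u v : ℍ → ℝ} (hu : IsSmooth u) (hv : IsSmooth v) (r : ℝ)
    {z : ℂ} (hz : z ∈ upperSet) :
    ‖dz (coordC (u + r • v)) z‖ ^ 2 =
      ‖dz (coordC u) z‖ ^ 2 + r * gradPair u v z + r ^ 2 * ‖dz (coordC v) z‖ ^ 2 := by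
  have h := gradPair_self (u + r • v) z
  rw [gradPair_add_smul hu hv r _ hz, gradPair_comm u, gradPair_comm v,
    gradPair_add_smul hu hv r _ hz, gradPair_add_smul hu hv r _ hz, gradPair_self, gradPair_self,
    gradPair_comm v u] at h
  linarith

lemma coord_add_smul (u v : ℍ → ℝ) (r : ℝ) (z : ℂ) :
    coord (u + r • v) z = coord u z + r * coord v z := rfl

namespace FundamentalPolygon

variable {g : ℕ} {M : MarkedFuchsianGroup g} (P : FundamentalPolygon M)

/-- The derivative of the Liouville action at `φ` in the direction `σ`, before integration by
parts. -/
def firstVariation (φ σ : ℍ → ℝ) : ℝ :=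
  (∫ z in UpperHalfPlane.coe '' P.F, (gradPair φ σ z + coord σ z * Real.exp (coord φ z))) +
    1 / 2 * (P.kappaPairing σ).im

/-- The integral is a quadratic polynomial in `t`, with the gradient pairing as its linear
coefficient. -/
lemma hasDerivAt_dirichlet {φ σ : ℍ → ℝ} (hφ : IsSmooth φ) (hσ : IsSmooth σ) :
    HasDerivAt (fun t : ℝ => ∫ z in UpperHalfPlane.coe '' P.F,
      ‖dz (coordC (φ + t • σ)) z‖ ^ 2) (∫ z in UpperHalfPlane.coe '' P.F, gradPair φ σ z) 0 := by
  have i1 : IntegrableOn (fun z => ‖dz (coordC φ) z‖ ^ 2) (UpperHalfPlane.coe '' P.F) :=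
    integrableOn_coe_image P.compact ((contDiffOn_dz hφ.contDiffOn_coordC).continuousOn.norm.pow 2)
  have i2 := integrableOn_coe_image P.compact (continuousOn_gradPair hφ hσ)
  have i3 : IntegrableOn (fun z => ‖dz (coordC σ) z‖ ^ 2) (UpperHalfPlane.coe '' P.F) :=
    integrableOn_coe_image P.compact ((contDiffOn_dz hσ.contDiffOn_coordC).continuousOn.norm.pow 2)
  have h : ∀ t : ℝ, ∫ z in UpperHalfPlane.coe '' P.F, ‖dz (coordC (φ + t • σ)) z‖ ^ 2 =
      (∫ z in UpperHalfPlane.coe '' P.F, ‖dz (coordC φ) z‖ ^ 2) +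
        t * (∫ z in UpperHalfPlane.coe '' P.F, gradPair φ σ z) +
        t ^ 2 * (∫ z in UpperHalfPlane.coe '' P.F, ‖dz (coordC σ) z‖ ^ 2) := by
    intro t
    rw [setIntegral_congr_fun (measurableSet_coe_image P.compact)
      (forall_coe_image fun z hz => norm_sq_dz_add_smul hφ hσ t hz),
      integral_add (f := fun z => ‖dz (coordC φ) z‖ ^ 2 + t * gradPair φ σ z)
        (Integrable.add i1 (i2.const_mul t)) (i3.const_mul _),
      integral_add i1 (i2.const_mul t), integral_const_mul, integral_const_mul]
  simp_rw [h]
  have h1 := ((hasDerivAt_id (0 : ℝ)).mul_const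
    (∫ z in UpperHalfPlane.coe '' P.F, gradPair φ σ z)).const_add
      (∫ z in UpperHalfPlane.coe '' P.F, ‖dz (coordC φ) z‖ ^ 2)
  have h2 := (hasDerivAt_pow 2 (0 : ℝ)).mul_const
    (∫ z in UpperHalfPlane.coe '' P.F, ‖dz (coordC σ) z‖ ^ 2)
  exact (h1.add h2).congr_deriv (by simp)

lemma hasDerivAt_liouvilleAction (hg : 0 < g) {l : M.Γ → ℍ → ℂ} (hl : IsPrimitive M.Γ l)
    {φ σ : ℍ → ℝ} (hφ : IsSmooth φ) (hσ : IsSmooth σ) :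
    HasDerivAt (fun t : ℝ => P.liouvilleAction l (φ + t • σ)) (P.firstVariation φ σ) 0 := by
  have hcφ : ContinuousOn (coord φ) upperSet := ContDiffOn.continuousOn hφ
  have hcσ : ContinuousOn (coord σ) upperSet := ContDiffOn.continuousOn hσ
  have h : ∀ t : ℝ, P.liouvilleAction l (φ + t • σ) =
      (∫ z in UpperHalfPlane.coe '' P.F, ‖dz (coordC (φ + t • σ)) z‖ ^ 2) +
      (∫ z in UpperHalfPlane.coe '' P.F, 1 * Real.exp (coord φ z + t * coord σ z)) +
      (1 / 2 * (P.kappaPairing (φ - phiHyp)).im + t * (1 / 2 * (P.kappaPairing σ).im)) := by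
    intro t
    have hs := hφ.add_smul hσ t
    rw [P.liouvilleAction_eq hg hl hs, integral_add
      (f := fun z => ‖dz (coordC (φ + t • σ)) z‖ ^ 2) (g := fun z => Real.exp (coord (φ + t • σ) z))
      (integrableOn_coe_image P.compact ((contDiffOn_dz hs.contDiffOn_coordC).continuousOn.norm.pow 2))
      (integrableOn_coe_image P.compact
        (Real.continuous_exp.comp_continuousOn (ContDiffOn.continuousOn hs)))]
    have e : φ + t • σ - phiHyp = (φ - phiHyp) + t • σ := by abel
    rw [e, P.kappaPairing_add_smul (hφ.sub isSmooth_phiHyp) hσ, Complex.add_im,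
      Complex.im_ofReal_mul]
    simp only [one_mul, coord_add_smul]
    ring
  simp_rw [h]
  have h3 := ((hasDerivAt_id (0 : ℝ)).mul_const (1 / 2 * (P.kappaPairing σ).im)).const_add
    (1 / 2 * (P.kappaPairing (φ - phiHyp)).im)
  refine (((P.hasDerivAt_dirichlet hφ hσ).add (hasDerivAt_integral_exp P.compact
    (continuousOn_const (c := (1 : ℝ))) hcφ hcσ)).add h3).congr_deriv ?_
  rw [firstVariation, integral_add (g := fun z => coord σ z * Real.exp (coord φ z)) (integrableOn_coe_image P.compact (continuousOn_gradPair hφ hσ))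
    (integrableOn_coe_image P.compact (hcσ.mul (Real.continuous_exp.comp_continuousOn hcφ)))]
  simp

/-- On a tangent vector `v`, `kappa` takes the value `2i Im (h''/h' · v)`; thus the holomorphic half
of the form carries half of its imaginary part. -/
lemma im_curveIntegral_eq {c : Arc} (hc : c.IsSmooth) (γ : PSL(2, ℝ)) {σ : ℍ → ℝ}
    (hσ : IsSmooth σ) :
    (curveIntegral (fun z => oneForm (coordC σ z * preSchwarzian γ⁻¹ z) 0) c.toComplex).im =
      1 / 2 * (curveIntegral (fun z => coordC σ z • kappa γ z) c.toComplex).im := by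
  have i1 : CurveIntegrable (fun z => oneForm (coordC σ z * preSchwarzian γ⁻¹ z) 0) c.toComplex :=
    curveIntegrable_of_continuousOn hc (continuousOn_oneForm
      (hσ.continuousOn_coordC.mul (continuousOn_preSchwarzian _)) continuousOn_const)
  have i2 : CurveIntegrable (fun z => coordC σ z • kappa γ z) c.toComplex :=
    curveIntegrable_of_continuousOn hc (hσ.continuousOn_coordC.smul (continuousOn_kappa γ))
  rw [curveIntegral_def, curveIntegral_def]
  have e1 := (Complex.imCLM.intervalIntegral_comp_comm i1)
  have e2 := (Complex.imCLM.intervalIntegral_comp_comm i2)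
  simp only [Complex.imCLM_apply] at e1 e2
  rw [← e1, ← e2, ← intervalIntegral.integral_const_mul]
  refine intervalIntegral.integral_congr fun t _ => ?_
  simp only [curveIntegralFun_def, kappa, smul_apply, oneForm_apply, smul_eq_mul, zero_mul,
    add_zero, coordC, mul_assoc, Complex.im_ofReal_mul, Complex.add_im, neg_mul, Complex.neg_im]
  rw [← map_mul, Complex.conj_im]
  ring

/-- Integration by parts on the polygon. -/
lemma im_kappaPairing {φ σ : ℍ → ℝ} (hφ : φ ∈ conformalMetrics M.Γ)
    (hσ : σ ∈ smoothFunctions M.Γ) :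
    1 / 2 * (P.kappaPairing σ).im = -∫ z in UpperHalfPlane.coe '' P.F,
      (gradPair φ σ z + 2 * coord σ z * (dz (dzbar (coordC φ)) z).re) := by
  obtain ⟨hφs, hφi⟩ := hφ
  obtain ⟨hσs, hσi⟩ := hσ
  -- Stokes is applied to `σ φ_z dz`. As `σ` is invariant, the defect of this form under a side
  -- pairing is `σ h''/h' dz`, the integrand of the boundary functional.
  set f : ℂ → ℂ := fun z => coordC σ z * dz (coordC φ) z
  have hfs : ContDiffOn ℝ ∞ f upperSet :=
    hσs.contDiffOn_coordC.mul (contDiffOn_dz hφs.contDiffOn_coordC)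
  have hf : ContDiffOn ℝ 1 f upperSet := hfs.of_le (by norm_cast)
  have hS := P.boundsRegion.sum_curveIntegral hf
  rw [P.sum_side _ (continuousOn_oneForm hf.continuousOn continuousOn_const)] at hS
  have hpull : ∀ (γ : M.Γ) (c : Arc), curveIntegral (fun z => oneForm (f z) 0 -
      pullback ((γ : PSL(2, ℝ))⁻¹) (fun z => oneForm (f z) 0) z) c.toComplex =
      curveIntegral (fun z => oneForm (coordC σ z * preSchwarzian ((γ : PSL(2, ℝ))⁻¹) z) 0)
        c.toComplex := by
    intro γ c
    refine curveIntegral_congr _ fun t => ?_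
    have hz := c.toComplex_mem t
    set z := c.toComplex t
    have hγ : (γ : PSL(2, ℝ))⁻¹ ∈ M.Γ := M.Γ.inv_mem γ.2
    have h1 := dz_conformal_mob hφs (hφi _ hγ) hz
    have h2 : coordC σ (mob ((γ : PSL(2, ℝ))⁻¹) z) = coordC σ z := by
      rw [coordC, coord_mob, hσi _ hγ]
      rfl
    ext v
    simp only [sub_apply, pullback, ContinuousLinearMap.comp_apply, oneForm_apply, f, h2]
    linear_combination (-coordC σ z * v) * h1
  simp only [hpull] at hS
  have h1 := congrArg Complex.im hS
  rw [Complex.im_sum, Finset.sum_congr rfl fun k _ => by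
    rw [Complex.sub_im, im_curveIntegral_eq (P.a_smooth k) _ hσs,
      im_curveIntegral_eq (P.b_smooth k) _ hσs]] at h1
  have h2 : 1 / 2 * (P.kappaPairing σ).im = -(2 * Complex.I *
      ∫ z in UpperHalfPlane.coe '' P.F, dzbar f z).im := by
    rw [← h1, kappaPairing, Complex.im_sum, Finset.mul_sum, ← Finset.sum_neg_distrib]
    refine Finset.sum_congr rfl fun k _ => ?_
    rw [Complex.sub_im]
    ring
  have h3 : (2 * Complex.I * ∫ z in UpperHalfPlane.coe '' P.F, dzbar f z).im =
      2 * (∫ z in UpperHalfPlane.coe '' P.F, dzbar f z).re := by simp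
  have hint : IntegrableOn (dzbar f) (UpperHalfPlane.coe '' P.F) :=
    integrableOn_coe_image P.compact (contDiffOn_dzbar hfs).continuousOn
  have h4 := Complex.reCLM.integral_comp_comm hint
  simp only [Complex.reCLM_apply] at h4
  rw [h2, h3, ← h4, ← integral_const_mul, neg_inj]
  refine setIntegral_congr_fun (measurableSet_coe_image P.compact)
    (forall_coe_image fun z hz => ?_)
  have hd := hasFDerivAt_oneForm (differentiableAt_of_contDiffOn
    (contDiffOn_dz hφs.contDiffOn_coordC) hz)
  have hprod := dzbar_eq (hasFDerivAt_oneForm_mul (hσs.hasFDerivAt hz) hd)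
  have hconj : dz (dzbar (coordC φ)) z = (starRingEnd ℂ) (dzbar (dz (coordC φ)) z) := by
    refine dz_eq ((hasFDerivAt_conj hd).congr_of_eventuallyEq ?_)
    filter_upwards [eventually_upperSet hz] with w hw
    exact dzbar_coordC φ (differentiableAt_of_contDiffOn hφs.contDiffOn_coordC hw)
  simp only [f]
  rw [hprod, hconj, Complex.conj_re, gradPair, Complex.add_re, coordC, Complex.re_ofReal_mul]
  ring

/-- After integration by parts the gradient terms cancel, leaving `σ (e^φ - 2 φ_{z z̄})`, which is
`(K + 1) σ e^φ` by definition of the curvature. -/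
lemma firstVariation_eq {φ σ : ℍ → ℝ} (hφ : φ ∈ conformalMetrics M.Γ)
    (hσ : σ ∈ smoothFunctions M.Γ) :
    P.firstVariation φ σ = ∫ z in UpperHalfPlane.coe '' P.F,
      coord (fun w => (curvature φ w + 1) * σ w * Real.exp (φ w)) z := by
  have hcφ : ContinuousOn (coord φ) upperSet := ContDiffOn.continuousOn hφ.1
  have hcσ : ContinuousOn (coord σ) upperSet := ContDiffOn.continuousOn hσ.1
  rw [firstVariation, P.im_kappaPairing hφ hσ, ← sub_eq_add_neg, ← integral_sub]
  · refine setIntegral_congr_fun (measurableSet_coe_image P.compact)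
      (forall_coe_image fun z hz => ?_)
    simp only [coord, curvature, coe_ofComplex hz, Real.exp_neg]
    have := (Real.exp_pos (φ (UpperHalfPlane.ofComplex z))).ne'
    field_simp
    ring
  · exact integrableOn_coe_image P.compact ((continuousOn_gradPair hφ.1 hσ.1).add
      (hcσ.mul (Real.continuous_exp.comp_continuousOn hcφ)))
  · exact integrableOn_coe_image P.compact ((continuousOn_gradPair hφ.1 hσ.1).add
      ((continuousOn_const.mul hcσ).mul (Complex.continuous_re.comp_continuousOn
        (contDiffOn_dz (contDiffOn_dzbar hφ.1.contDiffOn_coordC)).continuousOn)))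

end FundamentalPolygon

/-! ### Critical points and the second variation -/

/-- Needed so that the union of all translates of the frontier of the polygon is a null set. -/
lemma MarkedFuchsianGroup.countable {g : ℕ} (M : MarkedFuchsianGroup g) : Countable M.Γ := by
  have : Countable (FreeGroup (Fin g ⊕ Fin g)) := Quotient.countable
  exact M.generates.countable

lemma volume_real_eq_integral {F : Set ℍ} (hF : IsCompact F) :
    (volume : Measure ℍ).real F = ∫ z in UpperHalfPlane.coe '' F, (1 / z.im ^ 2 : ℝ) := by
  rw [Measure.real, UpperHalfPlane.volume_eq_lintegral, integral_eq_lintegral_of_nonneg_ae]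
  · congr 1
    refine setLIntegral_congr_fun (measurableSet_coe_image hF) fun z _ => ?_
    rw [← ENNReal.ofReal_coe_nnreal]
    congr 1
    simp
  · exact Filter.Eventually.of_forall fun z => by positivity
  · have : Measurable fun z : ℂ => (1 / z.im ^ 2 : ℝ) := by fun_prop
    exact this.aestronglyMeasurable

lemma volume_eq_zero_of_coe_image {s : Set ℍ} (h : volume (UpperHalfPlane.coe '' s) = 0) :
    volume s = 0 := by
  rw [UpperHalfPlane.volume_eq_lintegral]
  exact setLIntegral_measure_zero _ _ h

namespace FundamentalPolygon

variable {g : ℕ} {M : MarkedFuchsianGroup g} (P : FundamentalPolygon M)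

/-- An invariant continuous function which vanishes almost everywhere on the polygon is zero. -/
lemma eq_zero_of_ae {u : ℍ → ℝ} (hu : Continuous u) (hi : ∀ γ ∈ M.Γ, ∀ z : ℍ, u (γ • z) = u z)
    (h0 : ∀ᵐ z ∂(volume.restrict (UpperHalfPlane.coe '' P.F)), coord u z = 0) : u = 0 := by
  have hne : IsOpen {z : ℍ | u z ≠ 0} := isOpen_ne_fun hu continuous_const
  have hint : ∀ z ∈ interior P.F, u z = 0 := by
    have hopen : IsOpen (UpperHalfPlane.coe '' (interior P.F ∩ {z : ℍ | u z ≠ 0})) :=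
      UpperHalfPlane.isOpenEmbedding_coe.isOpenMap _ (isOpen_interior.inter hne)
    have hnull : volume (UpperHalfPlane.coe '' (interior P.F ∩ {z : ℍ | u z ≠ 0})) = 0 := by
      rw [ae_restrict_iff' (measurableSet_coe_image P.compact)] at h0
      refine measure_mono_null ?_ h0
      rintro _ ⟨z, ⟨hz, hz'⟩, rfl⟩
      simp only [Set.mem_compl_iff, Set.mem_ofPred_eq, coord_coe]
      exact fun h => hz' (h ⟨z, interior_subset hz, rfl⟩)
    intro z hz
    by_contra hz'
    have hempty := hopen.measure_eq_zero_iff volume |>.mp hnull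
    have : (z : ℂ) ∈ UpperHalfPlane.coe '' (interior P.F ∩ {z : ℍ | u z ≠ 0}) := ⟨z, ⟨hz, hz'⟩, rfl⟩
    rw [hempty] at this
    exact this
  -- By invariance and the covering property, `u` can be nonzero only on translates of the frontier.
  -- These form a null set, whereas the nonvanishing set is open.
  have hcov : UpperHalfPlane.coe '' {z : ℍ | u z ≠ 0} ⊆
      ⋃ γ : M.Γ, mob (γ : PSL(2, ℝ)) '' (UpperHalfPlane.coe '' frontier P.F) := by
    rintro _ ⟨z, hz, rfl⟩
    obtain ⟨γ, hγ⟩ := P.covers z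
    refine Set.mem_iUnion.mpr ⟨γ⁻¹, ((γ • z : ℍ) : ℂ), ⟨γ • z, ⟨subset_closure hγ, fun hin => ?_⟩,
      rfl⟩, ?_⟩
    · have := hint _ hin
      exact hz ((hi γ γ.2 z).symm.trans this)
    · rw [mob_coe]
      congr 1
      exact inv_smul_smul γ z
  have := M.countable
  have hnull : volume (UpperHalfPlane.coe '' {z : ℍ | u z ≠ 0}) = 0 := by
    refine measure_mono_null hcov (measure_iUnion_null fun γ => ?_)
    refine addHaar_image_eq_zero_of_differentiableOn_of_addHaar_eq_zero volume ?_
      P.boundsRegion.volume_frontier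
    exact ((contDiffOn_mob_real (γ : PSL(2, ℝ)) (n := 1)).differentiableOn one_ne_zero).mono
      (forall_coe_image fun z hz => hz)
  have hempty := (UpperHalfPlane.isOpenEmbedding_coe.isOpenMap _ hne).measure_eq_zero_iff volume
    |>.mp hnull
  funext z
  by_contra hz
  have : (z : ℂ) ∈ UpperHalfPlane.coe '' {z : ℍ | u z ≠ 0} := ⟨z, hz, rfl⟩
  rw [hempty] at this
  exact this

/-- The common end of three arguments: the Euler–Lagrange equation, uniqueness, and positivity of
the second variation. Each supplies a nonnegative weight that controls the zeros of `u`. -/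
lemma eq_zero_of_integral_eq_zero {u : ℍ → ℝ} (hu : Continuous u)
    (hi : ∀ γ ∈ M.Γ, ∀ z : ℍ, u (γ • z) = u z) {w : ℂ → ℝ} (hw : ContinuousOn w upperSet)
    (hw0 : ∀ z ∈ upperSet, 0 ≤ w z) (hwu : ∀ z ∈ upperSet, w z = 0 → coord u z = 0)
    (h : ∫ z in UpperHalfPlane.coe '' P.F, w z = 0) : u = 0 := by
  refine P.eq_zero_of_ae hu hi ?_
  have hm := measurableSet_coe_image P.compact
  have h1 := (integral_eq_zero_iff_of_nonneg_ae (μ := volume.restrict (UpperHalfPlane.coe '' P.F))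
    ((ae_restrict_iff' hm).mpr (Filter.Eventually.of_forall (forall_coe_image hw0)))
    (integrableOn_coe_image P.compact hw)).mp h
  filter_upwards [h1, ae_restrict_mem hm] with z hz hzF
  exact forall_coe_image hwu z hzF hz

lemma integrableOn_gradPair_add {φ σ : ℍ → ℝ} (hφ : IsSmooth φ) (hσ : IsSmooth σ) :
    IntegrableOn (fun z => gradPair φ σ z + coord σ z * Real.exp (coord φ z))
      (UpperHalfPlane.coe '' P.F) :=
  integrableOn_coe_image P.compact ((continuousOn_gradPair hφ hσ).add
    ((ContDiffOn.continuousOn hσ).mul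
      (Real.continuous_exp.comp_continuousOn (ContDiffOn.continuousOn hφ))))

lemma isCriticalPoint_iff (hg : 0 < g) {l : M.Γ → ℍ → ℂ} (hl : IsPrimitive M.Γ l)
    {φ : ℍ → ℝ} (hφ : φ ∈ conformalMetrics M.Γ) :
    IsCriticalPoint M.Γ (P.liouvilleAction l) φ ↔
      ∀ σ ∈ smoothFunctions M.Γ, P.firstVariation φ σ = 0 := by
  refine forall₂_congr fun σ hσ => ?_
  have h := P.hasDerivAt_liouvilleAction hg hl hφ.1 hσ.1
  exact ⟨fun h0 => h.unique h0, fun h0 => h0 ▸ h⟩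

/-- In the direction `σ = K + 1` the first variation is `∬ (K + 1)² e^φ`, which vanishes only if `K
= -1` everywhere. -/
theorem isCriticalPoint_iff_curvature (hg : 0 < g) {l : M.Γ → ℍ → ℂ} (hl : IsPrimitive M.Γ l)
    {φ : ℍ → ℝ} (hφ : φ ∈ conformalMetrics M.Γ) :
    IsCriticalPoint M.Γ (P.liouvilleAction l) φ ↔ ∀ z : ℍ, curvature φ z = -1 := by
  rw [P.isCriticalPoint_iff hg hl hφ]
  have hcφ : ContinuousOn (coord φ) upperSet := ContDiffOn.continuousOn hφ.1
  constructor
  · intro h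
    have hσ := curvature_add_one_mem hφ
    have h1 := h _ hσ
    rw [P.firstVariation_eq hφ hσ] at h1
    have hc : ContinuousOn (coord fun z => curvature φ z + 1) upperSet :=
      ContDiffOn.continuousOn hσ.1
    have h2 := P.eq_zero_of_integral_eq_zero (IsSmooth.continuous hσ.1) hσ.2
      ((hc.mul hc).mul (Real.continuous_exp.comp_continuousOn hcφ))
      (fun z _ => mul_nonneg (mul_self_nonneg _) (Real.exp_pos _).le)
      (fun z _ h0 => mul_self_eq_zero.mp ((mul_eq_zero.mp h0).resolve_right (Real.exp_pos _).ne'))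
      h1
    intro z
    have := congrFun h2 z
    simp only [Pi.zero_apply] at this
    linarith
  · intro h σ hσ
    rw [P.firstVariation_eq hφ hσ]
    simp [h, coord]

/-- Convexity along the segment from `φ_hyp` to `φ`. With `u = φ - φ_hyp`, the first variations at
the two ends in direction `u` have the same boundary term, and they differ by `∬ 2|u_z|² + u (e^φ -
e^{φ_hyp})`. Both summands are nonnegative, and the second vanishes only where `u = 0`. -/
theorem isCriticalPoint_iff_eq_phiHyp (hg : 0 < g) {l : M.Γ → ℍ → ℂ} (hl : IsPrimitive M.Γ l)
    {φ : ℍ → ℝ} (hφ : φ ∈ conformalMetrics M.Γ) :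
    IsCriticalPoint M.Γ (P.liouvilleAction l) φ ↔ φ = phiHyp := by
  have h0 : IsCriticalPoint M.Γ (P.liouvilleAction l) phiHyp :=
    (P.isCriticalPoint_iff_curvature hg hl (phiHyp_mem M.Γ)).mpr curvature_phiHyp
  refine ⟨fun h => ?_, fun h => h ▸ h0⟩
  rw [P.isCriticalPoint_iff hg hl hφ] at h
  rw [P.isCriticalPoint_iff hg hl (phiHyp_mem M.Γ)] at h0
  set u := φ - phiHyp with hu
  have hus : IsSmooth u := hφ.1.sub isSmooth_phiHyp
  have hui : ∀ γ ∈ M.Γ, ∀ z : ℍ, u (γ • z) = u z := fun γ hγ z => by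
    simp only [hu, Pi.sub_apply]
    linarith [hφ.2 γ hγ z, (phiHyp_mem M.Γ).2 γ hγ z]
  have e : φ = phiHyp + (1 : ℝ) • u := by
    rw [one_smul, hu]
    abel
  have h1 := (h u ⟨hus, hui⟩).trans (h0 u ⟨hus, hui⟩).symm
  rw [firstVariation, firstVariation, add_left_inj, ← sub_eq_zero, ← integral_sub] at h1
  · have hcφ : ContinuousOn (coord φ) upperSet := ContDiffOn.continuousOn hφ.1
    have hc0 : ContinuousOn (coord phiHyp) upperSet := ContDiffOn.continuousOn isSmooth_phiHyp
    have hcu : ContinuousOn (coord u) upperSet := ContDiffOn.continuousOn hus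
    have hpos : ∀ z ∈ upperSet, 0 ≤ coord u z * (Real.exp (coord φ z) - Real.exp (coord phiHyp z)) ∧
        (coord u z * (Real.exp (coord φ z) - Real.exp (coord phiHyp z)) = 0 → coord u z = 0) := by
      intro z _
      have e1 : coord φ z - coord phiHyp z = coord u z := rfl
      refine ⟨?_, fun h => ?_⟩
      · rcases le_total (coord phiHyp z) (coord φ z) with h | h
        · exact mul_nonneg (by linarith) (sub_nonneg.mpr (Real.exp_le_exp.mpr h))
        · exact mul_nonneg_of_nonpos_of_nonpos (by linarith)
            (sub_nonpos.mpr (Real.exp_le_exp.mpr h))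
      · rcases mul_eq_zero.mp h with h | h
        · exact h
        · have := Real.exp_injective (sub_eq_zero.mp h)
          linarith
    have hw : ∀ z ∈ upperSet, gradPair φ u z + coord u z * Real.exp (coord φ z) -
        (gradPair phiHyp u z + coord u z * Real.exp (coord phiHyp z)) =
        2 * ‖dz (coordC u) z‖ ^ 2 +
          coord u z * (Real.exp (coord φ z) - Real.exp (coord phiHyp z)) := by
      intro z hz
      have h2 : gradPair φ u z = gradPair phiHyp u z + gradPair u u z := by
        conv_lhs => rw [e, gradPair_add_smul isSmooth_phiHyp hus 1 u hz]
        ring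
      rw [h2, gradPair_self]
      ring
    rw [setIntegral_congr_fun (measurableSet_coe_image P.compact) (forall_coe_image hw)] at h1
    have h3 := P.eq_zero_of_integral_eq_zero hus.continuous hui
      ((continuousOn_const.mul ((contDiffOn_dz hus.contDiffOn_coordC).continuousOn.norm.pow 2)).add
        (hcu.mul ((Real.continuous_exp.comp_continuousOn hcφ).sub
          (Real.continuous_exp.comp_continuousOn hc0))))
      (fun z hz => add_nonneg (mul_nonneg zero_le_two (sq_nonneg _)) (hpos z hz).1)
      (fun z hz h => (hpos z hz).2 (by
        have h5 : 2 * ‖dz (coordC u) z‖ ^ 2 +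
          coord u z * (Real.exp (coord φ z) - Real.exp (coord phiHyp z)) = 0 := h
        nlinarith [(hpos z hz).1, sq_nonneg ‖dz (coordC u) z‖]))
      h1
    exact sub_eq_zero.mp h3
  · exact P.integrableOn_gradPair_add hφ.1 hus
  · exact P.integrableOn_gradPair_add isSmooth_phiHyp hus

/-- The second variation of the Dirichlet type integral `∫ |φ_z|² + e^φ` at `φ_hyp`. -/
def hessianIntegral (σ τ : ℍ → ℝ) : ℝ :=
  ∫ z in UpperHalfPlane.coe '' P.F,
    (gradPair σ τ z + coord σ z * coord τ z * Real.exp (coord phiHyp z))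

lemma hessianIntegral_comm (σ τ : ℍ → ℝ) : P.hessianIntegral σ τ = P.hessianIntegral τ σ := by
  simp only [hessianIntegral, gradPair_comm σ, mul_comm (coord σ _)]

lemma continuousOn_hessian_integrand {σ τ : ℍ → ℝ} (hσ : IsSmooth σ) (hτ : IsSmooth τ) :
    ContinuousOn (fun z => gradPair σ τ z + coord σ z * coord τ z * Real.exp (coord phiHyp z))
      upperSet :=
  (continuousOn_gradPair hσ hτ).add (((ContDiffOn.continuousOn hσ).mul
    (ContDiffOn.continuousOn hτ)).mul
    (Real.continuous_exp.comp_continuousOn (ContDiffOn.continuousOn isSmooth_phiHyp)))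

lemma hessianIntegral_add_smul {u v τ : ℍ → ℝ} (hu : IsSmooth u) (hv : IsSmooth v)
    (hτ : IsSmooth τ) (r : ℝ) :
    P.hessianIntegral (u + r • v) τ = P.hessianIntegral u τ + r * P.hessianIntegral v τ := by
  simp only [hessianIntegral]
  rw [← integral_const_mul, ← integral_add
    (integrableOn_coe_image P.compact (continuousOn_hessian_integrand hu hτ))
    ((integrableOn_coe_image P.compact (continuousOn_hessian_integrand hv hτ)).const_mul r)]
  refine setIntegral_congr_fun (measurableSet_coe_image P.compact)
    (forall_coe_image fun z hz => ?_)
  simp only [gradPair_add_smul hu hv r τ hz, coord_add_smul]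
  ring

/-- The second variation of the Liouville action at the hyperbolic metric. -/
def hessian : LinearMap.BilinForm ℝ (smoothFunctions M.Γ) :=
  have hadd (σ σ' τ : smoothFunctions M.Γ) : P.hessianIntegral (σ + σ' : smoothFunctions M.Γ) τ =
      P.hessianIntegral σ τ + P.hessianIntegral σ' τ := by
    simpa using P.hessianIntegral_add_smul σ.2.1 σ'.2.1 τ.2.1 1
  have hsmul (c : ℝ) (σ τ : smoothFunctions M.Γ) :
      P.hessianIntegral (c • σ : smoothFunctions M.Γ) τ = c • P.hessianIntegral σ τ := by
    have h0 : P.hessianIntegral 0 τ = 0 := by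
      simpa using P.hessianIntegral_add_smul (0 : smoothFunctions M.Γ).2.1
        (0 : smoothFunctions M.Γ).2.1 τ.2.1 1
    simpa [h0] using P.hessianIntegral_add_smul (0 : smoothFunctions M.Γ).2.1 σ.2.1 τ.2.1 c
  LinearMap.mk₂ ℝ (fun σ τ => P.hessianIntegral σ τ) hadd hsmul
    (fun σ τ τ' => by simp only [P.hessianIntegral_comm σ, hadd])
    (fun c σ τ => by simp only [P.hessianIntegral_comm σ, hsmul])

lemma hessian_apply (σ τ : smoothFunctions M.Γ) :
    P.hessian σ τ = P.hessianIntegral σ τ := rfl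

lemma hessian_pos {σ : smoothFunctions M.Γ} (h : σ ≠ 0) : 0 < P.hessian σ σ := by
  have hw : ∀ z, gradPair σ σ z + coord (σ : ℍ → ℝ) z * coord σ z * Real.exp (coord phiHyp z) =
      2 * ‖dz (coordC σ) z‖ ^ 2 + coord (σ : ℍ → ℝ) z ^ 2 * Real.exp (coord phiHyp z) := fun z => by
    rw [gradPair_self]
    ring
  have h0 : ∀ z, 0 ≤ gradPair σ σ z + coord (σ : ℍ → ℝ) z * coord σ z * Real.exp (coord phiHyp z) :=
    fun z => by
      rw [hw]
      positivity
  refine lt_of_le_of_ne (integral_nonneg h0) fun he => h (Subtype.ext ?_)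
  refine P.eq_zero_of_integral_eq_zero σ.2.1.continuous σ.2.2
    (continuousOn_hessian_integrand σ.2.1 σ.2.1) (fun z _ => h0 z) (fun z _ hz => ?_) he.symm
  rw [hw] at hz
  have h1 : coord (σ : ℍ → ℝ) z ^ 2 * Real.exp (coord phiHyp z) = 0 :=
    le_antisymm (by nlinarith [sq_nonneg ‖dz (coordC σ) z‖]) (by positivity)
  exact pow_eq_zero_iff two_ne_zero |>.mp ((mul_eq_zero.mp h1).resolve_right (Real.exp_pos _).ne')

lemma hessian_isSymm : P.hessian.IsSymm :=
  ⟨fun _ _ => P.hessianIntegral_comm _ _⟩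

lemma hessian_nondegenerate : P.hessian.Nondegenerate := by
  have h : ∀ σ, P.hessian σ σ = 0 → σ = 0 := fun σ h => by
    by_contra h0
    exact (P.hessian_pos h0).ne' h
  exact ⟨fun σ hσ => h σ (hσ σ), fun σ hσ => h σ (hσ σ)⟩

lemma hasDerivAt_firstVariation {φ σ τ : ℍ → ℝ} (hφ : IsSmooth φ) (hσ : IsSmooth σ)
    (hτ : IsSmooth τ) :
    HasDerivAt (fun s : ℝ => P.firstVariation (φ + s • σ) τ)
      (∫ z in UpperHalfPlane.coe '' P.F,
        (gradPair σ τ z + coord τ z * coord σ z * Real.exp (coord φ z))) 0 := by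
  have hcφ : ContinuousOn (coord φ) upperSet := ContDiffOn.continuousOn hφ
  have hcσ : ContinuousOn (coord σ) upperSet := ContDiffOn.continuousOn hσ
  have hcτ : ContinuousOn (coord τ) upperSet := ContDiffOn.continuousOn hτ
  have i1 := integrableOn_coe_image P.compact (continuousOn_gradPair hφ hτ)
  have i2 := integrableOn_coe_image P.compact (continuousOn_gradPair hσ hτ)
  have h : ∀ s : ℝ, P.firstVariation (φ + s • σ) τ =
      ((∫ z in UpperHalfPlane.coe '' P.F, gradPair φ τ z) +
        s * ∫ z in UpperHalfPlane.coe '' P.F, gradPair σ τ z) +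
      (∫ z in UpperHalfPlane.coe '' P.F,
        coord τ z * Real.exp (coord φ z + s * coord σ z)) + 1 / 2 * (P.kappaPairing τ).im := by
    intro s
    rw [firstVariation, ← integral_const_mul, ← integral_add i1 (i2.const_mul s), ← integral_add
      (f := fun z => gradPair φ τ z + s * gradPair σ τ z)
      (g := fun z => coord τ z * Real.exp (coord φ z + s * coord σ z)) (i1.add (i2.const_mul s))
      (integrableOn_coe_image P.compact (hcτ.mul (Real.continuous_exp.comp_continuousOn
        (hcφ.add (continuousOn_const.mul hcσ)))))]
    congr 1
    refine setIntegral_congr_fun (measurableSet_coe_image P.compact)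
      (forall_coe_image fun z hz => ?_)
    simp only [gradPair_add_smul hφ hσ s τ hz, coord_add_smul]
  simp_rw [h]
  refine (((((hasDerivAt_id (0 : ℝ)).mul_const _).const_add _).add
    (hasDerivAt_integral_exp P.compact hcτ hcφ hcσ)).add_const _).congr_deriv ?_
  rw [one_mul, ← integral_add (g := fun z => coord τ z * coord σ z * Real.exp (coord φ z)) i2
    (integrableOn_coe_image P.compact
      ((hcτ.mul hcσ).mul (Real.continuous_exp.comp_continuousOn hcφ)))]

theorem isSecondVariation_hessian (hg : 0 < g) {l : M.Γ → ℍ → ℂ} (hl : IsPrimitive M.Γ l) :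
    IsSecondVariation M.Γ (P.liouvilleAction l) phiHyp P.hessian := by
  intro σ τ
  have h : ∀ s : ℝ, HasDerivAt
      (fun t : ℝ => P.liouvilleAction l (phiHyp + s • (σ : ℍ → ℝ) + t • (τ : ℍ → ℝ)))
      (P.firstVariation (phiHyp + s • (σ : ℍ → ℝ)) τ) 0 := fun s =>
    P.hasDerivAt_liouvilleAction hg hl (isSmooth_phiHyp.add_smul σ.2.1 s) τ.2.1
  refine ⟨fun s => (h s).differentiableAt, ?_⟩
  simp_rw [fun s => (h s).deriv]
  refine (P.hasDerivAt_firstVariation isSmooth_phiHyp σ.2.1 τ.2.1).congr_deriv ?_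
  simp only [hessian_apply, hessianIntegral, mul_comm (coord (σ : ℍ → ℝ) _)]

/-- At `φ_hyp` the boundary term is evaluated at zero, and `|φ_z|²` and `e^φ` both equal `1/y²`;
this is where the factor two comes from. -/
theorem liouvilleAction_phiHyp (hg : 0 < g) {l : M.Γ → ℍ → ℂ} (hl : IsPrimitive M.Γ l) :
    P.liouvilleAction l phiHyp = 2 * (volume : Measure ℍ).real P.F := by
  have h0 : P.kappaPairing 0 = 0 := by
    have h := P.kappaPairing_add_smul (u := 0) (v := 0) (contDiffOn_const) (contDiffOn_const) 1
    simpa using h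
  rw [P.liouvilleAction_eq hg hl isSmooth_phiHyp, sub_self, h0, volume_real_eq_integral P.compact,
    ← integral_const_mul]
  simp only [Complex.zero_im, mul_zero, add_zero]
  refine setIntegral_congr_fun (measurableSet_coe_image P.compact)
    (forall_coe_image fun z hz => ?_)
  have hz' : (0 : ℝ) < z.im := hz
  simp only [dz_phiHyp hz, coord_phiHyp hz]
  rw [norm_div, Complex.norm_I, Complex.norm_real, Real.norm_eq_abs, abs_of_pos hz']
  rw [show -2 * Real.log z.im = -Real.log (z.im ^ 2) by rw [Real.log_pow]; push_cast; ring,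
    Real.exp_neg, Real.exp_log (by positivity)]
  field_simp
  ring

end FundamentalPolygon

/-! ### An antiderivative of `θ[φ_hyp]` -/

/-- The sign of the matrix is free in `PSL(2, ℝ)`. With `c > 0` the map `z ↦ cz + d` preserves the
upper half-plane, so the argument of `cz + d` lies in `(0, π)`. -/
lemma exists_mobius_nonneg (γ : PSL(2, ℝ)) : ∃ a b c d : ℝ, a * d - b * c = 1 ∧ 0 ≤ c ∧
    ∀ z ∈ upperSet, mob γ z = (a * z + b) / (c * z + d) := by
  obtain ⟨a, b, c, d, h, hm⟩ := exists_mobius γ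
  rcases le_total 0 c with hc | hc
  · exact ⟨a, b, c, d, h, hc, hm⟩
  · refine ⟨-a, -b, -c, -d, by linarith, by linarith, fun z hz => ?_⟩
    rw [hm z hz, ← neg_div_neg_eq]
    push_cast
    congr 1 <;> ring

lemma hasDerivAt_integral_log_sin (c : ℝ) {t : ℝ} (ht : t ∈ Set.Ioo 0 Real.pi) (hc : c ≠ 0) :
    HasDerivAt (fun t => ∫ s in Real.pi / 2..t, 8 * Real.log (Real.sin s / c))
      (8 * Real.log (Real.sin t / c)) t := by
  have hcont : ContinuousOn (fun s => 8 * Real.log (Real.sin s / c)) (Set.Ioo 0 Real.pi) :=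
    continuousOn_const.mul (((Real.continuous_sin.div_const c).continuousOn).log fun s hs =>
      div_ne_zero (Real.sin_pos_of_pos_of_lt_pi hs.1 hs.2).ne' hc)
  have hsub : Set.uIcc (Real.pi / 2) t ⊆ Set.Ioo 0 Real.pi :=
    (Set.ordConnected_Ioo).uIcc_subset ⟨by positivity, by linarith [Real.pi_pos]⟩ ht
  exact intervalIntegral.integral_hasDerivAt_right (hcont.mono hsub).intervalIntegrable
    (hcont.stronglyMeasurableAtFilter isOpen_Ioo t ht)
    (hcont.continuousAt (isOpen_Ioo.mem_nhds ht))

/-- For `h = (az + b)/(cz + d)` with `c > 0`, set `w = cz + d`. Then `h''/h' = -2c/w`, the form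
`kappa` is `-4i d(arg w)`, and the scalar factor is `-2 log (sin (arg w) / c)`. Thus `θ = 8i log
(sin (arg w) / c) d(arg w)` depends on `arg w` alone and is exact. -/
lemma exists_hasFDerivAt_theta (γ : PSL(2, ℝ)) :
    ∃ f : ℍ → ℂ, ∀ z : ℍ, HasFDerivAt (coord f) (theta phiHyp γ z) (z : ℂ) := by
  obtain ⟨a, b, c, d, h, hc, hm⟩ := exists_mobius_nonneg γ⁻¹
  -- If `c = 0`, then `h` is affine, `h'' = 0` and the form vanishes.
  rcases hc.eq_or_lt with rfl | hc
  · refine ⟨0, fun z => (hasFDerivAt_const (0 : ℂ) (z : ℂ)).congr_fderiv ?_⟩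
    ext v
    simp [theta, deriv_deriv_mob_eq h hm (coe_mem_upperSet z), oneForm_apply]
  set H : ℝ → ℝ := fun t => ∫ s in Real.pi / 2..t, 8 * Real.log (Real.sin s / c) with hH
  set G : ℂ → ℂ := fun z => (H (Complex.log (c * z + d)).im : ℂ) * Complex.I with hG
  refine ⟨fun z => G z, fun z => ?_⟩
  have hz := coe_mem_upperSet z
  have hy : 0 < (z : ℂ).im := hz
  set w : ℂ := c * z + d with hw
  have hwim : w.im = c * (z : ℂ).im := by simp [hw]
  have hwpos : 0 < w.im := hwim ▸ mul_pos hc hy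
  have hslit : w ∈ Complex.slitPlane := Or.inr hwpos.ne'
  have hw0 : w ≠ 0 := Complex.slitPlane_ne_zero hslit
  have hn : 0 < ‖w‖ := norm_pos_iff.mpr hw0
  have ht : w.arg ∈ Set.Ioo 0 Real.pi := by
    refine ⟨lt_of_le_of_ne (Complex.arg_nonneg_iff.mpr hwpos.le) fun h0 => ?_,
      lt_of_le_of_ne (Complex.arg_le_pi w) fun h0 => ?_⟩
    · exact hwpos.ne' (Complex.arg_eq_zero_iff.mp h0.symm).2
    · exact hwpos.ne' (Complex.arg_eq_pi_iff.mp h0).2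
  have h1 : HasDerivAt (fun z : ℂ => Complex.log (c * z + d)) (c / w) (z : ℂ) := by
    have h2 : HasDerivAt (fun z : ℂ => (c : ℂ) * z + d) c (z : ℂ) := by
      simpa using ((hasDerivAt_id (z : ℂ)).const_mul (c : ℂ)).add_const (d : ℂ)
    exact h2.clog hslit
  have h3 : HasDerivAt H (8 * Real.log (Real.sin w.arg / c))
      (Complex.imCLM (Complex.log (c * z + d))) := by
    rw [Complex.imCLM_apply, Complex.log_im]
    exact hasDerivAt_integral_log_sin c ht hc.ne'
  have h4 := (h3.hasFDerivAt.comp (z : ℂ) (Complex.imCLM.hasFDerivAt.comp (z : ℂ)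
    (h1.hasFDerivAt.restrictScalars ℝ)))
  have h5 := (Complex.ofRealCLM.hasFDerivAt.comp (z : ℂ) h4).mul_const Complex.I
  refine HasFDerivAt.congr_fderiv (h5.congr_of_eventuallyEq ?_) ?_
  · filter_upwards [eventually_upperSet hz] with v hv
    simp [coord, coe_ofComplex hv, hG]
  · have hcoef : coord phiHyp z - 1 / 2 * Real.log (‖deriv (mob γ⁻¹) z‖ ^ 2) =
        -2 * Real.log (Real.sin w.arg / c) := by
      rw [coord_phiHyp hz, deriv_mob_eq h hm hz, Complex.sin_arg, hwim, ← hw]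
      have e1 : c * (z : ℂ).im / ‖w‖ / c = (z : ℂ).im / ‖w‖ := by field_simp
      rw [e1, Real.log_div hy.ne' hn.ne', norm_div, norm_one, norm_pow,
        one_div (‖w‖ ^ 2), Real.log_pow, Real.log_inv, Real.log_pow]
      push_cast
      ring
    have hp : deriv (deriv (mob γ⁻¹)) z / deriv (mob γ⁻¹) z = -2 * (c / w) := by
      rw [deriv_mob_eq h hm hz, deriv_deriv_mob_eq h hm hz, ← hw]
      field_simp
    ext v
    have hI := Complex.sub_conj (-2 * (c / w) * v)
    rw [map_mul] at hI
    simp only [theta, hcoef, hp, smul_apply, oneForm_apply, smul_eq_mul, neg_mul, ← sub_eq_add_neg]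
    simp only [neg_mul] at hI
    rw [hI]
    simp
    ring

theorem exists_isPrimitive (Γ : Subgroup PSL(2, ℝ)) : ∃ l : Γ → ℍ → ℂ, IsPrimitive Γ l := by
  classical
  choose f hf using exists_hasFDerivAt_theta
  -- Setting `l 1 = 0` is consistent because the form attached to the identity is zero.
  refine ⟨fun γ => if γ = 1 then 0 else f γ, by simp, fun γ z => ?_⟩
  rcases eq_or_ne γ 1 with rfl | hγ
  · rw [if_pos rfl]
    refine (hasFDerivAt_const (0 : ℂ) (z : ℂ)).congr_fderiv ?_
    have h : deriv (deriv (mob 1)) z = 0 := by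
      refine ((hasDerivAt_const (z : ℂ) (1 : ℂ)).congr_of_eventuallyEq ?_).deriv
      filter_upwards [eventually_upperSet (coe_mem_upperSet z)] with w hw using deriv_mob_one hw
    ext v
    simp [theta, h, oneForm_apply]
  · rw [if_neg hγ]
    exact hf γ z

/-! ### Continuous logarithms and the rotation number of a simple closed curve -/

lemma exists_int_of_exp_eq_one {X : Type*} [TopologicalSpace X] {U : Set X} (hU : IsPreconnected U)
    {f : X → ℂ} (hf : ContinuousOn f U) (h : ∀ x ∈ U, Complex.exp (f x) = 1) :
    ∃ m : ℤ, ∀ x ∈ U, f x = m * (2 * Real.pi * Complex.I) := by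
  have hpi := Complex.two_pi_I_ne_zero
  have hd : IsDiscrete (Set.range ((↑) : ℤ → ℝ)) :=
    Int.isClosedEmbedding_coe_real.isEmbedding.isDiscrete_range
  have hint : ∀ x ∈ U, ∃ m : ℤ, f x = m * (2 * Real.pi * Complex.I) := fun x hx =>
    Complex.exp_eq_one_iff.mp (h x hx)
  have hre : ∀ (x : X) (m : ℤ), f x = m * (2 * Real.pi * Complex.I) →
      (f x / (2 * Real.pi * Complex.I)).re = m := by
    intro x m hm
    rw [hm, mul_div_cancel_right₀ _ hpi, Complex.intCast_re]
  obtain ⟨_, ⟨m, rfl⟩, hm⟩ := hU.eqOn_const_of_mapsTo hd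
    (Complex.continuous_re.comp_continuousOn (hf.div_const (2 * Real.pi * Complex.I)))
    (fun x hx => by
      obtain ⟨m, hm⟩ := hint x hx
      exact ⟨m, (hre x m hm).symm⟩) ⟨_, 0, rfl⟩
  refine ⟨m, fun x hx => ?_⟩
  obtain ⟨m', hm'⟩ := hint x hx
  have h1 : (m' : ℝ) = m := (hre x m' hm').symm.trans (hm hx)
  rw [hm', Int.cast_injective h1]

lemma exists_continuousOn_log {E : Type*} [NormedAddCommGroup E] [NormedSpace ℝ E] {U : Set E}
    (hU : Convex ℝ U) (ho : IsOpen U) (hne : U.Nonempty) {f : E → ℂ} (hf : ContinuousOn f U)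
    (h0 : ∀ x ∈ U, f x ≠ 0) :
    ∃ L : E → ℂ, ContinuousOn L U ∧ ∀ x ∈ U, Complex.exp (L x) = f x := by
  have := hU.contractibleSpace hne
  have hs : IsSimplyConnected U := inferInstanceAs (SimplyConnectedSpace U)
  refine Complex.exists_continuousOn_eqOn_exp_comp hs ho hf ?_
  rintro ⟨x, hx, h⟩
  exact h0 x hx h

/-- For points `z ≠ w` of the upper half-plane, a positive multiple of the direction at `z` of the
geodesic from `z` to `w`. -/
def geodesicDirection (z w : ℂ) : ℂ := Complex.I * (w - z) / (w - (starRingEnd ℂ) z)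

lemma im_sub_conj_pos {z w : ℂ} (hz : 0 < z.im) (hw : 0 < w.im) :
    0 < (w - (starRingEnd ℂ) z).im := by
  rw [Complex.sub_im, Complex.conj_im]
  linarith

lemma sub_conj_ne_zero {z w : ℂ} (hz : 0 < z.im) (hw : 0 < w.im) : w - (starRingEnd ℂ) z ≠ 0 :=
  fun h => (im_sub_conj_pos hz hw).ne' (by rw [h, Complex.zero_im])

lemma geodesicDirection_ne_zero {z w : ℂ} (hz : 0 < z.im) (hw : 0 < w.im) (h : z ≠ w) :
    geodesicDirection z w ≠ 0 :=
  div_ne_zero (mul_ne_zero Complex.I_ne_zero (sub_ne_zero.mpr h.symm)) (sub_conj_ne_zero hz hw)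

lemma exp_arg_mul_I (X : ℂ) (h : X ≠ 0) :
    Complex.exp (2 * X.arg * Complex.I) = X / (starRingEnd ℂ) X := by
  have h1 := Complex.norm_mul_exp_arg_mul_I X
  have h2 : (starRingEnd ℂ) X = ‖X‖ * Complex.exp (-(X.arg * Complex.I)) := by
    conv_lhs => rw [← h1]
    rw [map_mul, Complex.conj_ofReal, ← Complex.exp_conj, map_mul, Complex.conj_ofReal,
      Complex.conj_I, mul_neg]
  have hn : (‖X‖ : ℂ) ≠ 0 := by exact_mod_cast norm_ne_zero_iff.mpr h
  conv_rhs => rw [h2, ← h1]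
  simp only [norm_mul, Complex.norm_exp_ofReal_mul_I, Complex.norm_real, norm_norm, mul_one]
  rw [mul_div_mul_left _ _ hn, ← Complex.exp_sub, h1]
  congr 1
  ring

/-- With `X = w - conj z`, the two directions are `i(w - z)/X` and `i(w - z)/conj X`, and `X / conj
X = exp (2i arg X)`. -/
lemma geodesicDirection_swap {z w : ℂ} (hz : 0 < z.im) (hw : 0 < w.im) :
    geodesicDirection w z = geodesicDirection z w *
      Complex.exp (2 * (w - (starRingEnd ℂ) z).arg * Complex.I) := by
  have h1 := sub_conj_ne_zero hz hw
  have h2 := sub_conj_ne_zero hw hz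
  have h3 : (starRingEnd ℂ) (w - (starRingEnd ℂ) z) = -(z - (starRingEnd ℂ) w) := by
    simp
  rw [exp_arg_mul_I _ h1, h3, geodesicDirection, geodesicDirection]
  field_simp
  ring

lemma arg_sub_conj_swap {z w : ℂ} (hz : 0 < z.im) (hw : 0 < w.im) :
    (z - (starRingEnd ℂ) w).arg = Real.pi - (w - (starRingEnd ℂ) z).arg := by
  have hX := im_sub_conj_pos hz hw
  have h3 : z - (starRingEnd ℂ) w = -(starRingEnd ℂ) (w - (starRingEnd ℂ) z) := by simp
  rw [h3, Complex.arg_neg_eq_arg_add_pi_of_im_neg (by rw [Complex.conj_im]; linarith),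
    Complex.arg_conj, if_neg]
  · ring
  · rw [Complex.arg_eq_pi_iff]
    exact fun h => hX.ne' h.2

/-- Pairs of parameters of a closed curve of period `n` corresponding to distinct points. -/
def chordSet (n : ℝ) : Set (ℝ × ℝ) := {p | 0 < p.1 ∧ p.1 < p.2 ∧ p.2 < p.1 + n}

lemma convex_chordSet (n : ℝ) : Convex ℝ (chordSet n) := by
  have h1 : Convex ℝ {p : ℝ × ℝ | 0 < p.1} := convex_halfSpace_gt (LinearMap.fst ℝ ℝ ℝ).isLinear 0
  have h2 : Convex ℝ {p : ℝ × ℝ | p.1 - p.2 < 0} :=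
    convex_halfSpace_lt (LinearMap.fst ℝ ℝ ℝ - LinearMap.snd ℝ ℝ ℝ).isLinear 0
  have h3 : Convex ℝ {p : ℝ × ℝ | p.2 - p.1 < n} :=
    convex_halfSpace_lt (LinearMap.snd ℝ ℝ ℝ - LinearMap.fst ℝ ℝ ℝ).isLinear n
  have e : chordSet n = {p : ℝ × ℝ | 0 < p.1} ∩ ({p | p.1 - p.2 < 0} ∩ {p | p.2 - p.1 < n}) := by
    ext p
    simp only [chordSet, Set.mem_inter_iff, Set.mem_ofPred_eq, sub_lt_iff_lt_add', add_zero]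
  rw [e]
  exact h1.inter (h2.inter h3)

lemma isOpen_chordSet (n : ℝ) : IsOpen (chordSet n) :=
  (isOpen_lt continuous_const continuous_fst).inter ((isOpen_lt continuous_fst continuous_snd).inter
    (isOpen_lt continuous_snd (continuous_fst.add continuous_const)))

/-- A closed curve in the upper half-plane, parametrized periodically, without self-intersections. -/
structure IsSimpleClosed (n : ℝ) (C : ℝ → ℂ) : Prop where
  pos : 0 < n
  continuousOn : ContinuousOn C (Set.Ioi 0)
  im_pos : ∀ t, 0 < (C t).im
  periodic : ∀ t, 0 < t → C (t + n) = C t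
  injective : ∀ p ∈ chordSet n, C p.1 ≠ C p.2

/-- The rotation of the chords of a simple closed curve: a continuous logarithm of the direction of
the chord changes by an odd multiple of `2πi` along the curve. -/
theorem IsSimpleClosed.exists_rotation {n : ℝ} {C : ℝ → ℂ} (hC : IsSimpleClosed n C) :
    ∃ (Λ : ℝ × ℝ → ℂ) (m : ℤ), ContinuousOn Λ (chordSet n) ∧
      (∀ p ∈ chordSet n, Complex.exp (Λ p) = geodesicDirection (C p.1) (C p.2)) ∧
      (∀ p ∈ chordSet n, Λ (p.2, p.1 + n) = Λ p +
        2 * (C p.2 - (starRingEnd ℂ) (C p.1)).arg * Complex.I + m * (2 * Real.pi * Complex.I)) ∧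
      ∀ p ∈ chordSet n, Λ (p.1 + n, p.2 + n) = Λ p + (2 * m + 1) * (2 * Real.pi * Complex.I) := by
  have hn := hC.pos
  have hU := convex_chordSet n
  have c1 : ContinuousOn (fun p : ℝ × ℝ => C p.1) (chordSet n) :=
    hC.continuousOn.comp continuous_fst.continuousOn fun p hp => hp.1
  have c2 : ContinuousOn (fun p : ℝ × ℝ => C p.2) (chordSet n) :=
    hC.continuousOn.comp continuous_snd.continuousOn fun p hp => hp.1.trans hp.2.1
  have cX : ContinuousOn (fun p : ℝ × ℝ => C p.2 - (starRingEnd ℂ) (C p.1)) (chordSet n) :=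
    c2.sub (Complex.continuous_conj.comp_continuousOn c1)
  have hX : ∀ p : ℝ × ℝ, 0 < (C p.2 - (starRingEnd ℂ) (C p.1)).im := fun p =>
    im_sub_conj_pos (hC.im_pos _) (hC.im_pos _)
  obtain ⟨Λ, hΛ, hexp⟩ := exists_continuousOn_log hU (isOpen_chordSet n)
    ⟨(n, n + n / 2), hn, by simp [hn], by simp only; linarith⟩
    (f := fun p => geodesicDirection (C p.1) (C p.2))
    ((continuousOn_const.mul (c2.sub c1)).div cX
      fun p _ => sub_conj_ne_zero (hC.im_pos _) (hC.im_pos _))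
    (fun p hp => geodesicDirection_ne_zero (hC.im_pos _) (hC.im_pos _) (hC.injective p hp))
  -- The map `(s, t) ↦ (t, s + n)` exchanges the end points of a chord, and its square is
  -- translation by a full period.
  have hflip : ∀ p ∈ chordSet n, (p.2, p.1 + n) ∈ chordSet n := fun p hp =>
    ⟨hp.1.trans hp.2.1, hp.2.2, by simp only; linarith [hp.2.1]⟩
  -- By `geodesicDirection_swap` this expression is a continuous logarithm of `1` on a connected
  -- set, so it is a constant multiple of `2πi`.
  obtain ⟨m, hm⟩ := exists_int_of_exp_eq_one hU.isPreconnected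
    (f := fun p => Λ (p.2, p.1 + n) - Λ p -
      2 * (C p.2 - (starRingEnd ℂ) (C p.1)).arg * Complex.I) (by
      refine ((hΛ.comp (by fun_prop) hflip).sub hΛ).sub
        ((continuousOn_const.mul (Complex.continuous_ofReal.comp_continuousOn ?_)).mul
          continuousOn_const)
      exact fun p hp => ContinuousAt.comp_continuousWithinAt
        (f := fun p : ℝ × ℝ => C p.2 - (starRingEnd ℂ) (C p.1))
        (Complex.continuousAt_arg (Or.inr (hX p).ne')) (cX p hp)) (fun p hp => by
      rw [Complex.exp_sub, Complex.exp_sub, hexp _ (hflip p hp), hexp p hp]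
      simp only
      rw [hC.periodic _ hp.1,
        geodesicDirection_swap (hC.im_pos p.1) (hC.im_pos p.2)]
      have := geodesicDirection_ne_zero (hC.im_pos p.1) (hC.im_pos p.2) (hC.injective p hp)
      have := Complex.exp_ne_zero (2 * (C p.2 - (starRingEnd ℂ) (C p.1)).arg * Complex.I)
      field_simp)
  have hm' : ∀ p ∈ chordSet n, Λ (p.2, p.1 + n) = Λ p +
      2 * (C p.2 - (starRingEnd ℂ) (C p.1)).arg * Complex.I + m * (2 * Real.pi * Complex.I) :=
    fun p hp => by linear_combination hm p hp
  refine ⟨Λ, m, hΛ, hexp, hm', fun p hp => ?_⟩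
  -- Two exchanges make a period. The two arguments add up to `π`, which contributes the `1` in the
  -- odd number `2m + 1`.
  have h1 := hm' _ (hflip p hp)
  simp only at h1
  rw [h1, hm' p hp, hC.periodic _ hp.1, arg_sub_conj_swap (hC.im_pos p.1) (hC.im_pos p.2)]
  push_cast
  ring

/-! ### Integrals of logarithmic derivatives -/

/-- By continuity the imaginary part of `L s - L t` stays in `(-π, π)` near `t`, where `L s - L t`
is the principal logarithm of `q s / q t`. -/
lemma hasDerivAt_of_exp_eq {L q : ℝ → ℂ} {t : ℝ} {q' : ℂ} (hL : ContinuousAt L t)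
    (hq : HasDerivAt q q' t) (h : ∀ᶠ s in nhds t, Complex.exp (L s) = q s) :
    HasDerivAt L (q' / q t) t := by
  have ht : Complex.exp (L t) = q t := h.self_of_nhds
  have h0 : q t ≠ 0 := ht ▸ Complex.exp_ne_zero _
  have h1 : HasDerivAt (fun s => Complex.log (q s / q t)) (q' / q t) t := by
    have h2 := (hq.div_const (q t)).clog_real (by rw [div_self h0]; exact Or.inl one_pos)
    rwa [div_self h0, div_one] at h2
  have h3 : ∀ᶠ s in nhds t, (L s - L t).im ∈ Set.Ioo (-Real.pi) Real.pi := by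
    have h4 : ContinuousAt (fun s => (L s - L t).im) t :=
      Complex.continuous_im.continuousAt.comp (hL.sub continuousAt_const)
    refine h4.eventually_mem (Ioo_mem_nhds ?_ ?_) <;> simp [Real.pi_pos]
  refine (h1.const_add (L t)).congr_of_eventuallyEq ?_
  filter_upwards [h, h3] with s hs hs'
  rw [← hs, ← ht, ← Complex.exp_sub, Complex.log_exp hs'.1 hs'.2.le]
  ring

lemma Arc.hasDerivWithinAt_extend {c : Arc} (hc : c.IsSmooth) {t : ℝ} (ht : t ∈ Set.Icc (0 : ℝ) 1) :
    HasDerivWithinAt c.toComplex.extend (derivWithin c.toComplex.extend (Set.Icc 0 1) t)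
      (Set.Icc 0 1) t :=
  (hc.contDiffOn_one.differentiableOn one_ne_zero t ht).hasDerivWithinAt

lemma Arc.hasDerivAt_extend {c : Arc} (hc : c.IsSmooth) {t : ℝ} (ht : t ∈ Set.Ioo (0 : ℝ) 1) :
    HasDerivAt c.toComplex.extend (derivWithin c.toComplex.extend (Set.Icc 0 1) t) t :=
  (Arc.hasDerivWithinAt_extend hc (Set.Ioo_subset_Icc_self ht)).hasDerivAt (Icc_mem_nhds ht.1 ht.2)

lemma Arc.continuousOn_derivWithin {c : Arc} (hc : c.IsSmooth) :
    ContinuousOn (derivWithin c.toComplex.extend (Set.Icc 0 1)) (Set.Icc 0 1) :=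
  hc.contDiffOn_one.continuousOn_derivWithin uniqueDiffOn_Icc_zero_one le_rfl

lemma curveIntegral_oneForm (f : ℂ → ℂ) (c : Arc) :
    curveIntegral (fun z => oneForm (f z) 0) c.toComplex = ∫ t in (0 : ℝ)..1,
      f (c.toComplex.extend t) * derivWithin c.toComplex.extend (Set.Icc 0 1) t := by
  rw [curveIntegral_def]
  refine intervalIntegral.integral_congr fun t _ => ?_
  simp [curveIntegralFun_def, oneForm_apply]

/-- The integral of a logarithmic derivative along a path is the increment of a continuous
logarithm. -/
lemma curveIntegral_logDeriv {c : Arc} (hc : c.IsSmooth) {q q' : ℂ → ℂ}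
    (hq : ∀ z ∈ upperSet, HasDerivAt q (q' z) z) (hq' : ContinuousOn q' upperSet) {L : ℝ → ℂ}
    (hL : ContinuousOn L (Set.Icc 0 1))
    (h : ∀ t ∈ Set.Icc (0 : ℝ) 1, Complex.exp (L t) = q (c.toComplex.extend t)) :
    curveIntegral (fun z => oneForm (q' z / q z) 0) c.toComplex = L 1 - L 0 := by
  have hcc := c.toComplex.continuous_extend
  rw [curveIntegral_oneForm, intervalIntegral.integral_eq_sub_of_hasDerivAt_of_le zero_le_one hL]
  · intro t ht
    have h1 := (hq _ (c.extend_mem t)).comp t (Arc.hasDerivAt_extend hc ht)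
    refine (hasDerivAt_of_exp_eq (hL.continuousAt (Icc_mem_nhds ht.1 ht.2)) h1 ?_).congr_deriv ?_
    · filter_upwards [Icc_mem_nhds ht.1 ht.2] with s hs using h s hs
    · simp only [Function.comp_apply]
      ring
  · refine ContinuousOn.intervalIntegrable ?_
    rw [Set.uIcc_of_le zero_le_one]
    refine ContinuousOn.mul (ContinuousOn.div (hq'.comp hcc.continuousOn fun t _ => c.extend_mem t)
      (fun t _ => ?_) fun t ht => ?_) (Arc.continuousOn_derivWithin hc)
    · exact ((hq _ (c.extend_mem t)).continuousAt.comp hcc.continuousAt).continuousWithinAt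
    · rw [← h t ht]
      exact Complex.exp_ne_zero _

/-! ### Geodesics in the disc model -/

/-- The coordinate on the disc model of the hyperbolic plane with center `v`. -/
def diskCoord (v w : ℂ) : ℂ := (w - v) / (w - (starRingEnd ℂ) v)

lemma norm_diskCoord (v w : ℍ) : ‖diskCoord v w‖ = Real.tanh (dist v w / 2) := by
  rw [dist_comm, UpperHalfPlane.tanh_half_dist, diskCoord, norm_div, Complex.dist_eq,
    Complex.dist_eq]

/-- The disc form of the hyperbolic distance; together with the subtraction formula for `cosh` it
turns equality in the triangle inequality into `|1 - p| = 1 - |p|`. -/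
lemma norm_one_sub_diskCoord (v z w : ℍ) :
    ‖1 - (starRingEnd ℂ) (diskCoord v z) * diskCoord v w‖ =
      Real.cosh (dist z w / 2) / (Real.cosh (dist v z / 2) * Real.cosh (dist v w / 2)) := by
  have h1 := sub_conj_ne_zero v.im_pos z.im_pos
  have h2 := sub_conj_ne_zero v.im_pos w.im_pos
  have h1' : (starRingEnd ℂ) (z : ℂ) - v ≠ 0 := by
    have := (map_ne_zero (starRingEnd ℂ)).mpr h1
    rwa [map_sub, Complex.conj_conj] at this
  have e : 1 - (starRingEnd ℂ) (diskCoord v z) * diskCoord v w =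
      ((v : ℂ) - (starRingEnd ℂ) v) * ((starRingEnd ℂ) z - w) /
        (((starRingEnd ℂ) (z : ℂ) - v) * (w - (starRingEnd ℂ) v)) := by
    simp only [diskCoord, map_div₀, map_sub, Complex.conj_conj]
    field_simp
    ring
  have n1 : ‖(v : ℂ) - (starRingEnd ℂ) v‖ = 2 * v.im := by
    rw [Complex.sub_conj]
    simp [abs_of_pos v.im_pos]
  have n2 : ‖(starRingEnd ℂ) (z : ℂ) - v‖ = dist (v : ℂ) ((starRingEnd ℂ) z) := by
    rw [dist_comm, Complex.dist_eq]
  have n3 : ‖(w : ℂ) - (starRingEnd ℂ) v‖ = dist (v : ℂ) ((starRingEnd ℂ) w) := by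
    rw [Complex.dist_eq, ← Complex.norm_conj, map_sub, Complex.conj_conj, norm_sub_rev]
  have n4 : ‖(starRingEnd ℂ) (z : ℂ) - w‖ = dist (z : ℂ) ((starRingEnd ℂ) w) := by
    rw [Complex.dist_eq, ← Complex.norm_conj, map_sub, Complex.conj_conj]
  rw [e, norm_div, norm_mul, norm_mul, n1, n2, n3, n4, UpperHalfPlane.cosh_half_dist,
    UpperHalfPlane.cosh_half_dist, UpperHalfPlane.cosh_half_dist]
  have hv := v.im_pos
  have hz := z.im_pos
  have hw := w.im_pos
  have s1 : Real.sqrt (v.im * z.im) * Real.sqrt (v.im * w.im) = v.im * Real.sqrt (z.im * w.im) := by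
    rw [← Real.sqrt_mul (by positivity), show v.im * z.im * (v.im * w.im) =
      v.im ^ 2 * (z.im * w.im) by ring, Real.sqrt_mul (by positivity), Real.sqrt_sq hv.le]
  have p1 : 0 < Real.sqrt (v.im * z.im) := Real.sqrt_pos.mpr (by positivity)
  have p2 : 0 < Real.sqrt (v.im * w.im) := Real.sqrt_pos.mpr (by positivity)
  have p3 : 0 < Real.sqrt (z.im * w.im) := Real.sqrt_pos.mpr (by positivity)
  have d1 : 0 < dist (v : ℂ) ((starRingEnd ℂ) z) := n2 ▸ norm_pos_iff.mpr h1'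
  have d2 : 0 < dist (v : ℂ) ((starRingEnd ℂ) w) := n3 ▸ norm_pos_iff.mpr h2
  have s2 : v.im = Real.sqrt (v.im * z.im) * Real.sqrt (v.im * w.im) / Real.sqrt (z.im * w.im) := by
    rw [s1]
    field_simp
  conv_lhs => rw [s2]
  field_simp

/-- If the distances from `v` to `z` and `w` are in line, `z` and `w` lie on the same ray from
`v`. -/
lemma diskCoord_eq_of_dist {v z w : ℍ} (h : dist v w = dist v z + dist z w) :
    (‖diskCoord v w‖ : ℂ) * diskCoord v z = ‖diskCoord v z‖ * diskCoord v w := by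
  set p := (starRingEnd ℂ) (diskCoord v z) * diskCoord v w with hp
  have hn : ‖p‖ = Real.tanh (dist v z / 2) * Real.tanh (dist v w / 2) := by
    rw [hp, norm_mul, Complex.norm_conj, norm_diskCoord, norm_diskCoord]
  have c1 := Real.cosh_pos (dist v z / 2)
  have c2 := Real.cosh_pos (dist v w / 2)
  have h1 : ‖1 - p‖ = 1 - ‖p‖ := by
    rw [hp, norm_one_sub_diskCoord, ← hp, hn, show dist z w / 2 = dist v w / 2 - dist v z / 2 by
      rw [h]; ring, Real.cosh_sub, Real.tanh_eq_sinh_div_cosh, Real.tanh_eq_sinh_div_cosh]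
    field_simp
  -- Squaring `|1 - p| = 1 - |p|` shows that `p` is real and nonnegative, so the two disc
  -- coordinates are positively proportional.
  have h2 : p.re = ‖p‖ := by
    have h3 : ‖1 - p‖ ^ 2 = 1 - 2 * p.re + ‖p‖ ^ 2 := by
      rw [← Complex.normSq_eq_norm_sq, ← Complex.normSq_eq_norm_sq, Complex.normSq_sub]
      simp
      ring
    rw [h1] at h3
    nlinarith
  have h4 : p = ‖p‖ := by
    have := Complex.re_eq_norm.mp h2
    exact (Complex.eq_re_of_ofReal_le (r := 0) (by simpa using this)).trans (by rw [h2])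
  rcases eq_or_ne (diskCoord v z) 0 with h0 | h0
  · rw [h0]
    simp
  have h5 : diskCoord v z * p = ‖diskCoord v z‖ ^ 2 * diskCoord v w := by
    rw [hp, ← mul_assoc, Complex.mul_conj, Complex.normSq_eq_norm_sq]
    push_cast
    ring
  rw [h4, hp, norm_mul, Complex.norm_conj] at h5
  have hz : (‖diskCoord v z‖ : ℂ) ≠ 0 := by exact_mod_cast norm_ne_zero_iff.mpr h0
  push_cast at h5
  apply mul_left_cancel₀ hz
  linear_combination h5

/-- A geodesic segment is a ray in the disc model centered at its initial point. -/
lemma IsGeodesicSegment.exists_direction {c : Arc} (hc : IsGeodesicSegment c) :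
    ∃ e : ℂ, ‖e‖ = 1 ∧ ∀ t : unitInterval,
      diskCoord c.1.1 (c.2 t) = e * Real.tanh (t * dist c.1.1 c.1.2 / 2) := by
  have hd : ∀ t : unitInterval, dist c.1.1 (c.2 t) = t * dist c.1.1 c.1.2 := fun t => by
    have := hc.dist_eq 0 t
    rwa [c.2.source, Set.Icc.coe_zero, zero_sub, abs_neg, abs_of_nonneg t.2.1] at this
  have hd' : ∀ t : unitInterval, dist (c.2 t) c.1.2 = (1 - t) * dist c.1.1 c.1.2 := fun t => by
    have := hc.dist_eq t 1
    rwa [c.2.target, Set.Icc.coe_one, abs_sub_comm, abs_of_nonneg (sub_nonneg.mpr t.2.2)]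
      at this
  have h1 : ∀ t : unitInterval, (‖diskCoord c.1.1 c.1.2‖ : ℂ) * diskCoord c.1.1 (c.2 t) =
      Real.tanh (t * dist c.1.1 c.1.2 / 2) * diskCoord c.1.1 c.1.2 := fun t => by
    rw [diskCoord_eq_of_dist (by rw [hd, hd']; ring), norm_diskCoord, hd]
  rcases eq_or_ne (diskCoord c.1.1 c.1.2) 0 with h0 | h0
  · refine ⟨1, norm_one, fun t => ?_⟩
    have h2 : dist c.1.1 c.1.2 = 0 := by
      rw [diskCoord, div_eq_zero_iff, or_iff_left
        (sub_conj_ne_zero c.1.1.im_pos c.1.2.im_pos), sub_eq_zero] at h0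
      rw [dist_eq_zero]
      exact (UpperHalfPlane.ext h0).symm
    have h3 : ‖diskCoord c.1.1 (c.2 t)‖ = 0 := by rw [norm_diskCoord, hd, h2]; simp
    rw [norm_eq_zero.mp h3, h2]
    simp
  · have hn : (‖diskCoord c.1.1 c.1.2‖ : ℂ) ≠ 0 := by exact_mod_cast norm_ne_zero_iff.mpr h0
    refine ⟨diskCoord c.1.1 c.1.2 / ‖diskCoord c.1.1 c.1.2‖, ?_, fun t => ?_⟩
    · rw [norm_div, Complex.norm_real, norm_norm, div_self (norm_ne_zero_iff.mpr h0)]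
    · have := h1 t
      field_simp
      linear_combination this

lemma IsGeodesicSegment.reverse {c : Arc} (hc : IsGeodesicSegment c) :
    IsGeodesicSegment c.reverse where
  dist_eq s t := by
    have h := hc.dist_eq (unitInterval.symm s) (unitInterval.symm t)
    rw [unitInterval.coe_symm_eq, unitInterval.coe_symm_eq, sub_sub_sub_cancel_left,
      abs_sub_comm] at h
    rw [dist_comm c.reverse.1.1]
    exact h
  smooth := Arc.IsSmooth.reverse hc.smooth

lemma IsGeodesicSegment.translate {c : Arc} (hc : IsGeodesicSegment c) (γ : PSL(2, ℝ)) :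
    IsGeodesicSegment (c.translate γ) where
  dist_eq s t := by
    have h := hc.dist_eq s t
    rw [← dist_smul_smul γ (c.2 s), ← dist_smul_smul γ c.1.1] at h
    exact h
  smooth := Arc.IsSmooth.translate hc.smooth γ

lemma hasDerivAt_diskCoord {v w : ℂ} (hv : 0 < v.im) (hw : 0 < w.im) :
    HasDerivAt (diskCoord v) ((v - (starRingEnd ℂ) v) / (w - (starRingEnd ℂ) v) ^ 2) w := by
  have hne := sub_conj_ne_zero hv hw
  refine (((hasDerivAt_id w).sub_const v).div ((hasDerivAt_id w).sub_const _) hne).congr_deriv ?_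
  simp only [id]
  congr 1
  ring

lemma Arc.extend_apply (c : Arc) {t : ℝ} (ht : t ∈ Set.Icc (0 : ℝ) 1) :
    c.toComplex.extend t = (c.2 ⟨t, ht⟩ : ℂ) := by
  rw [Path.extend_apply _ ht, Arc.toComplex_apply]

/-- The angular part of `dζ / ζ` vanishes along rays from the center of the disc. -/
lemma IsGeodesicSegment.im_logDeriv_diskCoord {c : Arc} (hc : IsGeodesicSegment c) {t : ℝ}
    (ht : t ∈ Set.Ioo (0 : ℝ) 1) {v : ℂ} (hv : v = c.1.1) :
    ((v - (starRingEnd ℂ) v) / (c.toComplex.extend t - (starRingEnd ℂ) v) ^ 2 /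
      diskCoord v (c.toComplex.extend t) *
        derivWithin c.toComplex.extend (Set.Icc 0 1) t).im = 0 := by
  obtain ⟨e, he, hd⟩ := hc.exists_direction
  rw [← hv] at hd
  -- Rotating by `conj e` makes the disc coordinate real along the segment, so its logarithmic
  -- derivative is real there.
  set q : ℝ → ℂ := fun t => (starRingEnd ℂ) e * diskCoord v (c.toComplex.extend t)
  have hv' : 0 < v.im := hv ▸ c.1.1.im_pos
  have hee : (starRingEnd ℂ) e * e = 1 := by
    rw [mul_comm, Complex.mul_conj, Complex.normSq_eq_norm_sq, he]
    simp
  have he0 : (starRingEnd ℂ) e ≠ 0 := left_ne_zero_of_mul_eq_one hee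
  have hq0 : ∀ s ∈ Set.Icc (0 : ℝ) 1, (q s).im = 0 := fun s hs => by
    simp only [q, c.extend_apply hs, hd, ← mul_assoc, hee, one_mul, Complex.ofReal_im]
  have h1 : HasDerivAt q _ t := ((hasDerivAt_diskCoord hv' (c.extend_mem t)).comp t
    (Arc.hasDerivAt_extend hc.smooth ht)).const_mul ((starRingEnd ℂ) e)
  have h2 := ((Complex.imCLM.hasFDerivAt.comp_hasDerivAt t h1).congr_of_eventuallyEq
    (f₁ := fun _ => 0) (by
      filter_upwards [Icc_mem_nhds ht.1 ht.2] with s hs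
      simp [hq0 s hs])).unique (hasDerivAt_const t 0)
  rw [Complex.imCLM_apply] at h2
  have h3 := hq0 t (Set.Ioo_subset_Icc_self ht)
  rw [show ∀ a b d : ℂ, a / b * d = (starRingEnd ℂ) e * (a * d) / ((starRingEnd ℂ) e * b) from
    fun a b d => by rw [mul_div_mul_left _ _ he0]; ring]
  rw [Complex.div_im, h2, h3]
  simp

/-- The boundary term of the Gauss–Bonnet formula for a geodesic segment. -/
lemma IsGeodesicSegment.re_curveIntegral_inv_im {c : Arc} (hc : IsGeodesicSegment c)
    (hne : c.1.1 ≠ c.1.2) :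
    (curveIntegral (fun z => oneForm (1 / (z.im : ℂ)) 0) c.toComplex).re =
      Real.pi - 2 * ((c.1.2 : ℂ) - (starRingEnd ℂ) (c.1.1 : ℂ)).arg := by
  set v : ℂ := (c.1.1 : ℂ) with hv
  have hv' : 0 < v.im := c.1.1.im_pos
  have hcc := c.toComplex.continuous_extend
  have hslit : ∀ t, c.toComplex.extend t - (starRingEnd ℂ) v ∈ Complex.slitPlane := fun t =>
    Or.inr (im_sub_conj_pos hv' (c.extend_mem t)).ne'
  have hint : IntervalIntegrable (fun t => 1 / ((c.toComplex.extend t).im : ℂ) *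
      derivWithin c.toComplex.extend (Set.Icc 0 1) t) volume 0 1 := by
    refine ContinuousOn.intervalIntegrable ?_
    rw [Set.uIcc_of_le zero_le_one]
    refine ContinuousOn.mul (Continuous.continuousOn ?_) (Arc.continuousOn_derivWithin hc.smooth)
    exact continuous_const.div (by fun_prop) fun t => by exact_mod_cast (c.extend_mem t).ne'
  rw [curveIntegral_oneForm]
  have hre := Complex.reCLM.intervalIntegral_comp_comm hint
  simp only [Complex.reCLM_apply] at hre
  -- Along the geodesic, `-2 arg (z - conj v)` is a primitive of `Re (dz / y)`. Its initial value is
  -- `-π`, since `v - conj v` is a positive multiple of `i`.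
  rw [← hre, intervalIntegral.integral_eq_sub_of_hasDerivAt_of_le zero_le_one
    (f := fun t => -2 * (Complex.log (c.toComplex.extend t - (starRingEnd ℂ) v)).im)]
  · have h1 : (v - (starRingEnd ℂ) v).arg = Real.pi / 2 := by
      rw [Complex.sub_conj]
      have : ((2 * v.im : ℝ) : ℂ) * Complex.I = ((2 * v.im : ℝ) : ℂ) * Complex.I := rfl
      rw [Complex.arg_real_mul _ (by positivity), Complex.arg_I]
    simp only [Path.extend_one, Path.extend_zero, Complex.log_im, ← hv, h1]
    ring
  · refine continuousOn_const.mul (Complex.continuous_im.comp_continuousOn fun t _ => ?_)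
    exact ContinuousAt.continuousWithinAt
      ((continuousAt_clog (hslit t)).comp (f := fun t => c.toComplex.extend t - (starRingEnd ℂ) v)
        (hcc.sub continuous_const).continuousAt)
  · intro t ht
    have h1 := Arc.hasDerivAt_extend hc.smooth ht
    have h2 := (Complex.imCLM.hasFDerivAt.comp_hasDerivAt t
      ((h1.sub_const ((starRingEnd ℂ) v)).clog_real (hslit t))).const_mul (-2)
    refine h2.congr_deriv ?_
    have h3 := hc.im_logDeriv_diskCoord ht hv
    set z := c.toComplex.extend t with hz
    set z' := derivWithin c.toComplex.extend (Set.Icc 0 1) t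
    have hzv : z ≠ v := by
      rw [hz, c.extend_apply (Set.Ioo_subset_Icc_self ht), hv]
      intro h
      have h5 := hc.dist_eq 0 ⟨t, Set.Ioo_subset_Icc_self ht⟩
      rw [c.2.source, UpperHalfPlane.ext h, dist_self, Set.Icc.coe_zero, eq_comm] at h5
      rcases mul_eq_zero.mp h5 with h5 | h5
      · exact ht.1.ne' (by simpa using h5)
      · exact hne (dist_eq_zero.mp h5)
    have hzi : 0 < z.im := c.extend_mem t
    have hne1 : z - v ≠ 0 := sub_ne_zero.mpr hzv
    have hne2 := sub_conj_ne_zero hv' hzi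
    have hne3 := sub_conj_ne_zero hv' hv'
    set ρ := (v - (starRingEnd ℂ) v) / (z - (starRingEnd ℂ) v) ^ 2 / diskCoord v z * z' with hρ
    -- The velocity is a real multiple of an explicit function of `z`, because motion along a ray
    -- from `v` is radial in the disc.
    have hz' : z' = ρ.re * ((z - v) * (z - (starRingEnd ℂ) v) / (v - (starRingEnd ℂ) v)) := by
      rw [show (ρ.re : ℂ) = ρ from Complex.ext rfl (by rw [h3]; rfl), hρ, diskCoord]
      field_simp
    have e1 : z' / (z - (starRingEnd ℂ) v) = ρ.re * ((z - v) / (v - (starRingEnd ℂ) v)) := by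
      rw [hz']
      field_simp
    have e2 : v - (starRingEnd ℂ) v = ((2 * v.im : ℝ) : ℂ) * Complex.I := Complex.sub_conj v
    have e3 : ∀ x : ℂ, x / (((2 * v.im : ℝ) : ℂ) * Complex.I) =
        ((1 / (2 * v.im) : ℝ) : ℂ) * (-Complex.I * x) := fun x => by
      have : (v.im : ℂ) ≠ 0 := by exact_mod_cast hv'.ne'
      push_cast
      field_simp
      rw [Complex.I_sq]
      ring
    have e4 : 1 / (z.im : ℂ) * z' = ((1 / z.im : ℝ) : ℂ) * z' := by push_cast; ring
    rw [Complex.imCLM_apply, e4, Complex.re_ofReal_mul, e1, hz', e2, e3, e3]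
    simp only [Complex.re_ofReal_mul, Complex.im_ofReal_mul]
    simp
    field_simp
    ring
  · rw [intervalIntegrable_iff] at hint ⊢
    exact hint.re

namespace FundamentalPolygon

/-! ### The boundary of the polygon as a periodic curve -/

variable {g : ℕ} {M : MarkedFuchsianGroup g} (P : FundamentalPolygon M)

lemma side_geodesic (i : Fin g × Fin 4) : IsGeodesicSegment (P.side i) := by
  obtain ⟨k, j⟩ := i
  fin_cases j
  · exact P.a_geodesic k
  · exact (P.b_geodesic k).translate _
  · exact ((P.a_geodesic k).translate _).reverse
  · exact (P.b_geodesic k).reverse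

lemma side_injective {i j : Fin g × Fin 4} {s t : unitInterval} (hs : s ≠ 1) (ht : t ≠ 1)
    (h : (P.side i).2 s = (P.side j).2 t) : i = j ∧ s = t := by
  have := P.simple (x₁ := (i, s)) (x₂ := (j, t)) hs ht h
  exact Prod.mk_inj.mp this

/-- The sides in the order in which the boundary is traversed, indexed periodically. -/
def edgeIndex (hg : 0 < g) (j : ℕ) : Fin g × Fin 4 :=
  (⟨j / 4 % g, Nat.mod_lt _ hg⟩, ⟨j % 4, Nat.mod_lt _ (by norm_num)⟩)

/-- The `j`-th side of the polygon. -/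
abbrev edge (hg : 0 < g) (j : ℕ) : Arc := P.side (edgeIndex hg j)

/-- The `j`-th vertex of the polygon. -/
abbrev vertex (hg : 0 < g) (j : ℕ) : ℍ := (P.edge hg j).1.1

lemma edgeIndex_periodic (hg : 0 < g) (j : ℕ) : edgeIndex hg (j + 4 * g) = edgeIndex hg j := by
  refine Prod.ext (Fin.ext ?_) (Fin.ext ?_) <;> simp only [edgeIndex]
  · rw [Nat.add_mul_div_left _ _ (by norm_num), Nat.add_mod_right]
  · rw [Nat.add_mul_mod_self_left]

lemma modEq_of_edgeIndex_eq {hg : 0 < g} {i j : ℕ} (h : edgeIndex hg i = edgeIndex hg j) :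
    i ≡ j [MOD 4 * g] := by
  have h1 : i / 4 % g = j / 4 % g := congrArg (fun x => (x.1 : ℕ)) h
  have h2 : i % 4 = j % 4 := congrArg (fun x => (x.2 : ℕ)) h
  rw [Nat.ModEq, Nat.mod_mul, Nat.mod_mul, h1, h2]

lemma sum_edgeIndex {A : Type*} [AddCommMonoid A] (hg : 0 < g) (m : ℕ) (f : Fin g × Fin 4 → A) :
    ∑ j ∈ Finset.range (4 * g), f (edgeIndex hg (m + j)) = ∑ i, f i := by
  rw [← Fin.sum_univ_eq_sum_range (fun j => f (edgeIndex hg (m + j)))]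
  refine Function.Bijective.sum_comp (e := fun j : Fin (4 * g) => edgeIndex hg (m + j)) ?_ f
  rw [Fintype.bijective_iff_injective_and_card]
  refine ⟨fun i j h => ?_, by simp [mul_comm]⟩
  have h1 := Nat.ModEq.add_left_cancel' m (modEq_of_edgeIndex_eq h)
  exact Fin.ext (Nat.ModEq.eq_of_lt_of_lt h1 i.2 j.2)

lemma edge_end (hg : 0 < g) (j : ℕ) : (P.edge hg j).1.2 = P.vertex hg (j + 1) := by
  obtain ⟨q, r, hr, rfl⟩ : ∃ q r, r < 4 ∧ j = 4 * q + r :=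
    ⟨j / 4, j % 4, Nat.mod_lt _ (by norm_num), (Nat.div_add_mod j 4).symm⟩
  set k : Fin g := ⟨q % g, Nat.mod_lt _ hg⟩ with hk
  have hidx : ∀ s (hs : s < 4), edgeIndex hg (4 * q + s) = (k, ⟨s, hs⟩) := fun s hs => by
    refine Prod.ext (Fin.ext ?_) (Fin.ext ?_) <;> simp only [edgeIndex, hk]
    · congr 1
      omega
    · omega
  have hnext : edgeIndex hg (4 * q + 3 + 1) = (finRotate g k, 0) := by
    obtain ⟨n, rfl⟩ : ∃ n, g = n + 1 := ⟨g - 1, by omega⟩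
    refine Prod.ext (Fin.ext ?_) (Fin.ext ?_) <;> simp only [edgeIndex]
    · rw [finRotate_apply, Fin.val_add, hk]
      simp only [Fin.val_one']
      rw [show (4 * q + 3 + 1) / 4 = q + 1 by omega, ← Nat.add_mod]
    · simp only [Fin.val_zero]
      omega
  interval_cases r
  · rw [edge, vertex, edge, hidx 0 (by norm_num), add_assoc, hidx 1 (by norm_num)]
    exact P.vertex₁ k
  · rw [edge, vertex, edge, hidx 1 (by norm_num), add_assoc, hidx 2 (by norm_num)]
    exact P.vertex₂ k
  · rw [edge, vertex, edge, hidx 2 (by norm_num), add_assoc, hidx 3 (by norm_num)]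
    exact P.vertex₃ k
  · rw [edge, vertex, edge, hidx 3 (by norm_num), hnext]
    exact P.vertex₄ k

lemma vertex_ne (hg : 0 < g) {i j : ℕ} (h : ¬i ≡ j [MOD 4 * g]) : P.vertex hg i ≠ P.vertex hg j := by
  intro h1
  refine h (modEq_of_edgeIndex_eq (hg := hg) (P.side_injective (s := 0) (t := 0) zero_ne_one
    zero_ne_one ?_).1)
  · rw [(P.side _).2.source, (P.side _).2.source]
    exact h1

/-- The boundary of the polygon as a closed curve of period `4g`, the `j`-th side being traversed
on `[j, j + 1]`. -/
def boundary (hg : 0 < g) (t : ℝ) : ℂ := (P.edge hg ⌊t⌋₊).toComplex.extend (t - ⌊t⌋₊)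

lemma boundary_add (hg : 0 < g) (j : ℕ) {t : ℝ} (ht : t ∈ Set.Icc (0 : ℝ) 1) :
    P.boundary hg (j + t) = (P.edge hg j).toComplex.extend t := by
  rcases ht.2.eq_or_lt with rfl | h1
  · have : ⌊(j : ℝ) + 1⌋₊ = j + 1 := by
      rw [Nat.floor_add_one (Nat.cast_nonneg j), Nat.floor_natCast]
    rw [boundary, this]
    push_cast
    rw [sub_self, Path.extend_zero, Path.extend_one, P.edge_end]
  · have : ⌊(j : ℝ) + t⌋₊ = j := by
      rw [Nat.floor_eq_iff (by linarith [ht.1, (Nat.cast_nonneg j : (0 : ℝ) ≤ j)])]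
      exact ⟨by linarith [ht.1], by linarith⟩
    rw [boundary, this, add_sub_cancel_left]

lemma boundary_natCast (hg : 0 < g) (j : ℕ) : P.boundary hg j = P.vertex hg j := by
  have := P.boundary_add hg j (t := 0) (by simp)
  rw [add_zero] at this
  rw [this, Path.extend_zero]

lemma continuousOn_boundary_Icc (hg : 0 < g) (j : ℕ) :
    ContinuousOn (P.boundary hg) (Set.Icc j (j + 1)) := by
  have h : ContinuousOn (fun t : ℝ => (P.edge hg j).toComplex.extend (t - j)) (Set.Icc j (j + 1)) :=
    ((P.edge hg j).toComplex.continuous_extend.comp (continuous_id.sub continuous_const)).continuousOn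
  refine h.congr fun t ht => ?_
  simp only
  rw [← P.boundary_add hg j ⟨by linarith [ht.1], by linarith [ht.2]⟩, add_sub_cancel]

lemma continuousOn_boundary (hg : 0 < g) : ContinuousOn (P.boundary hg) (Set.Ioi 0) := by
  have h : ∀ N : ℕ, ContinuousOn (P.boundary hg) (Set.Icc 0 N) := by
    intro N
    induction N with
    | zero => simp
    | succ N ih =>
      have := ih.union_of_isClosed (P.continuousOn_boundary_Icc hg N) isClosed_Icc isClosed_Icc
      rw [Set.Icc_union_Icc_eq_Icc (Nat.cast_nonneg N) (by linarith)] at this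
      exact_mod_cast this
  intro t ht
  obtain ⟨N, hN⟩ := exists_nat_gt t
  exact ((h N).continuousAt (Icc_mem_nhds ht hN)).continuousWithinAt

lemma boundary_eq (hg : 0 < g) {t : ℝ} (ht : 0 ≤ t) : ∃ s : unitInterval, s ≠ 1 ∧
    (s : ℝ) = t - ⌊t⌋₊ ∧ P.boundary hg t = ((P.edge hg ⌊t⌋₊).2 s : ℂ) := by
  have h1 := Nat.floor_le ht
  have h2 := Nat.lt_floor_add_one t
  have hs : t - ⌊t⌋₊ ∈ Set.Icc (0 : ℝ) 1 := ⟨by linarith, by linarith⟩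
  refine ⟨⟨t - ⌊t⌋₊, hs⟩, fun h => ?_, rfl, Arc.extend_apply _ hs⟩
  have : t - ⌊t⌋₊ = 1 := congrArg Subtype.val h
  linarith

lemma isSimpleClosed_boundary (hg : 0 < g) : IsSimpleClosed (4 * g) (P.boundary hg) where
  pos := by positivity
  continuousOn := P.continuousOn_boundary hg
  im_pos t := Arc.extend_mem _ _
  periodic t ht := by
    have h : ⌊t + 4 * g⌋₊ = ⌊t⌋₊ + 4 * g := by
      have := Nat.floor_add_natCast ht.le (4 * g)
      push_cast at this
      exact this
    rw [boundary, boundary, h, edge, edge, edgeIndex_periodic]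
    congr 1
    push_cast
    ring
  injective := by
    rintro ⟨s, t⟩ ⟨h0, h1, h2⟩ h
    simp only at h0 h1 h2 h
    obtain ⟨x, hx1, hxs, hx⟩ := P.boundary_eq hg h0.le
    obtain ⟨y, hy1, hyt, hy⟩ := P.boundary_eq hg (h0.trans h1).le
    rw [hx, hy] at h
    obtain ⟨hi, rfl⟩ := P.side_injective hx1 hy1 (UpperHalfPlane.ext h)
    have h3 := modEq_of_edgeIndex_eq hi
    have h4 : t - s = (⌊t⌋₊ : ℝ) - ⌊s⌋₊ := by linarith
    have h5 : ⌊s⌋₊ < ⌊t⌋₊ := by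
      have : (⌊s⌋₊ : ℝ) < ⌊t⌋₊ := by linarith
      exact_mod_cast this
    have h6 : ⌊t⌋₊ < ⌊s⌋₊ + 4 * g := by
      have : (⌊t⌋₊ : ℝ) < ⌊s⌋₊ + 4 * g := by linarith
      exact_mod_cast this
    -- Equal points lie on the same side, so the difference of the side numbers is a positive
    -- multiple of `4g`; yet it is less than `4g`.
    have h7 := (Nat.modEq_iff_dvd' h5.le).mp h3
    have h8 := Nat.le_of_dvd (by omega) h7
    omega

end FundamentalPolygon

/-! ### The angle density at a point of the upper half-plane -/

/-- A smooth nondecreasing function which vanishes on `(-∞, 1/2]` and is `1` on `[1, ∞)`. -/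
def radialCutoff (x : ℝ) : ℝ := Real.smoothTransition (2 * x - 1)

lemma contDiff_radialCutoff {n : ℕ∞} : ContDiff ℝ n radialCutoff :=
  Real.smoothTransition.contDiff.comp ((contDiff_const.mul contDiff_id).sub contDiff_const)

lemma radialCutoff_of_le {x : ℝ} (h : x ≤ 1 / 2) : radialCutoff x = 0 :=
  Real.smoothTransition.zero_of_nonpos (by linarith)

lemma radialCutoff_of_one_le {x : ℝ} (h : 1 ≤ x) : radialCutoff x = 1 :=
  Real.smoothTransition.one_of_one_le (by linarith)

lemma hasDerivAt_radialCutoff (x : ℝ) : HasDerivAt radialCutoff (deriv radialCutoff x) x :=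
  ((contDiff_radialCutoff (n := 1)).differentiable (by simp) x).hasDerivAt

lemma deriv_radialCutoff_nonneg (x : ℝ) : 0 ≤ deriv radialCutoff x := by
  refine Monotone.deriv_nonneg (g := radialCutoff) fun x y h => ?_
  exact Real.smoothTransition.monotone (by linarith)

lemma deriv_radialCutoff_of_le {x : ℝ} (h : x ≤ 1 / 2) : deriv radialCutoff x = 0 := by
  refine IsLocalMin.deriv_eq_zero (Filter.Eventually.of_forall fun y => ?_)
  rw [radialCutoff_of_le h]
  exact Real.smoothTransition.nonneg _

/-- A cutoff function which vanishes near `v` and is `1` off the disc of radius `r`. -/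
def diskCutoff (v : ℂ) (r : ℝ) (z : ℂ) : ℝ := radialCutoff (‖diskCoord v z‖ ^ 2 / r ^ 2)

/-- The derivative of `diskCoord v`. -/
def diskCoordDeriv (v z : ℂ) : ℂ := (v - (starRingEnd ℂ) v) / (z - (starRingEnd ℂ) v) ^ 2

/-- A rotationally symmetric density supported in a small disc around `v`. -/
def angleDensity (v : ℂ) (r : ℝ) (z : ℂ) : ℝ :=
  deriv radialCutoff (‖diskCoord v z‖ ^ 2 / r ^ 2) * ‖diskCoordDeriv v z‖ ^ 2 / r ^ 2

lemma angleDensity_nonneg (v : ℂ) (r : ℝ) (z : ℂ) : 0 ≤ angleDensity v r z :=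
  div_nonneg (mul_nonneg (deriv_radialCutoff_nonneg _) (sq_nonneg _)) (sq_nonneg _)

lemma hasDerivAt_diskCoord_of_ne {v z : ℂ} (h : z ≠ (starRingEnd ℂ) v) :
    HasDerivAt (diskCoord v) (diskCoordDeriv v z) z := by
  refine (((hasDerivAt_id z).sub_const v).div ((hasDerivAt_id z).sub_const _)
    (sub_ne_zero.mpr h)).congr_deriv ?_
  simp only [id, diskCoordDeriv]
  congr 1
  ring

lemma hasFDerivAt_real_comp {χ : ℝ → ℝ} {χ' : ℝ} {U : ℂ → ℂ} {p z : ℂ}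
    (hU : HasFDerivAt U (oneForm p ((starRingEnd ℂ) p)) z) (hχ : HasDerivAt χ χ' (U z).re) :
    HasFDerivAt (fun z => (χ (U z).re : ℂ)) (oneForm (χ' * p) (χ' * (starRingEnd ℂ) p)) z := by
  have h1 := Complex.ofRealCLM.hasFDerivAt.comp z
    (hχ.hasFDerivAt.comp z (Complex.reCLM.hasFDerivAt.comp z hU))
  refine h1.congr_fderiv ?_
  ext v
  have h2 : p * v + (starRingEnd ℂ) p * (starRingEnd ℂ) v = ((2 * (p * v).re : ℝ) : ℂ) := by
    rw [← map_mul, Complex.add_conj]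
  simp only [ContinuousLinearMap.comp_apply, oneForm_apply, h2, mul_assoc, ← mul_add]
  simp
  ring

/-- The hypothesis is only `z ≠ conj v`, not membership in the upper half-plane, since the total
mass of the density is computed over the whole plane. -/
lemma hasFDerivAt_diskCutoff_mul {v z : ℂ} (r : ℝ) (h : z ≠ (starRingEnd ℂ) v) {w : ℂ → ℂ} {w' : ℂ}
    (hw : HasDerivAt w w' z) :
    HasFDerivAt (fun z => (diskCutoff v r z : ℂ) * w z)
      (oneForm (diskCutoff v r z * w' + w z * (deriv radialCutoff (‖diskCoord v z‖ ^ 2 / r ^ 2) *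
        (diskCoordDeriv v z * (starRingEnd ℂ) (diskCoord v z) / r ^ 2)))
        (w z * (deriv radialCutoff (‖diskCoord v z‖ ^ 2 / r ^ 2) *
          (diskCoord v z * (starRingEnd ℂ) (diskCoordDeriv v z) / r ^ 2)))) z := by
  have h1 := hasFDerivAt_oneForm_of_hasDerivAt (hasDerivAt_diskCoord_of_ne h)
  have h2 := hasFDerivAt_oneForm_mul h1 (hasFDerivAt_conj h1)
  have h3 := h2.const_smul ((1 / r ^ 2 : ℝ) : ℂ)
  rw [smul_oneForm] at h3
  have hre : ∀ z, (((1 / r ^ 2 : ℝ) : ℂ) • (diskCoord v z * (starRingEnd ℂ) (diskCoord v z))).re =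
      ‖diskCoord v z‖ ^ 2 / r ^ 2 := fun z => by
    rw [Complex.mul_conj, Complex.normSq_eq_norm_sq, smul_eq_mul, ← Complex.ofReal_mul,
      Complex.ofReal_re]
    ring
  have hc := hasDerivAt_radialCutoff (‖diskCoord v z‖ ^ 2 / r ^ 2)
  rw [← hre] at hc
  have h4 := hasFDerivAt_real_comp (χ := radialCutoff)
    (U := fun z => ((1 / r ^ 2 : ℝ) : ℂ) • (diskCoord v z * (starRingEnd ℂ) (diskCoord v z)))
    (p := ((1 / r ^ 2 : ℝ) : ℂ) * (diskCoord v z * (starRingEnd ℂ) 0 +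
      (starRingEnd ℂ) (diskCoord v z) * diskCoordDeriv v z))
    (h3.congr_fderiv (by
      congr 1
      simp only [map_mul, map_add, Complex.conj_conj, Complex.conj_ofReal, map_zero]
      ring)) hc
  simp only [hre] at h4
  refine (hasFDerivAt_oneForm_mul h4 (hasFDerivAt_oneForm_of_hasDerivAt hw)).congr_fderiv ?_
  congr 1
  · simp only [diskCutoff, map_zero]
    push_cast
    ring
  · simp only [map_mul, map_add, Complex.conj_conj, Complex.conj_ofReal, map_zero]
    push_cast
    ring

lemma diskCoord_self (v : ℂ) : diskCoord v v = 0 := by simp [diskCoord]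

lemma eventually_diskCutoff_eq_zero {v : ℂ} (hv : 0 < v.im) (r : ℝ) :
    ∀ᶠ z in nhds v, diskCutoff v r z = 0 := by
  have h : ContinuousAt (fun z => ‖diskCoord v z‖ ^ 2 / r ^ 2) v :=
    (((hasDerivAt_diskCoord hv hv).continuousAt.norm.pow 2).div_const _)
  have h1 : ∀ᶠ z in nhds v, ‖diskCoord v z‖ ^ 2 / r ^ 2 < 1 / 2 :=
    h.eventually_lt continuousAt_const (by simp [diskCoord_self])
  filter_upwards [h1] with z hz using radialCutoff_of_le hz.le

lemma contDiffAt_diskCutoff {v z : ℂ} (r : ℝ) (h : z ≠ (starRingEnd ℂ) v) :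
    ContDiffAt ℝ 1 (fun z => (diskCutoff v r z : ℂ)) z := by
  have h1 : ContDiffAt ℝ 1 (diskCoord v) z := ContDiffAt.restrict_scalars ℝ (𝕜' := ℂ)
    (ContDiffAt.div (contDiffAt_id.sub contDiffAt_const) (contDiffAt_id.sub contDiffAt_const)
      (sub_ne_zero.mpr h))
  have h2 : ContDiffAt ℝ 1 (fun z => ‖diskCoord v z‖ ^ 2 / r ^ 2) z := (h1.norm_sq ℝ).div_const _
  exact Complex.ofRealCLM.contDiff.contDiffAt.comp z
    ((contDiff_radialCutoff (n := 1)).contDiffAt.comp z h2)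

/-- The total mass of the angle density. -/
lemma integral_angleDensity {v : ℂ} (hv : 0 < v.im) {r : ℝ} (hr : 0 < r) (hr1 : r < 1) :
    ∫ z, (angleDensity v r z : ℂ) = Real.pi := by
  set c := (starRingEnd ℂ) v with hc
  have hvc : v ≠ c := fun h => by
    have := congrArg Complex.im h
    rw [hc, Complex.conj_im] at this
    linarith
  -- The factor `(v - c)/(z - c)` is chosen so that division by `z - v` gives the logarithmic
  -- derivative of the disc coordinate. Then `-u_{z̄}/(z - v)` is the angle density and `u(v) = 1`,
  -- so the mass is `π` by Cauchy–Pompeiu at `v`.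
  set u : ℂ → ℂ := fun z => (1 - (diskCutoff v r z : ℂ)) * ((v - c) / (z - c)) with hu
  have hfar : ∀ z, z ≠ c → r * ‖z - c‖ ≤ ‖z - v‖ → diskCutoff v r z = 1 := by
    intro z hz h
    refine radialCutoff_of_one_le ?_
    have h1 : 0 < ‖z - c‖ := norm_pos_iff.mpr (sub_ne_zero.mpr hz)
    rw [diskCoord, norm_div, ← div_pow, one_le_sq_iff₀ (by positivity), le_div_iff₀ hr,
      le_div_iff₀ h1, one_mul]
    exact h
  have hzero : ∀ z, r * ‖z - c‖ ≤ ‖z - v‖ → u z = 0 := by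
    intro z h
    rcases eq_or_ne z c with rfl | hz
    · simp [hu]
    · simp [hu, hfar z hz h]
  -- The pole of the disc coordinate at `c = conj v` is harmless: the coordinate is large nearby, so
  -- `u` vanishes there.
  have hnear : ∀ᶠ z in nhds c, r * ‖z - c‖ ≤ ‖z - v‖ := by
    have h1 : ContinuousAt (fun z : ℂ => r * ‖z - c‖) c := by fun_prop
    have h2 : ContinuousAt (fun z : ℂ => ‖z - v‖) c := by fun_prop
    have h3 : r * ‖c - c‖ < ‖c - v‖ := by
      rw [sub_self, norm_zero, mul_zero]
      exact norm_pos_iff.mpr (sub_ne_zero.mpr hvc.symm)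
    filter_upwards [h1.eventually_lt h2 h3] with z hz using hz.le
  have hcd : ContDiff ℝ 1 u := by
    rw [contDiff_iff_contDiffAt]
    intro z
    rcases eq_or_ne z c with rfl | hz
    · refine (contDiffAt_const (c := (0 : ℂ))).congr_of_eventuallyEq ?_
      filter_upwards [hnear] with z hz using hzero z hz
    · exact (contDiffAt_const.sub (contDiffAt_diskCutoff r hz)).mul
        (ContDiffAt.restrict_scalars ℝ (𝕜' := ℂ) (contDiffAt_const.div
          (contDiffAt_id.sub contDiffAt_const) (sub_ne_zero.mpr hz)))
  have hcs : HasCompactSupport u := by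
    -- The radius comes from the triangle inequality: beyond it, `r|z - c| ≤ r|z - v| + r|v - c| ≤
    -- |z - v|`.
    refine HasCompactSupport.intro (isCompact_closedBall v (r * ‖v - c‖ / (1 - r))) fun z hz => ?_
    refine hzero z ?_
    rw [Metric.mem_closedBall, not_le, dist_eq_norm, div_lt_iff₀ (by linarith)] at hz
    have h1 : ‖z - c‖ ≤ ‖z - v‖ + ‖v - c‖ := norm_sub_le_norm_sub_add_norm_sub _ _ _
    nlinarith
  have hP := integral_dzbar_div_sub hcd hcs v
  have huv : u v = 1 := by
    have : diskCutoff v r v = 0 := (eventually_diskCutoff_eq_zero hv r).self_of_nhds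
    simp [hu, this, div_self (sub_ne_zero.mpr hvc)]
  rw [huv, mul_one, ← neg_inj, neg_neg, ← integral_neg] at hP
  rw [← hP]
  refine integral_congr_ae ?_
  have hae : ∀ᵐ z : ℂ, z ≠ c := by
    simp [ae_iff]
  filter_upwards [hae] with z hz
  have h1 := hasFDerivAt_diskCutoff_mul r hz (((hasDerivAt_id z).sub_const c).inv
    (sub_ne_zero.mpr hz) |>.const_mul (v - c))
  have h2 := (hasFDerivAt_oneForm_of_hasDerivAt (((hasDerivAt_id z).sub_const c).inv
    (sub_ne_zero.mpr hz) |>.const_mul (v - c))).add (h1.const_smul (-1 : ℂ))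
  rw [smul_oneForm, oneForm_add] at h2
  have h3 := dzbar_eq (f := u) (h2.congr_of_eventuallyEq (Filter.Eventually.of_forall fun w => by
    simp [hu]
    ring))
  rw [h3, angleDensity]
  rcases eq_or_ne z v with rfl | hzv
  · simp [diskCoord_self, deriv_radialCutoff_of_le]
  have hz1 := sub_ne_zero.mpr hz
  have hz2 := sub_ne_zero.mpr hzv
  have e1 : ((‖diskCoordDeriv v z‖ : ℂ)) ^ 2 =
      diskCoordDeriv v z * (starRingEnd ℂ) (diskCoordDeriv v z) := by
    rw [Complex.mul_conj, Complex.normSq_eq_norm_sq]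
    push_cast
    rfl
  push_cast
  rw [e1]
  simp only [id, Pi.inv_apply]
  generalize deriv radialCutoff _ = a
  generalize (starRingEnd ℂ) (diskCoordDeriv v z) = b
  rw [diskCoordDeriv, diskCoord, ← hc]
  have hr' : (r : ℂ) ≠ 0 := by exact_mod_cast hr.ne'
  field_simp
  ring

/-- The angular form `dζ / ζ` at `v`, cut off near `v`. -/
lemma contDiffOn_diskCutoff_mul {v : ℂ} (hv : 0 < v.im) (r : ℝ) :
    ContDiffOn ℝ 1 (fun z => (diskCutoff v r z : ℂ) * (diskCoordDeriv v z / diskCoord v z))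
      upperSet := by
  intro z hz
  refine ContDiffAt.contDiffWithinAt ?_
  have hne : z ≠ (starRingEnd ℂ) v := sub_ne_zero.mp (sub_conj_ne_zero hv hz)
  rcases eq_or_ne z v with rfl | hzv
  · refine (contDiffAt_const (c := (0 : ℂ))).congr_of_eventuallyEq ?_
    filter_upwards [eventually_diskCutoff_eq_zero hv r] with w hw
    simp [hw]
  · refine (contDiffAt_diskCutoff r hne).mul (ContDiffAt.restrict_scalars ℝ (𝕜' := ℂ)
      (ContDiffAt.div (contDiffAt_const.div ((contDiffAt_id.sub contDiffAt_const).pow 2)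
        (pow_ne_zero 2 (sub_ne_zero.mpr hne))) ((contDiffAt_id.sub contDiffAt_const).div
        (contDiffAt_id.sub contDiffAt_const) (sub_ne_zero.mpr hne)) ?_))
    exact div_ne_zero (sub_ne_zero.mpr hzv) (sub_ne_zero.mpr hne)

/-- Away from `v` the angular form is holomorphic, so only the cutoff is differentiated; its factor
`ζ conj ζ'` meets `ζ'/ζ` to give `|ζ'|²`. -/
lemma dzbar_diskCutoff_mul {v : ℂ} (hv : 0 < v.im) (r : ℝ) {z : ℂ} (hz : z ∈ upperSet) :
    dzbar (fun z => (diskCutoff v r z : ℂ) * (diskCoordDeriv v z / diskCoord v z)) z =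
      angleDensity v r z := by
  have hne : z ≠ (starRingEnd ℂ) v := sub_ne_zero.mp (sub_conj_ne_zero hv hz)
  rcases eq_or_ne z v with rfl | hzv
  · have h1 : HasFDerivAt (fun w => (diskCutoff z r w : ℂ) *
        (diskCoordDeriv z w / diskCoord z w)) (oneForm 0 0) z := by
      refine ((hasFDerivAt_const (0 : ℂ) z).congr_of_eventuallyEq ?_).congr_fderiv ?_
      · filter_upwards [eventually_diskCutoff_eq_zero hv r] with w hw
        simp [hw]
      · ext
        simp [oneForm_apply]
    rw [dzbar_eq h1, angleDensity]
    simp [diskCoord_self, deriv_radialCutoff_of_le]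
  · have hd0 : diskCoord v z ≠ 0 := div_ne_zero (sub_ne_zero.mpr hzv) (sub_ne_zero.mpr hne)
    have hw : DifferentiableAt ℂ (fun z => diskCoordDeriv v z / diskCoord v z) z := by
      refine DifferentiableAt.div ?_ (hasDerivAt_diskCoord_of_ne hne).differentiableAt hd0
      unfold diskCoordDeriv
      exact (differentiableAt_const _).div ((differentiableAt_id.sub_const _).pow 2)
        (pow_ne_zero 2 (sub_ne_zero.mpr hne))
    rw [dzbar_eq (hasFDerivAt_diskCutoff_mul r hne hw.hasDerivAt), angleDensity]
    have e1 : ((‖diskCoordDeriv v z‖ : ℂ)) ^ 2 =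
        diskCoordDeriv v z * (starRingEnd ℂ) (diskCoordDeriv v z) := by
      rw [Complex.mul_conj, Complex.normSq_eq_norm_sq]
      push_cast
      rfl
    push_cast
    rw [e1]
    field_simp

lemma geodesicDirection_eq (z w : ℂ) : geodesicDirection z w = Complex.I * diskCoord z w := by
  rw [geodesicDirection, diskCoord, mul_div_assoc]

lemma continuousOn_diskCoordDeriv {v : ℂ} (hv : 0 < v.im) :
    ContinuousOn (diskCoordDeriv v) upperSet :=
  continuousOn_const.div ((continuousOn_id.sub continuousOn_const).pow 2)
    fun _ hz => pow_ne_zero 2 (sub_conj_ne_zero hv hz)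

/-- The angle subtended by a path at a point of the upper half-plane. -/
def subtendedAngle (v : ℂ) (c : Arc) : ℝ :=
  (curveIntegral (fun z => oneForm (diskCoordDeriv v z / diskCoord v z) 0) c.toComplex).im

lemma subtendedAngle_eq {v : ℂ} (hv : 0 < v.im) {c : Arc} (hc : c.IsSmooth) {L : ℝ → ℂ}
    (hL : ContinuousOn L (Set.Icc 0 1))
    (h : ∀ t ∈ Set.Icc (0 : ℝ) 1,
      Complex.exp (L t) = geodesicDirection v (c.toComplex.extend t)) :
    subtendedAngle v c = (L 1).im - (L 0).im := by
  have h1 := curveIntegral_logDeriv hc (q := fun z => Complex.I * diskCoord v z)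
    (q' := fun z => Complex.I * diskCoordDeriv v z)
    (fun z hz => (hasDerivAt_diskCoord hv hz).const_mul Complex.I)
    (continuousOn_const.mul (continuousOn_diskCoordDeriv hv)) hL
    (fun t ht => by rw [h t ht, geodesicDirection_eq])
  simp only [mul_div_mul_left _ _ Complex.I_ne_zero] at h1
  rw [subtendedAngle, h1, Complex.sub_im]

namespace FundamentalPolygon

variable {g : ℕ} {M : MarkedFuchsianGroup g} (P : FundamentalPolygon M)

/-! ### Angles of the polygon -/

/-- The angle subtended at a vertex by the sides which do not contain it. -/
def vertexAngle (hg : 0 < g) (i : ℕ) : ℝ :=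
  ∑ j ∈ Finset.range (4 * g - 2), subtendedAngle (P.vertex hg i) (P.edge hg (i + 1 + j))

/-- The argument which measures the rotation of the tangent along a side. -/
def sideArg (i : Fin g × Fin 4) : ℝ :=
  (((P.side i).1.2 : ℂ) - (starRingEnd ℂ) ((P.side i).1.1 : ℂ)).arg

lemma mem_chordSet {i : ℕ} (hi : 0 < i) {t : ℝ} (h1 : (i : ℝ) < t)
    (h2 : t < i + 4 * g) : ((i : ℝ), t) ∈ chordSet (4 * g) :=
  ⟨Nat.cast_pos.mpr hi, h1, h2⟩

/-- The chords from the `i`-th vertex to all these sides stay in `chordSet`, so a single continuous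
logarithm measures every subtended angle and the sum telescopes. -/
lemma vertexAngle_eq (hg : 0 < g) {Λ : ℝ × ℝ → ℂ} (hΛ : ContinuousOn Λ (chordSet (4 * g)))
    (hexp : ∀ p ∈ chordSet (4 * g : ℝ), Complex.exp (Λ p) =
      geodesicDirection (P.boundary hg p.1) (P.boundary hg p.2)) {i : ℕ} (hi : 0 < i) :
    P.vertexAngle hg i = (Λ (i, i + 4 * g - 1)).im - (Λ (i, i + 1)).im := by
  have hmem : ∀ j < 4 * g - 2, ∀ t ∈ Set.Icc (0 : ℝ) 1,
      ((i : ℝ), ((i + 1 + j : ℕ) : ℝ) + t) ∈ chordSet (4 * g) := by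
    intro j hj t ht
    have h1 : ((j + 3 : ℕ) : ℝ) ≤ ((4 * g : ℕ) : ℝ) := by
      exact_mod_cast (by omega : j + 3 ≤ 4 * g)
    push_cast at h1
    refine mem_chordSet hi ?_ ?_ <;> push_cast
    · linarith [ht.1, (Nat.cast_nonneg j : (0 : ℝ) ≤ j)]
    · linarith [ht.2]
  have h : ∀ j ∈ Finset.range (4 * g - 2),
      subtendedAngle (P.vertex hg i) (P.edge hg (i + 1 + j)) =
        (Λ (i, (i + 1 + (j + 1 : ℕ) : ℝ))).im - (Λ (i, (i + 1 + j : ℝ))).im := by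
    intro j hj
    rw [Finset.mem_range] at hj
    rw [subtendedAngle_eq (P.vertex hg i).im_pos (P.side_smooth _)
      (L := fun t => Λ (i, ((i + 1 + j : ℕ) : ℝ) + t))
      (hΛ.comp (by fun_prop) fun t ht => hmem j hj t ht) (fun t ht => by
        rw [hexp _ (hmem j hj t ht), P.boundary_natCast, P.boundary_add hg _ ht])]
    push_cast
    rw [add_zero, ← add_assoc]
  rw [vertexAngle, Finset.sum_congr rfl h,
    Finset.sum_range_sub (fun j : ℕ => (Λ (i, (i + 1 + j : ℝ))).im)]
  push_cast [Nat.cast_sub (show 2 ≤ 4 * g by omega)]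
  rw [add_zero]
  congr 4
  ring

/-- The rotation number of the boundary determines the sum of the angles of the polygon. -/
lemma exists_sum_vertexAngle (hg : 0 < g) : ∃ m : ℤ,
    ∑ k ∈ Finset.range (4 * g), P.vertexAngle hg (4 * g + k) =
      2 * ∑ i, P.sideArg i + (4 * g * (2 * m) - 2 * (2 * m + 1)) * Real.pi := by
  obtain ⟨Λ, m, hΛ, hexp, hflip, hper⟩ := (P.isSimpleClosed_boundary hg).exists_rotation
  refine ⟨m, ?_⟩
  have hg' : (1 : ℝ) ≤ g := by exact_mod_cast hg
  -- The chord from vertex `i` to vertex `i + 4g - 1` is the side ending at `i`, reversed, so the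
  -- exchange rule expresses it through `Λ (i - 1, i)` and the differences telescope. Starting at
  -- `4g` rather than `0` keeps `i - 1` positive, as `chordSet` demands.
  have h : ∀ k ∈ Finset.range (4 * g), P.vertexAngle hg (4 * g + k) =
      2 * P.sideArg (edgeIndex hg (4 * g - 1 + k)) + 2 * m * Real.pi -
        ((Λ ((4 * g - 1 + (k + 1 : ℕ) : ℝ), (4 * g - 1 + (k + 1 : ℕ) : ℝ) + 1)).im -
          (Λ ((4 * g - 1 + k : ℝ), (4 * g - 1 + k : ℝ) + 1)).im) := by
    intro k hk
    rw [P.vertexAngle_eq hg hΛ hexp (by omega)]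
    have hi : ((4 * g - 1 + k : ℕ) : ℝ) = 4 * g - 1 + k := by
      rw [Nat.cast_add, Nat.cast_sub (by omega)]
      push_cast
      ring
    have hk0 : (0 : ℝ) ≤ k := Nat.cast_nonneg k
    have hp : ((4 * g - 1 + k : ℝ), (4 * g - 1 + k : ℝ) + 1) ∈ chordSet (4 * g) :=
      ⟨by simp only; linarith, by simp, by simp only; linarith⟩
    have h1 := congrArg Complex.im (hflip _ hp)
    have hb1 : P.boundary hg (4 * g - 1 + k) = (P.edge hg (4 * g - 1 + k)).1.1 := by
      rw [← hi, P.boundary_natCast]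
    have hb2 : P.boundary hg ((4 * g - 1 + k) + 1) = (P.edge hg (4 * g - 1 + k)).1.2 := by
      rw [P.edge_end, ← P.boundary_natCast]
      push_cast [hi]
      rfl
    simp only [hb1, hb2] at h1
    have e1 : (((4 * g + k : ℕ) : ℝ), ((4 * g + k : ℕ) : ℝ) + 4 * g - 1) =
        ((4 * g - 1 + k : ℝ) + 1, (4 * g - 1 + k : ℝ) + 4 * g) := by
      push_cast
      ext <;> ring
    have e2 : (((4 * g + k : ℕ) : ℝ), ((4 * g + k : ℕ) : ℝ) + 1) =
        ((4 * g - 1 + (k + 1 : ℕ) : ℝ), (4 * g - 1 + (k + 1 : ℕ) : ℝ) + 1) := by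
      push_cast
      ext <;> ring
    rw [e1, h1, e2, sideArg]
    simp
    ring
  have hp0 : ((4 * g - 1 : ℝ), (4 * g - 1 : ℝ) + 1) ∈ chordSet (4 * g) :=
    ⟨by simp only; linarith, by simp, by simp only; linarith⟩
  -- What remains of the telescope is the turning of the sides over one period, an odd multiple of
  -- `2π`.
  have h2 := congrArg Complex.im (hper _ hp0)
  rw [Finset.sum_congr rfl h, Finset.sum_sub_distrib, Finset.sum_add_distrib, ← Finset.mul_sum,
    sum_edgeIndex hg (4 * g - 1) P.sideArg, Finset.sum_range_sub
      (fun k : ℕ => (Λ ((4 * g - 1 + k : ℝ), (4 * g - 1 + k : ℝ) + 1)).im)]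
  have e3 : ((4 * g - 1 + (4 * g : ℕ) : ℝ), (4 * g - 1 + (4 * g : ℕ) : ℝ) + 1) =
      ((4 * g - 1 : ℝ) + 4 * g, (4 * g - 1 : ℝ) + 1 + 4 * g) := by
    push_cast
    ext <;> ring
  rw [e3, h2]
  simp
  ring

lemma side_start_ne_end (i : Fin g × Fin 4) : (P.side i).1.1 ≠ (P.side i).1.2 := by
  obtain ⟨k, j⟩ := i
  intro h
  have hd : ∀ s t, (P.side (k, j)).2 s = (P.side (k, j)).2 t := fun s t => by
    rw [← dist_eq_zero, (P.side_geodesic (k, j)).dist_eq, h, dist_self, mul_zero]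
  have h1 : (⟨1 / 2, by norm_num, by norm_num⟩ : unitInterval) ≠ 1 := fun h => by
    have := congrArg Subtype.val h
    norm_num at this
  have h2 := (P.side_injective zero_ne_one h1 (hd _ _)).2
  have := congrArg Subtype.val h2
  norm_num at this

/-- The hyperbolic area as a boundary term. -/
lemma volume_real_eq_sum_sideArg :
    (volume : Measure ℍ).real P.F = ∑ i, (Real.pi - 2 * P.sideArg i) := by
  have hd : ∀ z ∈ upperSet, HasFDerivAt (fun z : ℂ => 1 / (z.im : ℂ))
      (oneForm (-1 / z.im ^ 2 * (-Complex.I / 2)) (-1 / z.im ^ 2 * (Complex.I / 2))) z := by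
    intro z hz
    have h := hasFDerivAt_real_comp_im (hasDerivAt_inv (ne_of_gt hz))
    refine (h.congr_of_eventuallyEq (Filter.Eventually.of_forall fun w => ?_)).congr_fderiv ?_
    · push_cast
      rw [one_div]
    · push_cast
      congr 1 <;> ring
  have hc : ContDiffOn ℝ 1 (fun z : ℂ => 1 / (z.im : ℂ)) upperSet := by
    have h1 : ContDiffOn ℝ 1 (fun z : ℂ => z.im⁻¹) upperSet :=
      Complex.imCLM.contDiff.contDiffOn.inv fun z hz => ne_of_gt hz
    refine (Complex.ofRealCLM.contDiff.comp_contDiffOn h1).congr fun z _ => ?_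
    simp
  -- Since `2i ∂(1/y)/∂z̄ = 1/y²`, Stokes for `dz / y` computes the hyperbolic area.
  have h := congrArg Complex.re (P.boundsRegion.sum_curveIntegral hc)
  rw [Complex.re_sum] at h
  rw [volume_real_eq_integral P.compact]
  have e1 : ∫ z in UpperHalfPlane.coe '' P.F, dzbar (fun z : ℂ => 1 / (z.im : ℂ)) z =
      ∫ z in UpperHalfPlane.coe '' P.F, (-Complex.I / 2) * ((1 / z.im ^ 2 : ℝ) : ℂ) := by
    refine setIntegral_congr_fun (measurableSet_coe_image P.compact)
      (forall_coe_image fun z hz => ?_)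
    simp only [dzbar_eq (hd z hz)]
    push_cast
    ring
  rw [e1, integral_const_mul, integral_complex_ofReal, ← mul_assoc] at h
  have e2 : 2 * Complex.I * (-Complex.I / 2) = 1 := by
    linear_combination -Complex.I_sq
  rw [e2, one_mul, Complex.ofReal_re] at h
  rw [← h]
  exact Finset.sum_congr rfl fun i _ =>
    (P.side_geodesic i).re_curveIntegral_inv_im (P.side_start_ne_end i)

end FundamentalPolygon

/-- The angular form at `v`, cut off near `v`. -/
def cutAngularForm (v : ℂ) (r : ℝ) (z : ℂ) : ℂ :=
  (diskCutoff v r z : ℂ) * (diskCoordDeriv v z / diskCoord v z)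

/-- The segment runs along a ray from the centre, where `dζ/ζ` is real, and the cutoff is real.
Hence a side issuing from the vertex contributes no angle. -/
lemma IsGeodesicSegment.im_curveIntegral_cutAngularForm {c : Arc} (hc : IsGeodesicSegment c)
    (r : ℝ) :
    (curveIntegral (fun z => oneForm (cutAngularForm c.1.1 r z) 0) c.toComplex).im = 0 := by
  have hcont : ContinuousOn (fun t => cutAngularForm c.1.1 r (c.toComplex.extend t) *
      derivWithin c.toComplex.extend (Set.Icc 0 1) t) (Set.Icc 0 1) :=
    ((contDiffOn_diskCutoff_mul c.1.1.im_pos r).continuousOn.comp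
      c.toComplex.continuous_extend.continuousOn fun t _ => c.extend_mem t).mul
      (Arc.continuousOn_derivWithin hc.smooth)
  rw [curveIntegral_oneForm]
  have him := Complex.imCLM.intervalIntegral_comp_comm
    (ContinuousOn.intervalIntegrable (by rwa [Set.uIcc_of_le zero_le_one]) :
      IntervalIntegrable (fun t => cutAngularForm c.1.1 r (c.toComplex.extend t) *
        derivWithin c.toComplex.extend (Set.Icc 0 1) t) volume 0 1)
  simp only [Complex.imCLM_apply] at him
  rw [← him]
  refine intervalIntegral.integral_zero_ae ?_
  have h1 : ∀ᵐ t : ℝ, t ≠ 1 := by simp [ae_iff]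
  filter_upwards [h1] with t ht1 ht
  rw [Set.uIoc_of_le zero_le_one] at ht
  rw [cutAngularForm, mul_assoc, Complex.im_ofReal_mul, diskCoordDeriv,
    hc.im_logDeriv_diskCoord ⟨ht.1, lt_of_le_of_ne ht.2 ht1⟩ rfl, mul_zero]

namespace FundamentalPolygon

variable {g : ℕ} {M : MarkedFuchsianGroup g} (P : FundamentalPolygon M)

lemma edge_add_sub_one_end (hg : 0 < g) (i : ℕ) :
    (P.edge hg (i + (4 * g - 1))).1.2 = P.vertex hg i := by
  rw [P.edge_end, show i + (4 * g - 1) + 1 = i + 4 * g by omega, vertex, edge, edgeIndex_periodic]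

/-- Compactness: the sides not containing the vertex form a compact part of a simple curve that
misses it. Cutoffs of smaller radius are therefore `1` on those sides. -/
lemma exists_forall_le_norm_diskCoord (hg : 0 < g) {i : ℕ} (hi : 0 < i) :
    ∃ r > 0, ∀ j < 4 * g - 2, ∀ t : unitInterval,
      r ≤ ‖diskCoord (P.vertex hg i) ((P.edge hg (i + 1 + j)).2 t)‖ := by
  have hK : IsCompact (Set.Icc ((i : ℝ) + 1) (i + 4 * g - 1)) := isCompact_Icc
  have hne : (Set.Icc ((i : ℝ) + 1) (i + 4 * g - 1)).Nonempty := by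
    have : (1 : ℝ) ≤ g := by exact_mod_cast hg
    exact Set.nonempty_Icc.mpr (by linarith)
  have hv := (P.vertex hg i).im_pos
  have hi' : (0 : ℝ) < i := Nat.cast_pos.mpr hi
  have him := (P.isSimpleClosed_boundary hg).im_pos
  have hc : ContinuousOn (fun t => ‖diskCoord (P.vertex hg i) (P.boundary hg t)‖)
      (Set.Icc ((i : ℝ) + 1) (i + 4 * g - 1)) := by
    have h1 : ContinuousOn (P.boundary hg) (Set.Icc ((i : ℝ) + 1) (i + 4 * g - 1)) :=
      (P.continuousOn_boundary hg).mono fun t ht => by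
        have := ht.1
        simp only [Set.mem_Ioi]
        linarith
    exact ((h1.sub continuousOn_const).div (h1.sub continuousOn_const)
      fun t _ => sub_conj_ne_zero hv (him t)).norm
  obtain ⟨t₀, ht₀, hmin⟩ := hK.exists_isMinOn hne hc
  refine ⟨‖diskCoord (P.vertex hg i) (P.boundary hg t₀)‖, ?_, fun j hj t => ?_⟩
  rotate_left
  · have h1 : ((j + 3 : ℕ) : ℝ) ≤ ((4 * g : ℕ) : ℝ) := by
      exact_mod_cast (by omega : j + 3 ≤ 4 * g)
    push_cast at h1
    have h2 := hmin (a := ((i + 1 + j : ℕ) : ℝ) + t) (by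
      push_cast
      constructor
      · linarith [t.2.1, (Nat.cast_nonneg j : (0 : ℝ) ≤ j)]
      · linarith [t.2.2])
    simp only [Set.mem_ofPred_eq] at h2
    rw [P.boundary_add hg _ t.2, Arc.extend_apply _ t.2] at h2
    exact h2
  · refine norm_pos_iff.mpr (div_ne_zero (sub_ne_zero.mpr fun h => ?_) (sub_conj_ne_zero hv (him _)))
    have h3 := (P.isSimpleClosed_boundary hg).injective _
      (mem_chordSet (g := g) hi (t := t₀) (by linarith [ht₀.1]) (by linarith [ht₀.2]))
    exact h3 (by rw [P.boundary_natCast]; exact h.symm)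

/-- The angle at a vertex is the mass of the polygon for a rotationally symmetric density
supported near the vertex. -/
lemma eventually_vertexAngle_eq (hg : 0 < g) {i : ℕ} (hi : 0 < i) :
    ∀ᶠ r in nhdsWithin (0 : ℝ) (Set.Ioi 0), P.vertexAngle hg i =
      2 * ∫ z in UpperHalfPlane.coe '' P.F, angleDensity (P.vertex hg i) r z := by
  obtain ⟨r₀, hr₀, hle⟩ := P.exists_forall_le_norm_diskCoord hg hi
  filter_upwards [Ioo_mem_nhdsGT hr₀] with r hr
  set v : ℍ := P.vertex hg i with hv
  have hS := P.boundsRegion.sum_curveIntegral (contDiffOn_diskCutoff_mul v.im_pos r)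
  rw [setIntegral_congr_fun (measurableSet_coe_image P.compact)
    (forall_coe_image fun z hz => dzbar_diskCutoff_mul v.im_pos r hz), integral_complex_ofReal] at hS
  have h1 := congrArg Complex.im hS
  rw [show ∀ x : ℝ, (2 * Complex.I * (x : ℂ)).im = 2 * x from fun x => by simp] at h1
  -- Numbering the sides from `i` makes the two sides at the vertex the first and last terms, which
  -- contribute nothing. On the others the cutoff is `1`, so the subtended angles remain.
  rw [← h1, Complex.im_sum, ← sum_edgeIndex hg i, show 4 * g = 4 * g - 2 + 1 + 1 by omega,
    Finset.sum_range_succ, Finset.sum_range_succ']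
  have hfirst : (curveIntegral (fun z => oneForm ((diskCutoff v r z : ℂ) *
      (diskCoordDeriv v z / diskCoord v z)) 0) (P.edge hg (i + 0)).toComplex).im = 0 :=
    (P.side_geodesic (edgeIndex hg i)).im_curveIntegral_cutAngularForm r
  have hlast : (curveIntegral (fun z => oneForm ((diskCutoff v r z : ℂ) *
      (diskCoordDeriv v z / diskCoord v z)) 0) (P.edge hg (i + (4 * g - 2 + 1))).toComplex).im
      = 0 := by
    have h2 := (P.side_geodesic (edgeIndex hg (i + (4 * g - 2 + 1)))).reverse
      |>.im_curveIntegral_cutAngularForm r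
    rw [curveIntegral_reverse, Complex.neg_im, neg_eq_zero] at h2
    have h3 : (P.edge hg (i + (4 * g - 2 + 1))).reverse.1.1 = v := by
      rw [show 4 * g - 2 + 1 = 4 * g - 1 by omega]
      exact P.edge_add_sub_one_end hg i
    rw [h3] at h2
    exact h2
  rw [hfirst, hlast, add_zero, add_zero, vertexAngle]
  refine Finset.sum_congr rfl fun j hj => ?_
  rw [subtendedAngle, show i + 1 + j = i + (j + 1) by omega]
  congr 1
  refine curveIntegral_congr _ fun t => ?_
  have h4 := hle j (Finset.mem_range.mp hj) t
  rw [show i + 1 + j = i + (j + 1) by omega] at h4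
  rw [diskCutoff, Arc.toComplex_apply, radialCutoff_of_one_le, Complex.ofReal_one, one_mul]
  rw [← div_pow, one_le_sq_iff₀ (div_nonneg (norm_nonneg _) hr.1.le), le_div_iff₀ hr.1, one_mul]
  exact hr.2.le.trans h4

end FundamentalPolygon

/-! ### The angle sum -/

lemma setLIntegral_upperHalfPlane {F : Set ℍ} (hF : MeasurableSet F) {f : ℂ → ENNReal}
    (hf : Measurable f) :
    ∫⁻ w in F, f w ∂volume =
      ∫⁻ z in UpperHalfPlane.coe '' F, f z * ENNReal.ofReal (1 / z.im ^ 2) := by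
  have hw : Measurable fun z : ℍ =>
      (((1 / NNReal.mk z.im z.im_pos.le : NNReal) ^ 2 : NNReal) : ENNReal) := by
    have h1 : Continuous fun z : ℍ => 1 / NNReal.mk z.im z.im_pos.le :=
      .div₀ continuous_const (UpperHalfPlane.continuous_im.subtype_mk _)
        fun w => NNReal.ne_iff.mp w.im_ne_zero
    exact measurable_coe_nnreal_ennreal.comp (h1.pow 2).measurable
  have hmp : MeasurePreserving UpperHalfPlane.coe (volume.comap UpperHalfPlane.coe)
      (volume.restrict (Set.range UpperHalfPlane.coe)) :=
    ⟨UpperHalfPlane.measurable_coe, by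
      rw [UpperHalfPlane.measurableEmbedding_coe.map_comap]⟩
  have h1 := hmp.setLIntegral_comp_emb UpperHalfPlane.measurableEmbedding_coe
    (fun z => f z * ENNReal.ofReal (1 / z.im ^ 2)) F
  rw [Measure.restrict_restrict (UpperHalfPlane.measurableEmbedding_coe.measurableSet_image.mpr hF),
    Set.inter_eq_self_of_subset_left (Set.image_subset_range _ _)] at h1
  rw [← h1, UpperHalfPlane.volume_def, restrict_withDensity hF,
    lintegral_withDensity_eq_lintegral_mul₀ hw.aemeasurable (g := fun w : ℍ => f w)
      (hf.comp UpperHalfPlane.measurable_coe).aemeasurable]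
  refine lintegral_congr fun w => ?_
  simp only [Pi.mul_apply]
  rw [mul_comm]
  congr 1
  rw [← ENNReal.ofReal_coe_nnreal]
  congr 1
  simp

/-- The angle density with respect to the hyperbolic area, as a function of the distance. -/
def angleKernel (r d : ℝ) : ℝ :=
  deriv radialCutoff (Real.tanh (d / 2) ^ 2 / r ^ 2) * (1 - Real.tanh (d / 2) ^ 2) ^ 2 /
    (4 * r ^ 2)

/-- With `ζ` the disc coordinate, `|ζ'|² = (1 - |ζ|²)² / (4y²)`. Relative to hyperbolic area the
density thus depends only on the distance, so the group carries it from one vertex to another. -/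
lemma angleDensity_eq_angleKernel (v w : ℍ) (r : ℝ) :
    angleDensity v r w = angleKernel r (dist v w) * (1 / w.im ^ 2) := by
  have hne := sub_conj_ne_zero v.im_pos w.im_pos
  have hn : 0 < ‖(w : ℂ) - (starRingEnd ℂ) v‖ := norm_pos_iff.mpr hne
  have h1 : ‖diskCoordDeriv v w‖ = 2 * v.im / ‖(w : ℂ) - (starRingEnd ℂ) v‖ ^ 2 := by
    rw [diskCoordDeriv, norm_div, norm_pow, Complex.sub_conj]
    simp [abs_of_pos v.im_pos]
  have h2 : 1 - ‖diskCoord v w‖ ^ 2 = 4 * w.im * v.im / ‖(w : ℂ) - (starRingEnd ℂ) v‖ ^ 2 := by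
    rw [diskCoord, norm_div, div_pow, eq_div_iff (by positivity), sub_mul,
      div_mul_cancel₀ _ (by positivity), one_mul, ← Complex.normSq_eq_norm_sq,
      ← Complex.normSq_eq_norm_sq, Complex.normSq_apply, Complex.normSq_apply]
    simp
    ring
  have hw := w.im_pos
  rw [angleDensity, angleKernel, ← norm_diskCoord, h2, h1]
  rcases eq_or_ne r 0 with rfl | hr
  · simp
  · field_simp
    ring

lemma continuous_angleKernel (r : ℝ) : Continuous (angleKernel r) := by
  have h1 : Continuous (deriv radialCutoff) :=
    (contDiff_radialCutoff (n := 1)).continuous_deriv le_rfl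
  have h2 : Continuous Real.tanh := by
    simp only [funext Real.tanh_eq_sinh_div_cosh]
    exact Real.continuous_sinh.div Real.continuous_cosh fun x => (Real.cosh_pos x).ne'
  unfold angleKernel
  fun_prop

lemma measurable_angleDensity (v : ℂ) (r : ℝ) : Measurable (angleDensity v r) := by
  have h1 : Measurable (deriv radialCutoff) := measurable_deriv _
  unfold angleDensity diskCoord diskCoordDeriv
  fun_prop

/-- A nonintegrable function has integral `0` by convention, while this integral is `π`. -/
lemma integrable_angleDensity {v : ℂ} (hv : 0 < v.im) {r : ℝ} (hr : 0 < r) (hr1 : r < 1) :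
    Integrable (angleDensity v r) := by
  by_contra h
  have h1 := integral_angleDensity hv hr hr1
  rw [integral_complex_ofReal, integral_undef h] at h1
  exact Real.pi_ne_zero (by exact_mod_cast h1.symm)

lemma setLIntegral_angleKernel (v : ℍ) (r : ℝ) {F : Set ℍ} (hF : MeasurableSet F) :
    ∫⁻ w in F, ENNReal.ofReal (angleKernel r (dist v w)) ∂volume =
      ∫⁻ z in UpperHalfPlane.coe '' F, ENNReal.ofReal (angleDensity v r z) := by
  have hm : Measurable fun z : ℂ => ENNReal.ofReal (angleDensity v r z * z.im ^ 2) :=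
    ENNReal.measurable_ofReal.comp ((measurable_angleDensity v r).mul (by fun_prop))
  have hk : ∀ w : ℍ, ENNReal.ofReal (angleKernel r (dist v w)) =
      ENNReal.ofReal (angleDensity v r w * (w : ℂ).im ^ 2) := fun w => by
    have := w.im_pos
    rw [angleDensity_eq_angleKernel, UpperHalfPlane.coe_im]
    congr 1
    field_simp
  simp only [hk]
  rw [setLIntegral_upperHalfPlane hF hm]
  refine setLIntegral_congr_fun (UpperHalfPlane.measurableEmbedding_coe.measurableSet_image.mpr hF)
    fun z hz => ?_
  have hz' : 0 < z.im := forall_coe_image (p := fun z => 0 < z.im) (fun z hz => hz) z hz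
  rw [← ENNReal.ofReal_mul (mul_nonneg (angleDensity_nonneg _ _ _) (sq_nonneg _))]
  congr 1
  field_simp

lemma lintegral_angleKernel_le (v : ℍ) {r : ℝ} (hr : 0 < r) (hr1 : r < 1) :
    ∫⁻ w, ENNReal.ofReal (angleKernel r (dist v w)) ∂volume ≤ ENNReal.ofReal Real.pi := by
  rw [← setLIntegral_univ, setLIntegral_angleKernel v r MeasurableSet.univ]
  refine (setLIntegral_le_lintegral _ _).trans ?_
  rw [← ofReal_integral_eq_lintegral_ofReal (integrable_angleDensity v.im_pos hr hr1)
    (Filter.Eventually.of_forall fun z => angleDensity_nonneg _ _ _)]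
  have h1 := integral_angleDensity v.im_pos hr hr1
  rw [integral_complex_ofReal] at h1
  exact ENNReal.ofReal_le_ofReal (le_of_eq (by exact_mod_cast h1))

lemma continuousOn_angleDensity {v : ℂ} (hv : 0 < v.im) (r : ℝ) :
    ContinuousOn (angleDensity v r) upperSet := by
  have h1 : Continuous (deriv radialCutoff) :=
    (contDiff_radialCutoff (n := 1)).continuous_deriv le_rfl
  have h2 : ContinuousOn (diskCoord v) upperSet := fun z hz =>
    (hasDerivAt_diskCoord hv hz).continuousAt.continuousWithinAt
  exact ((h1.comp_continuousOn ((h2.norm.pow 2).div_const _)).mul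
    ((continuousOn_diskCoordDeriv hv).norm.pow 2)).div_const _

namespace FundamentalPolygon

variable {g : ℕ} {M : MarkedFuchsianGroup g} (P : FundamentalPolygon M)

lemma ofReal_integral_angleDensity (v : ℍ) (r : ℝ) :
    ENNReal.ofReal (∫ z in UpperHalfPlane.coe '' P.F, angleDensity v r z) =
      ∫⁻ w in P.F, ENNReal.ofReal (angleKernel r (dist v w)) ∂volume := by
  rw [setLIntegral_angleKernel v r P.compact.isClosed.measurableSet,
    ofReal_integral_eq_lintegral_ofReal
      (integrableOn_coe_image P.compact (continuousOn_angleDensity v.im_pos r))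
      (Filter.Eventually.of_forall fun z => angleDensity_nonneg _ _ _)]

/-! ### The vertices form one orbit -/

/-- The vertex relations identify both ends of each side; following the boundary, all `4g` vertices
fall into one orbit. -/
lemma side_end_mem_orbit (i : Fin g × Fin 4) :
    (P.side i).1.2 ∈ MulAction.orbit M.Γ (P.side i).1.1 := by
  obtain ⟨k, j⟩ := i
  have hb : (P.b k).1.2 = ((M.α k)⁻¹ * M.comm k) • (P.b k).1.1 := by
    rw [mul_smul, P.comm_smul_b_start, P.smul_a_start]
  have ha : (P.a k).1.2 = ((M.β k)⁻¹ * (M.comm k)⁻¹) • (P.a k).1.1 := by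
    rw [mul_smul, ← P.comm_smul_b_start, inv_smul_smul, P.smul_b_start]
  fin_cases j
  · exact ⟨_, ha.symm⟩
  · refine ⟨(M.β k)⁻¹ * ((M.α k)⁻¹ * M.comm k) * M.β k, ?_⟩
    change _ • ((M.β k)⁻¹ • (P.b k).1.1) = (M.β k)⁻¹ • (P.b k).1.2
    rw [hb, mul_smul, smul_inv_smul, mul_smul]
  · refine ⟨(M.α k)⁻¹ * ((M.β k)⁻¹ * (M.comm k)⁻¹)⁻¹ * M.α k, ?_⟩
    change _ • ((M.α k)⁻¹ • (P.a k).1.2) = (M.α k)⁻¹ • (P.a k).1.1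
    rw [ha, mul_smul, smul_inv_smul, mul_smul, inv_smul_smul]
  · refine ⟨((M.α k)⁻¹ * M.comm k)⁻¹, ?_⟩
    change _ • (P.b k).1.2 = (P.b k).1.1
    rw [hb, inv_smul_smul]

lemma exists_smul_eq_vertex (hg : 0 < g) (j : ℕ) : ∃ γ : M.Γ, γ • P.vertex hg 0 = P.vertex hg j := by
  induction j with
  | zero => exact ⟨1, one_smul _ _⟩
  | succ j ih =>
    obtain ⟨γ, hγ⟩ := ih
    obtain ⟨δ, hδ⟩ := P.side_end_mem_orbit (edgeIndex hg j)
    refine ⟨δ * γ, ?_⟩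
    rw [mul_smul, hγ, ← P.edge_end]
    exact hδ

lemma volume_frontier_eq_zero : (volume : Measure ℍ) (frontier P.F) = 0 :=
  volume_eq_zero_of_coe_image P.boundsRegion.volume_frontier

/-- The translates of the polygon overlap in null sets. -/
lemma aedisjoint_preimage_smul {γ δ : M.Γ} (h : γ ≠ δ) :
    AEDisjoint (volume : Measure ℍ) {w | γ • w ∈ P.F} {w | δ • w ∈ P.F} := by
  have hnull : ∀ γ : M.Γ, (volume : Measure ℍ) {w | γ • w ∈ frontier P.F} = 0 := fun γ =>
    (measure_preimage_smul volume (γ : PSL(2, ℝ)) (frontier P.F)).trans P.volume_frontier_eq_zero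
  refine measure_mono_null (fun w hw => ?_) (measure_union_null (hnull γ) (hnull δ))
  by_contra hcon
  simp only [Set.mem_union, Set.mem_ofPred_eq, not_or] at hcon
  have h1 : γ • w ∈ interior P.F := by
    by_contra h1
    exact hcon.1 ⟨subset_closure hw.1, h1⟩
  have h2 : δ • w ∈ interior P.F := by
    by_contra h2
    exact hcon.2 ⟨subset_closure hw.2, h2⟩
  refine P.disjoint (δ * γ⁻¹) (fun h3 => h (mul_inv_eq_one.mp h3).symm) _ h1 ?_
  rwa [mul_smul, inv_smul_smul]

lemma vertexAngle_nonneg (hg : 0 < g) {i : ℕ} (hi : 0 < i) : 0 ≤ P.vertexAngle hg i := by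
  obtain ⟨r, hr⟩ := (P.eventually_vertexAngle_eq hg hi).exists
  rw [hr]
  exact mul_nonneg zero_le_two (integral_nonneg fun z => angleDensity_nonneg _ _ _)

/-- The angle sum of the polygon is at most `2π`. -/
lemma sum_vertexAngle_le (hg : 0 < g) :
    ∑ k ∈ Finset.range (4 * g), P.vertexAngle hg (4 * g + k) ≤ 2 * Real.pi := by
  have h1 : ∀ᶠ r in nhdsWithin (0 : ℝ) (Set.Ioi 0), ∀ k ∈ Finset.range (4 * g),
      P.vertexAngle hg (4 * g + k) = 2 * ∫ z in UpperHalfPlane.coe '' P.F,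
        angleDensity (P.vertex hg (4 * g + k)) r z :=
    (Filter.eventually_all_finset _).mpr fun k _ => P.eventually_vertexAngle_eq hg (by omega)
  obtain ⟨r, hr, hr0, hr1⟩ := (h1.and (Ioo_mem_nhdsGT one_pos)).exists
  rw [Finset.sum_congr rfl hr, ← Finset.mul_sum]
  refine mul_le_mul_of_nonneg_left ?_ zero_le_two
  -- Moving every vertex back to one point `p` replaces the polygon by translates and all the
  -- densities by the one at `p`.
  choose γ hγ using P.exists_smul_eq_vertex hg
  set p := P.vertex hg 0
  rw [← ENNReal.ofReal_le_ofReal_iff Real.pi_pos.le, ENNReal.ofReal_sum_of_nonneg fun k _ =>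
    integral_nonneg fun z => angleDensity_nonneg _ _ _]
  have hmeas : Measurable fun w : ℍ => ENNReal.ofReal (angleKernel r (dist p w)) :=
    ENNReal.measurable_ofReal.comp
      ((continuous_angleKernel r).comp (continuous_const.dist continuous_id)).measurable
  have hF := P.compact.isClosed.measurableSet
  have h2 : ∀ k ∈ Finset.range (4 * g),
      ENNReal.ofReal (∫ z in UpperHalfPlane.coe '' P.F,
        angleDensity (P.vertex hg (4 * g + k)) r z) =
      ∫⁻ w in {w | γ (4 * g + k) • w ∈ P.F}, ENNReal.ofReal (angleKernel r (dist p w)) := by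
    intro k _
    have hmeas' : Measurable fun w : ℍ =>
        ENNReal.ofReal (angleKernel r (dist (P.vertex hg (4 * g + k)) w)) :=
      ENNReal.measurable_ofReal.comp
        ((continuous_angleKernel r).comp (continuous_const.dist continuous_id)).measurable
    rw [P.ofReal_integral_angleDensity, ← (measurePreserving_smul (γ (4 * g + k) : PSL(2, ℝ))
      (volume : Measure ℍ)).setLIntegral_comp_preimage hF hmeas']
    refine lintegral_congr fun w => ?_
    rw [← hγ (4 * g + k)]
    exact congrArg (fun d => ENNReal.ofReal (angleKernel r d)) (dist_smul_smul _ _ _)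
  rw [Finset.sum_congr rfl h2, ← lintegral_biUnion_finset₀]
  · exact (setLIntegral_le_lintegral _ _).trans (lintegral_angleKernel_le p hr0 hr1)
  · intro k hk l hl hkl
    -- Distinct vertices require distinct group elements, so the translates overlap in null sets and
    -- their masses add up to at most the total mass `π`.
    refine P.aedisjoint_preimage_smul fun h => ?_
    rw [Finset.coe_range, Set.mem_Iio] at hk hl
    refine P.vertex_ne hg (i := 4 * g + k) (j := 4 * g + l) (fun h3 => hkl ?_) ?_
    · exact Nat.ModEq.eq_of_lt_of_lt (Nat.ModEq.add_left_cancel' _ h3) hk hl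
    · rw [← hγ, ← hγ, h]
  · intro k _
    exact ((measurePreserving_smul (γ (4 * g + k) : PSL(2, ℝ))
      (volume : Measure ℍ)).measurable hF).nullMeasurableSet

end FundamentalPolygon

/-- The integral of `h''/h'` along a path, `h` a Möbius transformation, is a logarithm of the
quotient of the values of `h'` at the end points. -/
lemma exp_curveIntegral_preSchwarzian {c : Arc} (hc : c.IsSmooth) (γ : PSL(2, ℝ)) :
    Complex.exp (curveIntegral (fun z => oneForm (preSchwarzian γ z) 0) c.toComplex) =
      deriv (mob γ) c.1.2 / deriv (mob γ) c.1.1 := by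
  obtain ⟨L, hL, hexp⟩ := exists_continuousOn_log (U := upperSet) (convex_halfSpace_im_gt 0) isOpen_upperSet
    ⟨Complex.I, by simp [upperSet]⟩ (differentiableOn_deriv_mob γ).continuousOn
    fun z hz => deriv_mob_ne_zero γ hz
  have h := curveIntegral_logDeriv hc (q := deriv (mob γ)) (q' := deriv (deriv (mob γ)))
    (fun z hz => hasDerivAt_deriv_mob γ hz)
    ((differentiableOn_deriv_mob γ).deriv isOpen_upperSet).continuousOn
    (L := fun t => L (c.toComplex.extend t))
    (hL.comp c.toComplex.continuous_extend.continuousOn fun t _ => c.extend_mem t)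
    (fun t _ => hexp _ (c.extend_mem t))
  simp only [preSchwarzian]
  rw [h, Complex.exp_sub, hexp _ (c.extend_mem 1), hexp _ (c.extend_mem 0), Path.extend_one,
    Path.extend_zero]

lemma diskCoord_injective {v w w' : ℍ} (h : diskCoord v w = diskCoord v w') : w = w' := by
  rw [diskCoord, diskCoord, div_eq_div_iff (sub_conj_ne_zero v.im_pos w.im_pos)
    (sub_conj_ne_zero v.im_pos w'.im_pos)] at h
  have hv := sub_conj_ne_zero v.im_pos v.im_pos
  refine UpperHalfPlane.ext (mul_right_cancel₀ hv ?_)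
  linear_combination h

/-- Two geodesic segments which leave a point in the same direction share an interior point. -/
lemma IsGeodesicSegment.exists_common_point {c d : Arc} (hc : IsGeodesicSegment c) (hd : IsGeodesicSegment d)
    (h0 : c.1.1 = d.1.1) (hc1 : c.1.1 ≠ c.1.2) (hd1 : d.1.1 ≠ d.1.2) {r : ℝ} (hr : 0 < r)
    (h : diskCoord c.1.1 c.1.2 = r * diskCoord d.1.1 d.1.2) :
    ∃ s t : unitInterval, 0 < (s : ℝ) ∧ (s : ℝ) < 1 ∧ 0 < (t : ℝ) ∧ (t : ℝ) < 1 ∧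
      c.2 s = d.2 t := by
  obtain ⟨e, he, hce⟩ := hc.exists_direction
  obtain ⟨e', he', hde⟩ := hd.exists_direction
  have hlc : 0 < dist c.1.1 c.1.2 := dist_pos.mpr hc1
  have hld : 0 < dist d.1.1 d.1.2 := dist_pos.mpr hd1
  set x := dist c.1.1 c.1.2
  set y := dist d.1.1 d.1.2
  have hx : 0 < Real.tanh (x / 2) := by
    rw [Real.tanh_eq_sinh_div_cosh]
    exact div_pos (Real.sinh_pos_iff.mpr (by positivity)) (Real.cosh_pos _)
  have hy : 0 < Real.tanh (y / 2) := by
    rw [Real.tanh_eq_sinh_div_cosh]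
    exact div_pos (Real.sinh_pos_iff.mpr (by positivity)) (Real.cosh_pos _)
  have hee : e = e' := by
    have h1 := hce 1
    have h2 := hde 1
    simp only [c.2.target, d.2.target, Set.Icc.coe_one, one_mul] at h1 h2
    rw [h1, h2] at h
    have h3 := congrArg norm h
    simp only [norm_mul, he, he', Complex.norm_real, Real.norm_of_nonneg hx.le,
      Real.norm_of_nonneg hy.le, Real.norm_of_nonneg hr.le, one_mul] at h3
    have h4 : (Real.tanh (x / 2) : ℂ) ≠ 0 := by exact_mod_cast hx.ne'
    have h5 : e * (Real.tanh (x / 2) : ℂ) = e' * (Real.tanh (x / 2) : ℂ) := by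
      rw [h, h3]
      push_cast
      ring
    exact mul_right_cancel₀ h4 h5
  -- Points at the same distance `m` on the same ray coincide; half the shorter length keeps them
  -- interior to both segments.
  set m := min x y / 2
  have hm : 0 < m := by have := lt_min hlc hld; positivity
  have hmx : m < x := by have := min_le_left x y; simp only [m] at hm ⊢; linarith
  have hmy : m < y := by have := min_le_right x y; simp only [m] at hm ⊢; linarith
  have hs1 : m / x < 1 := (div_lt_one hlc).mpr hmx
  have ht1 : m / y < 1 := (div_lt_one hld).mpr hmy
  have hs0 : 0 < m / x := div_pos hm hlc
  have ht0 : 0 < m / y := div_pos hm hld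
  refine ⟨⟨m / x, hs0.le, hs1.le⟩, ⟨m / y, ht0.le, ht1.le⟩, hs0, hs1, ht0, ht1, ?_⟩
  have h1 := hce ⟨m / x, hs0.le, hs1.le⟩
  have h2 := hde ⟨m / y, ht0.le, ht1.le⟩
  simp only [div_mul_cancel₀ _ hlc.ne', div_mul_cancel₀ _ hld.ne'] at h1 h2
  rw [← hee] at h2
  have h3 := congrArg (fun v : ℍ => diskCoord v (c.2 ⟨m / x, hs0.le, hs1.le⟩)) h0
  exact diskCoord_injective (h3.symm.trans (h1.trans h2.symm))

namespace FundamentalPolygon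

variable {g : ℕ} {M : MarkedFuchsianGroup g} (P : FundamentalPolygon M)

/-! ### The area is a multiple of `2π` -/

/-- By the chain rule the derivatives of the Möbius maps form a multiplicative cocycle. The
telescoping identity, taken in `Additive ℂˣ` with zero coboundary, makes the product of the end
point ratios equal to `1`. -/
lemma prod_exp_curveIntegral_preSchwarzian (hg : 0 < g) :
    Complex.exp (∑ k,
      (curveIntegral (fun z => oneForm (preSchwarzian ((M.β k : PSL(2, ℝ))⁻¹) z) 0)
          (P.b k).toComplex
        - curveIntegral (fun z => oneForm (preSchwarzian ((M.α k : PSL(2, ℝ))⁻¹) z) 0)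
          (P.a k).toComplex)) = 1 := by
  have hU : ∀ (γ : M.Γ) (z : ℍ), deriv (mob ((γ : PSL(2, ℝ))⁻¹)) z ≠ 0 := fun γ z =>
    deriv_mob_ne_zero _ (coe_mem_upperSet z)
  let l : M.Γ → ℍ → Additive ℂˣ := fun γ z => Additive.ofMul (Units.mk0 _ (hU γ z))
  have hl : l 1 = 0 := by
    funext z
    refine congrArg Additive.ofMul (Units.ext ?_)
    simp [deriv_mob_one (coe_mem_upperSet z)]
  have h := P.sum_coboundary hg l hl (fun _ _ _ => 0) fun γ₁ γ₂ z => by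
    have h1 : l (γ₁ * γ₂) z = l γ₂ (γ₁⁻¹ • z) + l γ₁ z := by
      refine congrArg Additive.ofMul (Units.ext ?_)
      simp only [Units.val_mul, Units.val_mk0]
      have := deriv_mob_mul ((γ₂ : PSL(2, ℝ))⁻¹) ((γ₁ : PSL(2, ℝ))⁻¹) (coe_mem_upperSet z)
      rw [mob_coe] at this
      rw [Subgroup.coe_mul, mul_inv_rev, this]
      rfl
    rw [h1]
    abel
  simp only [ite_self, Finset.sum_const_zero, sub_self, add_zero] at h
  have h2 := congrArg (fun x : Additive ℂˣ => ((Additive.toMul x : ℂˣ) : ℂ)) h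
  simp only [toMul_sum, toMul_sub, toMul_zero, Units.val_one, Units.coe_prod] at h2
  rw [Complex.exp_sum, h2]
  refine Finset.prod_congr rfl fun k _ => ?_
  rw [Complex.exp_sub, exp_curveIntegral_preSchwarzian (P.b_smooth k),
    exp_curveIntegral_preSchwarzian (P.a_smooth k)]
  simp [l]

/-- Integration by parts with `φ = φ_hyp` and `σ = 1` expresses the area as minus the imaginary part
of the boundary sum of integrals of `h''/h'`, whose exponential is `1`. -/
lemma exists_volume_real_eq (hg : 0 < g) :
    ∃ n : ℤ, (volume : Measure ℍ).real P.F = n * (2 * Real.pi) := by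
  have h1 : (fun _ => 1 : ℍ → ℝ) ∈ smoothFunctions M.Γ := ⟨contDiffOn_const, fun _ _ _ => rfl⟩
  have h := P.im_kappaPairing (phiHyp_mem M.Γ) h1
  have hgrad : ∀ z, gradPair phiHyp (fun _ => 1) z = 0 := fun z => by
    have : coordC (fun _ => 1) = fun _ => 1 := by
      funext z
      simp [coordC, coord]
    simp [gradPair, dz, this]
  have e : ∫ z in UpperHalfPlane.coe '' P.F, (gradPair phiHyp (fun _ => 1) z +
      2 * coord (fun _ => (1 : ℝ)) z * (dz (dzbar (coordC phiHyp)) z).re) =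
      (volume : Measure ℍ).real P.F := by
    rw [volume_real_eq_integral P.compact]
    refine setIntegral_congr_fun (measurableSet_coe_image P.compact)
      (forall_coe_image fun z hz => ?_)
    have hz' : z.im ≠ 0 := ne_of_gt hz
    have e1 : dz (dzbar (coordC phiHyp)) z = ((1 / (2 * z.im ^ 2) : ℝ) : ℂ) := by
      rw [dz_dzbar_phiHyp hz]
      push_cast
      rfl
    simp only [hgrad, e1, Complex.ofReal_re, coord]
    field_simp
    ring
  rw [e] at h
  obtain ⟨n, hn⟩ := Complex.exp_eq_one_iff.mp (P.prod_exp_curveIntegral_preSchwarzian hg)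
  refine ⟨-n, ?_⟩
  have h2 := congrArg Complex.im hn
  have hk : 1 / 2 * (P.kappaPairing fun _ => 1).im = n * (2 * Real.pi) := by
    have e2 : ((n : ℂ) * (2 * Real.pi * Complex.I)).im = n * (2 * Real.pi) := by
      simp
    rw [← e2, ← h2, kappaPairing, Complex.im_sum, Complex.im_sum, Finset.mul_sum]
    refine Finset.sum_congr rfl fun k _ => ?_
    have e3 := im_curveIntegral_eq (P.b_smooth k) (M.β k : PSL(2, ℝ)) h1.1
    have e4 := im_curveIntegral_eq (P.a_smooth k) (M.α k : PSL(2, ℝ)) h1.1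
    simp only [coordC, coord, Complex.ofReal_one, one_mul, one_smul] at e3 e4 ⊢
    rw [Complex.sub_im, Complex.sub_im, e3, e4]
    ring
  rw [hk] at h
  push_cast
  linarith

/-! ### The angles are positive -/

/-- If the angle were zero, both sides at the vertex would leave in the same direction. Being
geodesic they would share an interior point, contradicting simplicity of the boundary. -/
lemma vertexAngle_pos (hg : 0 < g) {i : ℕ} (hi : 0 < i) : 0 < P.vertexAngle hg i := by
  refine (P.vertexAngle_nonneg hg hi).lt_of_ne' fun h0 => ?_
  obtain ⟨Λ, -, hΛ, hexp, -, -⟩ := (P.isSimpleClosed_boundary hg).exists_rotation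
  rw [P.vertexAngle_eq hg hΛ hexp hi, sub_eq_zero] at h0
  have hg' : (1 : ℝ) ≤ g := by exact_mod_cast hg
  have e1 := hexp _ (mem_chordSet hi (t := i + 4 * g - 1) (by linarith) (by linarith))
  have e2 := hexp _ (mem_chordSet hi (t := i + 1) (by linarith) (by linarith))
  have b1 : P.boundary hg (i + 4 * g - 1) = P.vertex hg (i + (4 * g - 1)) := by
    rw [← P.boundary_natCast]
    congr 1
    push_cast [Nat.cast_sub (show 1 ≤ 4 * g by omega)]
    ring
  have b2 : P.boundary hg (i + 1) = P.vertex hg (i + 1) := by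
    rw [← P.boundary_natCast]
    push_cast
    rfl
  simp only [b1, b2, P.boundary_natCast, geodesicDirection_eq] at e1 e2
  set c : Arc := (P.edge hg (i + (4 * g - 1))).reverse
  have hc0 : c.1.1 = P.vertex hg i := P.edge_add_sub_one_end hg i
  have hdir : diskCoord c.1.1 c.1.2 =
      (Real.exp ((Λ (i, i + 4 * g - 1)).re - (Λ (i, i + 1)).re) : ℝ) *
        diskCoord (P.edge hg i).1.1 (P.edge hg i).1.2 := by
    rw [hc0, P.edge_end]
    refine mul_left_cancel₀ Complex.I_ne_zero ?_
    change Complex.I * diskCoord (P.vertex hg i) (P.vertex hg (i + (4 * g - 1))) = _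
    rw [mul_left_comm, ← e1, ← e2, Complex.ofReal_exp, ← Complex.exp_add]
    congr 1
    apply Complex.ext <;> simp [h0]
  obtain ⟨s, t, hs0, hs1, ht0, ht1, hst⟩ := (P.side_geodesic _).reverse.exists_common_point
    (P.side_geodesic _) hc0 (P.side_start_ne_end _).symm
    (P.side_start_ne_end _) (Real.exp_pos _) hdir
  have h1 := (P.side_injective (s := unitInterval.symm s) (t := t)
    (fun h => by
      have := congrArg Subtype.val h
      simp only [unitInterval.coe_symm_eq, Set.Icc.coe_one] at this
      linarith)
    (fun h => by
      have := congrArg Subtype.val h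
      simp only [Set.Icc.coe_one] at this
      linarith) hst).1
  have h2 : i + (4 * g - 1) ≡ i + 0 [MOD 4 * g] := modEq_of_edgeIndex_eq h1
  have h3 := Nat.ModEq.eq_of_lt_of_lt (Nat.ModEq.add_left_cancel' _ h2) (by omega) (by omega)
  omega

/-- The Gauss–Bonnet theorem for the fundamental polygon. -/
theorem volume_real_eq (hg : 2 ≤ g) :
    (volume : Measure ℍ).real P.F = 2 * Real.pi * (2 * (g : ℝ) - 2) := by
  have hg0 : 0 < g := by omega
  have hg2 : (2 : ℝ) ≤ g := by exact_mod_cast hg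
  have hπ := Real.pi_pos
  obtain ⟨m, hm⟩ := P.exists_sum_vertexAngle hg0
  obtain ⟨n, hn⟩ := P.exists_volume_real_eq hg0
  have hle := P.sum_vertexAngle_le hg0
  have hpos : 0 < ∑ k ∈ Finset.range (4 * g), P.vertexAngle hg0 (4 * g + k) :=
    Finset.sum_pos (fun k _ => P.vertexAngle_pos hg0 (by omega)) ⟨0, by simp; omega⟩
  have harea : (volume : Measure ℍ).real P.F = 4 * g * Real.pi - 2 * ∑ i, P.sideArg i := by
    rw [P.volume_real_eq_sum_sideArg, Finset.sum_sub_distrib, ← Finset.mul_sum]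
    simp
    ring
  have harea0 : 0 ≤ (volume : Measure ℍ).real P.F := measureReal_nonneg
  -- This bounds the area by `4gπ`, so that `A + I ≤ (4g + 2)π`.
  have harg : 0 ≤ ∑ i, P.sideArg i := Finset.sum_nonneg fun i _ => by
    rw [sideArg, Complex.arg_nonneg_iff]
    exact (im_sub_conj_pos (P.side i).1.1.im_pos (P.side i).1.2.im_pos).le
  set A := (volume : Measure ℍ).real P.F
  set I := ∑ k ∈ Finset.range (4 * g), P.vertexAngle hg0 (4 * g + k)
  have hAI : A + I = (4 * g - 2) * (2 * m + 1) * Real.pi := by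
    rw [hm, harea]
    ring
  -- If `m ≤ -1`, then `A + I` would be negative; if `m ≥ 1`, it would be at least `(12g - 6)π`,
  -- which exceeds `(4g + 2)π` once `g ≥ 2`.
  have hm0 : m = 0 := by
    have h1 : -1 < m := by
      by_contra h
      have h' : (m : ℝ) ≤ -1 := by exact_mod_cast not_lt.mp h
      nlinarith [mul_nonneg (show (0 : ℝ) ≤ 4 * g - 2 by linarith) (show 0 ≤ -1 - (m : ℝ) by linarith)]
    have h2 : m < 1 := by
      by_contra h
      have h' : (1 : ℝ) ≤ m := by exact_mod_cast not_lt.mp h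
      have h3 : (4 * g - 2) * 3 ≤ (4 * g - 2) * (2 * (m : ℝ) + 1) :=
        mul_le_mul_of_nonneg_left (by linarith) (by linarith)
      have h4 := mul_le_mul_of_nonneg_right h3 hπ.le
      nlinarith
    omega
  rw [hm0, Int.cast_zero, mul_zero, zero_add, mul_one] at hAI
  -- With `A = 2πn` the angle sum is a multiple of `2π`; as `0 < I ≤ 2π`, the multiple is `1`.
  have hI : I = ((2 * g - 1 - n : ℤ) : ℝ) * (2 * Real.pi) := by
    push_cast
    linarith
  have h2 : (0 : ℝ) < ((2 * g - 1 - n : ℤ) : ℝ) := by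
    rw [hI] at hpos
    exact pos_of_mul_pos_left hpos (by positivity)
  have h3 : ((2 * g - 1 - n : ℤ) : ℝ) ≤ 1 := by
    rw [hI] at hle
    by_contra h
    nlinarith [not_le.mp h]
  have h4 : (0 : ℤ) < 2 * g - 1 - n := by exact_mod_cast h2
  have h5 : (2 * g - 1 - n : ℤ) ≤ 1 := by exact_mod_cast h3
  have h6 : n = 2 * g - 2 := by omega
  rw [hn, h6]
  push_cast
  ring

end FundamentalPolygon

end FuchsianLiouville

end

/-! ### Assembly of the theorem. -/

theorem corollary2p1 (g : ℕ) (hg : 2 ≤ g) (M : MarkedFuchsianGroup g)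
    (P : FundamentalPolygon M) :
    -- an antiderivative `l` of `θ[φ_hyp]` exists, and with any choice of it:
    (∃ l : M.Γ → ℍ → ℂ, IsPrimitive M.Γ l) ∧
    ∀ l : M.Γ → ℍ → ℂ, IsPrimitive M.Γ l →
      -- `S` is the (real) value of `(i/2) ⟨Ψ[φ], Σ⟩`
      (∀ φ ∈ conformalMetrics M.Γ, (P.liouvilleAction l φ : ℂ) = P.evaluation l φ) ∧
      -- the first variation of `S`
      (∀ φ ∈ conformalMetrics M.Γ, ∀ σ ∈ smoothFunctions M.Γ,
        HasDerivAt (fun t : ℝ => P.liouvilleAction l (φ + t • σ))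
          (∫ z in (UpperHalfPlane.coe '' P.F),
            coord (fun w => (curvature φ w + 1) * σ w * Real.exp (φ w)) z) 0) ∧
      -- the Euler-Lagrange equation is the Liouville equation
      (∀ φ ∈ conformalMetrics M.Γ,
        IsCriticalPoint M.Γ (P.liouvilleAction l) φ ↔ ∀ z : ℍ, curvature φ z = -1) ∧
      -- the hyperbolic metric is the critical point
      phiHyp ∈ conformalMetrics M.Γ ∧
      (∀ φ ∈ conformalMetrics M.Γ,
        IsCriticalPoint M.Γ (P.liouvilleAction l) φ ↔ φ = phiHyp) ∧
      -- it is non-degenerate, with positive definite second variation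
      (∃ B : LinearMap.BilinForm ℝ (smoothFunctions M.Γ),
        IsSecondVariation M.Γ (P.liouvilleAction l) phiHyp B ∧ B.IsSymm ∧ B.Nondegenerate ∧
          ∀ σ : smoothFunctions M.Γ, σ ≠ 0 → 0 < B σ σ) ∧
      -- the critical value is twice the hyperbolic area, that is, `4π(2g - 2)`
      P.liouvilleAction l phiHyp = 2 * (volume : Measure ℍ).real P.F ∧
      2 * (volume : Measure ℍ).real P.F = 4 * Real.pi * (2 * (g : ℝ) - 2) := by
  have hg0 : 0 < g := by omega
  refine ⟨exists_isPrimitive M.Γ, fun l hl => ⟨fun φ hφ => ?_, fun φ hφ σ hσ => ?_,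
    fun φ hφ => P.isCriticalPoint_iff_curvature hg0 hl hφ, phiHyp_mem M.Γ,
    fun φ hφ => P.isCriticalPoint_iff_eq_phiHyp hg0 hl hφ,
    ⟨P.hessian, P.isSecondVariation_hessian hg0 hl, P.hessian_isSymm, P.hessian_nondegenerate,
      fun σ hσ => P.hessian_pos hσ⟩, P.liouvilleAction_phiHyp hg0 hl, ?_⟩⟩
  · rw [FundamentalPolygon.liouvilleAction, P.evaluation_eq hg0 hl hφ.1, Complex.ofReal_re]
  · rw [← P.firstVariation_eq hφ hσ]
    exact P.hasDerivAt_liouvilleAction hg0 hl hφ.1 hσ.1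
  · rw [P.volume_real_eq hg]
    ring
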